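/- Let $N\ge 2$ be an integer and $\kappa>-\frac1N$ a real number. Write $(a)_n=a(a+1)\cdots(a+n-1)$. For polynomials $f$ in $x=(x_1,\dots,x_N)$ let $$T_if(x)=\frac{\partial f}{\partial x_i}(x)+\kappa\sum_{j\ne i}\frac{f(x)-f(x(i,j))}{x_i-x_j},$$ where $x(i,j)$ is $x$ with the entries $x_i,x_j$ interchanged; these operators commute. Put $\langle f,g\rangle_\kappa=f(T_1,\dots,T_N)g(x)|_{x=0}$, and, with $w_\kappa(x)=\prod_{i<j}|x_i-x_j|^{2\kappa}$, $d\mu=(2\pi)^{-N/2}e^{-|x|^2/2}dx$ on $\mathbb R^N$ and $m$ the normalized surface measure on the unit sphere $S_{N-1}$ of $\mathbb{R}^N$, $$\langle f,g\rangle_G=\frac{\int_{\mathbb R^N} fg\,w_\kappa\,d\mu}{\int_{\mathbb R^N} w_\kappa\,d\mu},\qquad \langle f,g\rangle_S=\frac{\int_{S_{N-1}} fg\,w_\kappa\,dm}{\int_{S_{N-1}} w_\kappa\,dm}.$$ Let $p_n(x_i;x)$ be the coefficient of $r^n$ in $(1-rx_i)^{-1}\prod_{j=1}^N(1-rx_j)^{-\kappa}$.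 Expand, as formal power series in $t$ with coefficients polynomial in $s,p_1,p_2$, $$\frac{1-st(p_1+p_2)+t^2p_1p_2}{(1-2stp_1+t^2p_1^2)(1-2stp_2+t^2p_2^2)}=\sum_{n,j}t^ns^j\phi_{nj},\qquad \frac{t(p_1-p_2)}{(1-2stp_1+t^2p_1^2)(1-2stp_2+t^2p_2^2)}=\sum_{n,j}t^ns^j\psi_{nj},$$ and regard $\phi_{nj},\psi_{nj}$ as polynomials in $x$ by replacing each monomial $p_1^ap_2^b$ by $p_a(x_1;x)\,p_b(x_2;x)$. Let $g_0^o=g_0^e=1$ and, for $n\ge0$, $$g^o_{n+1}(v)=(v+3n+1)g^o_n(v)-n(2n-1)g^o_{n-1}(v),\qquad g^e_{n+1}(v)=(v+3n+2)g^e_n(v)-n(2n+1)g^e_{n-1}(v).$$ For $m\ge 0$ let $$h_{2m}^+=\sum_{j=0}^m2^{-j}\frac{g_j^o(N\kappa-\kappa+m)}{(N\kappa+m+1)_j}\phi_{2m,2j},\qquad h_{2m+1}^+=\sum_{j=0}^m2^{-j}\frac{g_j^e(N\kappa-\kappa+m+1)}{(N\kappa+m+2)_j}\phi_{2m+1,2j+1},$$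 $$h_{2m}^-=\sum_{j=0}^{m-1}2^{-j}\frac{g_j^e(N\kappa-\kappa+m)}{(N\kappa+m+2)_j}\psi_{2m,2j+1},\qquad h_{2m+1}^-=\sum_{j=0}^m2^{-j}\frac{g_j^o(N\kappa-\kappa+m)}{(N\kappa+m+2)_j}\psi_{2m+1,2j}.$$ For $0\le j\le\lfloor n/2\rfloor$ let $$S(n,j;\alpha,\beta)=\sum_{\ell=0}^{\lfloor n/2\rfloor}\ \sum_{i=\max(0,\ell+j-\lfloor n/2\rfloor)}^{\min(\ell,j)}\frac{(\alpha+1)_\ell\,(2\alpha+\beta+2\ell)_{n-2\ell-j+i}}{i!\,(\ell-i)!\,(j-i)!\,(n-2\ell-2j+2i)!}(-1)^{\ell+j}2^{n-j+i}.$$ Write $\zeta=(1+\mathrm i,1-\mathrm i,0,\dots,0)\in\mathbb C^N$. Then, for every $m\ge0$ (for every $m\ge1$ in the formula for $h_{2m}^-$), the polynomials obtained on the right by applying the operators being constants, $$\begin{aligned} \langle h_{2m}^+,h_{2m}^+\rangle_\kappa&=2^{-2m}\,h_{2m}^+(\zeta)\,(T_1+T_2)^{2m}h_{2m}^+\\ &=2^{-m}\sum_{j=0}^m2^{-j}\frac{g_j^o(N\kappa-\kappa+m)}{(N\kappa+m+1)_j}S(2m,m-j;\kappa,1)\;(N\kappa-\kappa+1)_m(N\kappa+1)_m,\\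 \langle h_{2m+1}^+,h_{2m+1}^+\rangle_\kappa&=2^{-2m-1}\,h_{2m+1}^+(\zeta)\,(T_1+T_2)^{2m+1}h_{2m+1}^+\\ &=2^{-m}\sum_{j=0}^m2^{-j}\frac{g_j^e(N\kappa-\kappa+m+1)}{(N\kappa+m+2)_j}S(2m+1,m-j;\kappa,1)\;(N\kappa-\kappa+1)_m(N\kappa+1)_{m+1},\\ \langle h_{2m}^-,h_{2m}^-\rangle_\kappa&=-\mathrm i\,2^{-2m}\,h_{2m}^-(\zeta)\,(T_1+T_2)^{2m-1}(T_1-T_2)h_{2m}^-\\ &=2^{2-m}\sum_{j=0}^{m-1}2^{-j}\frac{g_j^e(N\kappa-\kappa+m)}{(N\kappa+m+2)_j}S(2m-1,m-1-j;\kappa,2)\;(N\kappa-\kappa+1)_{m-1}(N\kappa+1)_{m+1},\\ \langle h_{2m+1}^-,h_{2m+1}^-\rangle_\kappa&=-\mathrm i\,2^{-2m-1}\,h_{2m+1}^-(\zeta)\,(T_1+T_2)^{2m}(T_1-T_2)h_{2m+1}^-\\ &=2^{1-m}\sum_{j=0}^m2^{-j}\frac{g_j^o(N\kappa-\kappa+m)}{(N\kappa+m+2)_j}S(2m,m-j;\kappa,2)\;(N\kappa-\kappa+1)_m(N\kappa+1)_{m+1}.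 \end{aligned}$$ Moreover, for every $n\ge0$ and $h\in\{h_n^+,h_n^-\}$, the integrals in $\langle h,h\rangle_G$ and $\langle h,h\rangle_S$ (those of $w_\kappa$ included) converge absolutely, and $$\langle h,h\rangle_G=\langle h,h\rangle_\kappa=2^n\left(\tfrac N2\left((N-1)\kappa+1\right)\right)_n\langle h,h\rangle_S.$$ -/

import Mathlib

open MeasureTheory

noncomputable section

namespace PlanarDunkl

/-- Interchange of the variables `x_i` and `x_j` in a polynomial. -/
def swapVars {N : ℕ} (i j : Fin N) :
    MvPolynomial (Fin N) ℝ →ₐ[ℝ] MvPolynomial (Fin N) ℝ :=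
  MvPolynomial.rename (Equiv.swap i j)

theorem X_sub_X_dvd {N : ℕ} (i j : Fin N) (f : MvPolynomial (Fin N) ℝ) :
    (MvPolynomial.X i - MvPolynomial.X j) ∣ (f - swapVars i j f) := by
  induction f using MvPolynomial.induction_on with
  | C a => simp [swapVars]
  | add p q hp hq =>
    have h : p + q - swapVars i j (p + q)
        = (p - swapVars i j p) + (q - swapVars i j q) := by
      rw [map_add]; ring
    rw [h]
    exact dvd_add hp hq
  | mul_X p k hp =>
    have hk : (MvPolynomial.X i - MvPolynomial.X j : MvPolynomial (Fin N) ℝ) ∣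
        (MvPolynomial.X k - swapVars i j (MvPolynomial.X k)) := by
      simp only [swapVars, MvPolynomial.rename_X]
      rcases eq_or_ne k i with rfl | hki
      · simp
      · rcases eq_or_ne k j with rfl | hkj
        · rw [Equiv.swap_apply_right]
          exact ⟨-1, by ring⟩
        · rw [Equiv.swap_apply_of_ne_of_ne hki hkj]
          simp
    have h : p * MvPolynomial.X k - swapVars i j (p * MvPolynomial.X k)
        = (p - swapVars i j p) * MvPolynomial.X k
          + swapVars i j p * (MvPolynomial.X k - swapVars i j (MvPolynomial.X k)) := by
      rw [map_mul]; ring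
    rw [h]
    exact dvd_add (Dvd.dvd.mul_right hp _) (Dvd.dvd.mul_left hk _)

/-- The divided difference `(f(x) - f(x(i,j))) / (x_i - x_j)`; only used for `i ≠ j`. -/
def divDiffFun {N : ℕ} (i j : Fin N) (f : MvPolynomial (Fin N) ℝ) :
    MvPolynomial (Fin N) ℝ :=
  (X_sub_X_dvd i j f).choose

theorem divDiffFun_spec {N : ℕ} (i j : Fin N) (f : MvPolynomial (Fin N) ℝ) :
    f - swapVars i j f = (MvPolynomial.X i - MvPolynomial.X j) * divDiffFun i j f :=
  (X_sub_X_dvd i j f).choose_spec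

theorem X_sub_X_ne_zero {N : ℕ} {i j : Fin N} (h : i ≠ j) :
    (MvPolynomial.X i - MvPolynomial.X j : MvPolynomial (Fin N) ℝ) ≠ 0 :=
  sub_ne_zero.2 fun h' => h (MvPolynomial.X_injective h')

/-- The divided difference as a linear map, for `i ≠ j`. -/
def divDiff {N : ℕ} (i j : Fin N) (h : i ≠ j) :
    MvPolynomial (Fin N) ℝ →ₗ[ℝ] MvPolynomial (Fin N) ℝ where
  toFun := divDiffFun i j
  map_add' f g := by
    apply mul_left_cancel₀ (X_sub_X_ne_zero h)
    rw [mul_add, ← divDiffFun_spec, ← divDiffFun_spec, ← divDiffFun_spec, map_add]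
    ring
  map_smul' c f := by
    apply mul_left_cancel₀ (X_sub_X_ne_zero h)
    rw [RingHom.id_apply, mul_smul_comm, ← divDiffFun_spec, ← divDiffFun_spec, map_smul,
      smul_sub]

/-- The Dunkl operator `T_i` of type `A` with parameter `κ`. -/
def dunklT {N : ℕ} (κ : ℝ) (i : Fin N) : Module.End ℝ (MvPolynomial (Fin N) ℝ) :=
  (MvPolynomial.pderiv i).toLinearMap
    + κ • ∑ j : Fin N, if h : i ≠ j then divDiff i j h else 0

/-- The operator `f(T_1, …, T_N)`: each monomial `x^α` of `f` is replaced by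
`T_1^{α_1} ⋯ T_N^{α_N}`. (The `T_i` commute, so the order is immaterial.) -/
def polyOfT {N : ℕ} (κ : ℝ) :
    MvPolynomial (Fin N) ℝ →ₗ[ℝ] Module.End ℝ (MvPolynomial (Fin N) ℝ) :=
  (MvPolynomial.basisMonomials (Fin N) ℝ).constr ℝ
    fun α => (List.ofFn fun i : Fin N => dunklT κ i ^ α i).prod

/-- The pairing `⟨f, g⟩_κ = f(T_1, …, T_N) g(x) |_{x = 0}`. -/
def pairing {N : ℕ} (κ : ℝ) (f g : MvPolynomial (Fin N) ℝ) : ℝ :=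
  MvPolynomial.eval (0 : Fin N → ℝ) (polyOfT κ f g)

/-- The Pochhammer symbol `(a)_n = a (a+1) ⋯ (a+n-1)`. -/
def poch (a : ℝ) (n : ℕ) : ℝ := (ascPochhammer ℝ n).eval a

/-- The power series `(1 - r a)^{-κ} = ∑ₙ (κ)_n / n! aⁿ rⁿ` in `r`. -/
def powSeries {N : ℕ} (κ : ℝ) (a : MvPolynomial (Fin N) ℝ) :
    PowerSeries (MvPolynomial (Fin N) ℝ) :=
  PowerSeries.mk fun n => MvPolynomial.C (poch κ n / (n.factorial : ℝ)) * a ^ n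

/-- The polynomial `p_n(x_i; x)`, the coefficient of `rⁿ` in
`(1 - r x_i)⁻¹ ∏_j (1 - r x_j)^{-κ}`. -/
def pPoly {N : ℕ} (κ : ℝ) (n : ℕ) (i : Fin N) : MvPolynomial (Fin N) ℝ :=
  PowerSeries.coeff n
    (powSeries 1 (MvPolynomial.X i) * ∏ j : Fin N, powSeries κ (MvPolynomial.X j))

/-- The index of the first variable `x_1`. -/
def idx1 {N : ℕ} (hN : 2 ≤ N) : Fin N := ⟨0, by omega⟩

/-- The index of the second variable `x_2`. -/
def idx2 {N : ℕ} (hN : 2 ≤ N) : Fin N := ⟨1, by omega⟩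

/-- Polynomials in the symbolic variables `p_1, p_2`. -/
abbrev Sym := MvPolynomial (Fin 2) ℝ

/-- The linear map `Ψ⁻¹` on polynomials in the symbols `p_1, p_2`: it sends
`p_1^a p_2^b` to `p_a(x_1; x) p_b(x_2; x)`. -/
def psiInv {N : ℕ} (hN : 2 ≤ N) (κ : ℝ) : Sym →ₗ[ℝ] MvPolynomial (Fin N) ℝ :=
  (MvPolynomial.basisMonomials (Fin 2) ℝ).constr ℝ
    fun α => pPoly κ (α 0) (idx1 hN) * pPoly κ (α 1) (idx2 hN)

/-- The symbol `p_1` (for `k = 0`) or `p_2` (for `k = 1`), as a constant polynomial in `s`. -/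
def symP (k : Fin 2) : Polynomial Sym := Polynomial.C (MvPolynomial.X k)

/-- The power series `1 - 2 s t p_k + t² p_k²` in `t`. -/
def quad (k : Fin 2) : PowerSeries (Polynomial Sym) :=
  1 - PowerSeries.C (2 * Polynomial.X * symP k) * PowerSeries.X
    + PowerSeries.C (symP k ^ 2) * PowerSeries.X ^ 2

/-- `1 / ((1 - 2 s t p_1 + t² p_1²) (1 - 2 s t p_2 + t² p_2²))`; the constant coefficient of
the denominator is `1`. -/
def invQuads : PowerSeries (Polynomial Sym) :=
  PowerSeries.invOfUnit (quad 0 * quad 1) 1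

/-- The generating function `u_1`, a power series in `t` over polynomials in `s`. -/
def u1 : PowerSeries (Polynomial Sym) :=
  (1 - PowerSeries.C (Polynomial.X * (symP 0 + symP 1)) * PowerSeries.X
    + PowerSeries.C (symP 0 * symP 1) * PowerSeries.X ^ 2) * invQuads

/-- The generating function `u_2`, a power series in `t` over polynomials in `s`. -/
def u2 : PowerSeries (Polynomial Sym) :=
  PowerSeries.C (symP 0 - symP 1) * PowerSeries.X * invQuads

/-- `φ_{n,j}`: the coefficient of `tⁿ sʲ` in `u_1`, as a polynomial in `x`. -/
def phi {N : ℕ} (hN : 2 ≤ N) (κ : ℝ) (n j : ℕ) : MvPolynomial (Fin N) ℝ :=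
  psiInv hN κ ((PowerSeries.coeff n u1).coeff j)

/-- `ψ_{n,j}`: the coefficient of `tⁿ sʲ` in `u_2`, as a polynomial in `x`. -/
def psi {N : ℕ} (hN : 2 ≤ N) (κ : ℝ) (n j : ℕ) : MvPolynomial (Fin N) ℝ :=
  psiInv hN κ ((PowerSeries.coeff n u2).coeff j)

/-- The polynomials `g_n^o`. -/
def gO : ℕ → ℝ → ℝ
  | 0, _ => 1
  | 1, v => v + 1
  | n + 2, v => (v + 3 * ((n : ℝ) + 1) + 1) * gO (n + 1) v
      - ((n : ℝ) + 1) * (2 * ((n : ℝ) + 1) - 1) * gO n v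

/-- The polynomials `g_n^e`. -/
def gE : ℕ → ℝ → ℝ
  | 0, _ => 1
  | 1, v => v + 2
  | n + 2, v => (v + 3 * ((n : ℝ) + 1) + 2) * gE (n + 1) v
      - ((n : ℝ) + 1) * (2 * ((n : ℝ) + 1) + 1) * gE n v

/-- The symmetric planar harmonic polynomial `h_n^+`; here `m = ⌊n/2⌋`. -/
def hPlus {N : ℕ} (hN : 2 ≤ N) (κ : ℝ) (n : ℕ) : MvPolynomial (Fin N) ℝ :=
  let m := n / 2
  if Even n then
    ∑ j ∈ Finset.range (m + 1),
      ((2 : ℝ)⁻¹ ^ j * (gO j (N * κ - κ + m) / poch (N * κ + m + 1) j)) • phi hN κ n (2 * j)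
  else
    ∑ j ∈ Finset.range (m + 1),
      ((2 : ℝ)⁻¹ ^ j * (gE j (N * κ - κ + m + 1) / poch (N * κ + m + 2) j)) •
        phi hN κ n (2 * j + 1)

/-- The antisymmetric planar harmonic polynomial `h_n^-`; here `m = ⌊n/2⌋`. -/
def hMinus {N : ℕ} (hN : 2 ≤ N) (κ : ℝ) (n : ℕ) : MvPolynomial (Fin N) ℝ :=
  let m := n / 2
  if Even n then
    ∑ j ∈ Finset.range m,
      ((2 : ℝ)⁻¹ ^ j * (gE j (N * κ - κ + m) / poch (N * κ + m + 2) j)) •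
        psi hN κ n (2 * j + 1)
  else
    ∑ j ∈ Finset.range (m + 1),
      ((2 : ℝ)⁻¹ ^ j * (gO j (N * κ - κ + m) / poch (N * κ + m + 2) j)) • psi hN κ n (2 * j)

/-- `S(n, j; α, β)` for `0 ≤ j ≤ ⌊n/2⌋`. In this range no subtraction of natural numbers below
is truncated, except the lower limit of the inner sum, which is `max(0, ℓ + j - ⌊n/2⌋)`. -/
def sConst (n j : ℕ) (α β : ℝ) : ℝ :=
  ∑ l ∈ Finset.range (n / 2 + 1), ∑ i ∈ Finset.Icc (l + j - n / 2) (min l j),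
    poch (α + 1) l * poch (2 * α + β + 2 * l) (n + i - (2 * l + j))
      / ((i.factorial : ℝ) * ((l - i).factorial : ℝ) * ((j - i).factorial : ℝ)
          * ((n + 2 * i - (2 * l + 2 * j)).factorial : ℝ))
      * (-1) ^ (l + j) * 2 ^ (n + i - j)

/-- The value `f(1 + i, 1 - i, 0, …, 0)`. -/
def evalPoint {N : ℕ} (hN : 2 ≤ N) (f : MvPolynomial (Fin N) ℝ) : ℂ :=
  MvPolynomial.aeval (fun k : Fin N => if k = idx1 hN then 1 + Complex.I
    else if k = idx2 hN then 1 - Complex.I else 0) f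

/-- The operator `T_1 + T_2`. -/
def Tsum {N : ℕ} (hN : 2 ≤ N) (κ : ℝ) : Module.End ℝ (MvPolynomial (Fin N) ℝ) :=
  dunklT κ (idx1 hN) + dunklT κ (idx2 hN)

/-- The operator `T_1 - T_2`. -/
def Tdiff {N : ℕ} (hN : 2 ≤ N) (κ : ℝ) : Module.End ℝ (MvPolynomial (Fin N) ℝ) :=
  dunklT κ (idx1 hN) - dunklT κ (idx2 hN)

/-- The weight `w_κ(x) = ∏_{i<j} |x_i - x_j|^{2κ}`. -/
def weight {N : ℕ} (κ : ℝ) (x : EuclideanSpace ℝ (Fin N)) : ℝ :=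
  ∏ i : Fin N, ∏ j ∈ Finset.Ioi i, |x i - x j| ^ (2 * κ)

/-- The value of a polynomial at a point of Euclidean space. -/
def evalE {N : ℕ} (f : MvPolynomial (Fin N) ℝ) (x : EuclideanSpace ℝ (Fin N)) : ℝ :=
  MvPolynomial.eval (fun i => x i) f

/-- The Gaussian measure `(2π)^{-N/2} e^{-|x|²/2} dx` on `ℝᴺ`. -/
def gaussMeasure (N : ℕ) : Measure (EuclideanSpace ℝ (Fin N)) :=
  volume.withDensity fun x =>
    ENNReal.ofReal ((2 * Real.pi) ^ (-(N : ℝ) / 2) * Real.exp (-‖x‖ ^ 2 / 2))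

/-- The normalized surface measure on the unit sphere of `ℝᴺ`. -/
def sphereMeasure (N : ℕ) :
    Measure (Metric.sphere (0 : EuclideanSpace ℝ (Fin N)) 1) :=
  ((volume : Measure (EuclideanSpace ℝ (Fin N))).toSphere Set.univ)⁻¹ •
    (volume : Measure (EuclideanSpace ℝ (Fin N))).toSphere

/-- The Gaussian inner product `c_κ ∫ f g w_κ dμ`, where `c_κ ∫ w_κ dμ = 1`. -/
def gaussInner {N : ℕ} (κ : ℝ) (f g : MvPolynomial (Fin N) ℝ) : ℝ :=
  (∫ x, weight κ x ∂gaussMeasure N)⁻¹ *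
    ∫ x, evalE f x * evalE g x * weight κ x ∂gaussMeasure N

/-- The inner product `c'_κ ∫ f g w_κ dm` on the unit sphere, where `c'_κ ∫ w_κ dm = 1`. -/
def sphereInner {N : ℕ} (κ : ℝ) (f g : MvPolynomial (Fin N) ℝ) : ℝ :=
  (∫ x, weight κ x.1 ∂sphereMeasure N)⁻¹ *
    ∫ x, evalE f x.1 * evalE g x.1 * weight κ x.1 ∂sphereMeasure N

end PlanarDunkl

end

noncomputable section

namespace PlanarDunkl

section DunklOperators

open MvPolynomial

variable {N : ℕ}

theorem eq_divDiffFun {i j : Fin N} (h : i ≠ j) {f g : MvPolynomial (Fin N) ℝ}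
    (hg : f - swapVars i j f = (X i - X j) * g) : divDiffFun i j f = g :=
  mul_left_cancel₀ (X_sub_X_ne_zero h) (by rw [← divDiffFun_spec, hg])

theorem divDiffFun_add {i j : Fin N} (h : i ≠ j) (f g : MvPolynomial (Fin N) ℝ) :
    divDiffFun i j (f + g) = divDiffFun i j f + divDiffFun i j g :=
  (divDiff i j h).map_add f g

theorem divDiffFun_eq_zero {i j : Fin N} (h : i ≠ j) {f : MvPolynomial (Fin N) ℝ}
    (hf : swapVars i j f = f) : divDiffFun i j f = 0 :=
  eq_divDiffFun h (by rw [hf]; simp)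

theorem swapVars_swapVars (i j : Fin N) (f : MvPolynomial (Fin N) ℝ) :
    swapVars i j (swapVars i j f) = f := by
  simp only [swapVars, rename_rename]
  have : (Equiv.swap i j : Fin N → Fin N) ∘ (Equiv.swap i j) = id := by
    ext x; simp
  rw [this, rename_id_apply]

theorem swapVars_comm (i j : Fin N) : swapVars i j = swapVars j i := by
  simp only [swapVars, Equiv.swap_comm]

@[simp] theorem swapVars_X_left (i j : Fin N) : swapVars i j (X i) = X j := by
  simp [swapVars]

@[simp] theorem swapVars_X_right (i j : Fin N) : swapVars i j (X j) = X i := by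
  simp [swapVars]

theorem swapVars_X_of_ne {i j k : Fin N} (h : k ≠ i) (h' : k ≠ j) :
    swapVars i j (X k) = X k := by
  simp [swapVars, Equiv.swap_apply_of_ne_of_ne h h']

theorem swapVars_divDiffFun {i j : Fin N} (h : i ≠ j) (f : MvPolynomial (Fin N) ℝ) :
    swapVars i j (divDiffFun i j f) = divDiffFun i j f := by
  symm
  apply eq_divDiffFun h
  have := congrArg (swapVars i j) (divDiffFun_spec i j f)
  rw [map_sub, map_mul, map_sub, swapVars_swapVars, swapVars_X_left, swapVars_X_right] at this
  linear_combination -this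

theorem divDiffFun_comm {i j : Fin N} (h : i ≠ j) (f : MvPolynomial (Fin N) ℝ) :
    divDiffFun j i f = -divDiffFun i j f := by
  apply eq_divDiffFun h.symm
  rw [swapVars_comm, divDiffFun_spec]
  ring

theorem divDiffFun_mul {i j : Fin N} (h : i ≠ j) (f g : MvPolynomial (Fin N) ℝ) :
    divDiffFun i j (f * g) = divDiffFun i j f * g + f * divDiffFun i j g
      - (X i - X j) * (divDiffFun i j f * divDiffFun i j g) := by
  apply eq_divDiffFun h
  rw [map_mul]
  have hf := divDiffFun_spec i j f
  have hg := divDiffFun_spec i j g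
  have hf' : swapVars i j f = f - (X i - X j) * divDiffFun i j f := by
    linear_combination -hf
  have hg' : swapVars i j g = g - (X i - X j) * divDiffFun i j g := by
    linear_combination -hg
  rw [hf', hg']
  ring

theorem divDiffFun_X_left {i j : Fin N} (h : i ≠ j) :
    divDiffFun i j (X i : MvPolynomial (Fin N) ℝ) = 1 :=
  eq_divDiffFun h (by simp)

theorem divDiffFun_X_right {i j : Fin N} (h : i ≠ j) :
    divDiffFun i j (X j : MvPolynomial (Fin N) ℝ) = -1 :=
  eq_divDiffFun h (by simp)

theorem rename_divDiffFun (σ : Equiv.Perm (Fin N)) {i j : Fin N} (h : i ≠ j)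
    (f : MvPolynomial (Fin N) ℝ) :
    rename σ (divDiffFun i j f) = divDiffFun (σ i) (σ j) (rename σ f) := by
  symm
  apply eq_divDiffFun (fun h' => h (σ.injective h'))
  have := congrArg (rename σ) (divDiffFun_spec i j f)
  simp only [map_sub, map_mul, rename_X, swapVars, rename_rename] at this ⊢
  rw [← this]
  congr 3
  ext x
  simp only [Function.comp_apply, σ.injective.swap_apply]

theorem dunklT_apply (κ : ℝ) (i : Fin N) (f : MvPolynomial (Fin N) ℝ) :
    dunklT κ i f = pderiv i f + κ • ∑ j ∈ {i}ᶜ, divDiffFun i j f := by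
  simp only [dunklT, LinearMap.add_apply, LinearMap.smul_apply, LinearMap.sum_apply]
  congr 2
  rw [← Finset.sum_subset (Finset.subset_univ ({i}ᶜ : Finset (Fin N)))]
  · refine Finset.sum_congr rfl fun j hj => ?_
    have hj : i ≠ j := by simpa [eq_comm] using hj
    rw [dif_pos hj]; rfl
  · intro j _ hj
    have : ¬ i ≠ j := by simpa [eq_comm] using hj
    rw [dif_neg this]; rfl

theorem dunklT_C (κ : ℝ) (i : Fin N) (a : ℝ) : dunklT κ i (C a) = 0 := by
  rw [dunklT_apply, pderiv_C, zero_add]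
  rw [Finset.sum_eq_zero, smul_zero]
  intro j hj
  exact divDiffFun_eq_zero (by simpa [eq_comm] using hj) (by simp [swapVars])

/-- The product rule for Dunkl operators. -/
theorem dunklT_mul (κ : ℝ) (i : Fin N) (f g : MvPolynomial (Fin N) ℝ) :
    dunklT κ i (f * g) = dunklT κ i f * g + f * dunklT κ i g
      - κ • ∑ j ∈ {i}ᶜ, (X i - X j) * (divDiffFun i j f * divDiffFun i j g) := by
  simp only [dunklT_apply, Derivation.leibniz, smul_eq_mul]
  have : ∑ j ∈ {i}ᶜ, divDiffFun i j (f * g) = ∑ j ∈ {i}ᶜ, (divDiffFun i j f * g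
      + f * divDiffFun i j g - (X i - X j) * (divDiffFun i j f * divDiffFun i j g)) :=
    Finset.sum_congr rfl fun j hj => divDiffFun_mul (by simpa [eq_comm] using hj) f g
  rw [this, Finset.sum_sub_distrib, Finset.sum_add_distrib, ← Finset.sum_mul, ← Finset.mul_sum]
  simp only [smul_eq_C_mul]
  ring

theorem dunklT_X_mul_of_ne (κ : ℝ) {i k : Fin N} (h : i ≠ k) (f : MvPolynomial (Fin N) ℝ) :
    dunklT κ i (X k * f) = X k * dunklT κ i f - κ • swapVars i k f := by
  have h1 : dunklT κ i (X k) = -C κ := by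
    rw [dunklT_apply, pderiv_X_of_ne h.symm, Finset.sum_eq_single k]
    · rw [divDiffFun_X_right h, smul_eq_C_mul]; ring
    · intro j hj hjk
      exact divDiffFun_eq_zero (by simpa [eq_comm] using hj) (swapVars_X_of_ne h.symm hjk.symm)
    · intro hk; simp [h.symm] at hk
  rw [dunklT_mul, h1, Finset.sum_eq_single k]
  · have := divDiffFun_spec i k f
    rw [divDiffFun_X_right h, smul_eq_C_mul, smul_eq_C_mul]
    linear_combination (-C κ) * this
  · intro j hj hjk
    rw [divDiffFun_eq_zero (by simpa [eq_comm] using hj) (swapVars_X_of_ne h.symm hjk.symm)]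
    ring
  · intro hk; simp [h.symm] at hk

theorem dunklT_X_mul_self (κ : ℝ) (i : Fin N) (f : MvPolynomial (Fin N) ℝ) :
    dunklT κ i (X i * f) = X i * dunklT κ i f + f + κ • ∑ j ∈ {i}ᶜ, swapVars i j f := by
  have h1 : dunklT κ i (X i) = 1 + κ • ∑ j ∈ ({i}ᶜ : Finset (Fin N)), 1 := by
    rw [dunklT_apply, pderiv_X_self]
    congr 2
    exact Finset.sum_congr rfl fun j hj => divDiffFun_X_left (by simpa [eq_comm] using hj)
  rw [dunklT_mul, h1]
  have : ∀ j ∈ ({i}ᶜ : Finset (Fin N)),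
      (X i - X j) * (divDiffFun i j (X i) * divDiffFun i j f) = f - swapVars i j f := by
    intro j hj
    rw [divDiffFun_X_left (by simpa [eq_comm] using hj), one_mul, ← divDiffFun_spec]
  rw [Finset.sum_congr rfl this, Finset.sum_sub_distrib]
  have h2 : ∑ j ∈ ({i}ᶜ : Finset (Fin N)), f = (∑ j ∈ ({i}ᶜ : Finset (Fin N)), 1) * f := by
    rw [Finset.sum_mul, one_mul]
  rw [h2]
  simp only [smul_eq_C_mul]
  ring

theorem rename_dunklT (κ : ℝ) (σ : Equiv.Perm (Fin N)) (i : Fin N)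
    (f : MvPolynomial (Fin N) ℝ) :
    rename σ (dunklT κ i f) = dunklT κ (σ i) (rename σ f) := by
  rw [dunklT_apply, dunklT_apply, map_add, map_smul, map_sum, pderiv_rename σ.injective]
  congr 2
  refine Finset.sum_bij (fun j _ => σ j) (by simp) (by simp) ?_ ?_
  · intro b hb
    exact ⟨σ.symm b, by simpa [Equiv.symm_apply_eq] using hb, by simp⟩
  · intro j hj
    exact rename_divDiffFun σ (by simpa [eq_comm] using hj) f

theorem swapVars_dunklT (κ : ℝ) (i j k : Fin N) (f : MvPolynomial (Fin N) ℝ) :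
    swapVars i j (dunklT κ k f) = dunklT κ (Equiv.swap i j k) (swapVars i j f) :=
  rename_dunklT κ _ k f

theorem dunklT_comm (κ : ℝ) (i j : Fin N) (f : MvPolynomial (Fin N) ℝ) :
    dunklT κ i (dunklT κ j f) = dunklT κ j (dunklT κ i f) := by
  rcases eq_or_ne i j with rfl | hij
  · rfl
  have key : ∀ i j : Fin N, i ≠ j → ∀ f : MvPolynomial (Fin N) ℝ,
      dunklT κ i (dunklT κ j f) = dunklT κ j (dunklT κ i f) →
      dunklT κ i (dunklT κ j (X i * f)) = dunklT κ j (dunklT κ i (X i * f)) := by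
    intro i j hij f hf
    rw [dunklT_X_mul_of_ne κ hij.symm, map_sub, dunklT_X_mul_self, dunklT_X_mul_self, map_add,
      map_add, dunklT_X_mul_of_ne κ hij.symm, map_smul, map_smul, hf, map_sum]
    have hj : j ∈ ({i}ᶜ : Finset (Fin N)) := by simpa using hij.symm
    rw [← Finset.add_sum_erase _ _ hj, ← Finset.add_sum_erase _ _ hj]
    have h1 : swapVars i j (dunklT κ j f) = dunklT κ i (swapVars i j f) := by
      rw [swapVars_dunklT, Equiv.swap_apply_right]
    have h2 : swapVars i j (dunklT κ i f) = dunklT κ j (swapVars i j f) := by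
      rw [swapVars_dunklT, Equiv.swap_apply_left]
    have h3 : ∀ l ∈ ({i}ᶜ : Finset (Fin N)).erase j,
        swapVars i l (dunklT κ j f) = dunklT κ j (swapVars i l f) := by
      intro l hl
      rw [swapVars_dunklT, Equiv.swap_apply_of_ne_of_ne hij.symm]
      simp only [Finset.mem_erase] at hl
      exact hl.1.symm
    rw [Finset.sum_congr rfl h3, h1, swapVars_comm j i, h2]
    simp only [smul_add]
    abel
  induction f using MvPolynomial.induction_on with
  | C a => simp [dunklT_C]
  | add p q hp hq => simp only [map_add, hp, hq]
  | mul_X p k hp =>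
    rw [mul_comm]
    rcases eq_or_ne k i with rfl | hki
    · exact key k j hij p hp
    rcases eq_or_ne k j with rfl | hkj
    · exact (key k i hij.symm p hp.symm).symm
    rw [dunklT_X_mul_of_ne κ hkj.symm, dunklT_X_mul_of_ne κ hki.symm, map_sub, map_sub,
      dunklT_X_mul_of_ne κ hkj.symm, dunklT_X_mul_of_ne κ hki.symm, map_smul, map_smul, hp,
      swapVars_dunklT, swapVars_dunklT, Equiv.swap_apply_of_ne_of_ne hij.symm hkj.symm,
      Equiv.swap_apply_of_ne_of_ne hij hki.symm]
    abel

/-- Homogeneous polynomials are generated from constants by sums and multiplication by the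
variables. -/
theorem isHomogeneous_induction {p : ℕ → MvPolynomial (Fin N) ℝ → Prop}
    (hC : ∀ a, p 0 (C a)) (h0 : ∀ n, p n 0)
    (hadd : ∀ n f g, p n f → p n g → p n (f + g))
    (hX : ∀ n i f, f.IsHomogeneous n → p n f → p (n + 1) (X i * f))
    {n : ℕ} {f : MvPolynomial (Fin N) ℝ} (hf : f.IsHomogeneous n) : p n f := by
  have hmon : ∀ n : ℕ, ∀ d : Fin N →₀ ℕ, d.degree = n → ∀ a : ℝ, p n (monomial d a) := by
    intro n
    induction n with
    | zero =>
      intro d hd a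
      rw [Finsupp.degree_eq_zero_iff] at hd
      subst hd
      exact hC a
    | succ n ih =>
      intro d hd a
      have hd0 : d ≠ 0 := by
        rintro rfl
        simp at hd
      obtain ⟨i, hi⟩ := Finsupp.ne_iff.1 hd0
      have hle : Finsupp.single i 1 ≤ d := by
        rw [Finsupp.single_le_iff]
        exact Nat.one_le_iff_ne_zero.2 hi
      have hsum : Finsupp.single i 1 + (d - Finsupp.single i 1) = d := add_tsub_cancel_of_le hle
      have hdeg : (d - Finsupp.single i 1).degree = n := by
        have := congrArg Finsupp.degree hsum
        rw [map_add, Finsupp.degree_single, hd] at this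
        omega
      have : monomial d a = X i * monomial (d - Finsupp.single i 1) a := by
        rw [X, monomial_mul, one_mul, hsum]
      rw [this]
      exact hX n i _ (isHomogeneous_monomial a hdeg) (ih _ hdeg a)
  rw [← f.support_sum_monomial_coeff]
  refine Finset.sum_induction _ (p n) (hadd n) (h0 n) ?_
  intro d hd
  refine hmon n d ?_ _
  have := hf (mem_support_iff.1 hd)
  rw [Finsupp.degree_eq_weight_one]
  exact this

theorem isHomogeneous_swapVars {n : ℕ} {f : MvPolynomial (Fin N) ℝ} (hf : f.IsHomogeneous n)
    (i j : Fin N) : (swapVars i j f).IsHomogeneous n :=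
  hf.rename_isHomogeneous

theorem isHomogeneous_smul {n : ℕ} {f : MvPolynomial (Fin N) ℝ} (hf : f.IsHomogeneous n)
    (a : ℝ) : (a • f).IsHomogeneous n :=
  (homogeneousSubmodule (Fin N) ℝ n).smul_mem a hf

theorem isHomogeneous_sum {ι : Type*} {s : Finset ι} {n : ℕ} {f : ι → MvPolynomial (Fin N) ℝ}
    (hf : ∀ i ∈ s, (f i).IsHomogeneous n) : (∑ i ∈ s, f i).IsHomogeneous n :=
  (homogeneousSubmodule (Fin N) ℝ n).sum_mem hf

theorem dunklT_isHomogeneous (κ : ℝ) (i : Fin N) {n : ℕ} {f : MvPolynomial (Fin N) ℝ}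
    (hf : f.IsHomogeneous (n + 1)) : (dunklT κ i f).IsHomogeneous n := by
  have key : ∀ m : ℕ, ∀ f : MvPolynomial (Fin N) ℝ, f.IsHomogeneous m →
      (m = 0 ∧ dunklT κ i f = 0) ∨ (∃ k, m = k + 1 ∧ (dunklT κ i f).IsHomogeneous k) := by
    intro m f hf
    refine isHomogeneous_induction
      (p := fun m f => (m = 0 ∧ dunklT κ i f = 0) ∨
        (∃ k, m = k + 1 ∧ (dunklT κ i f).IsHomogeneous k)) ?_ ?_ ?_ ?_ hf
    · intro a; left; exact ⟨rfl, dunklT_C κ i a⟩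
    · intro n
      cases n with
      | zero => left; simp
      | succ n => right; exact ⟨n, rfl, by rw [map_zero]; exact isHomogeneous_zero _ _ _⟩
    · intro n f g hf hg
      cases n with
      | zero =>
        left
        simp only [true_and, Nat.zero_ne_add_one, false_and, exists_false, or_false] at hf hg
        exact ⟨rfl, by rw [map_add, hf, hg, add_zero]⟩
      | succ n =>
        right
        simp only [Nat.add_eq_zero_iff, one_ne_zero, and_false, false_and, false_or,
          Nat.add_right_cancel_iff, exists_eq_left'] at hf hg
        exact ⟨n, rfl, by rw [map_add]; exact hf.add hg⟩
    · intro n k f hf hTf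
      right
      refine ⟨n, rfl, ?_⟩
      have hXT : ∀ k : Fin N, (X k * dunklT κ i f).IsHomogeneous n := by
        intro k
        rcases hTf with ⟨_, h0⟩ | ⟨l, rfl, hl⟩
        · rw [h0, mul_zero]; exact isHomogeneous_zero _ _ _
        · rw [add_comm]; exact (isHomogeneous_X ℝ k).mul hl
      rcases eq_or_ne i k with rfl | hik
      · rw [dunklT_X_mul_self]
        exact ((hXT i).add hf).add (isHomogeneous_smul
          (isHomogeneous_sum fun j _ => isHomogeneous_swapVars hf i j) κ)
      · rw [dunklT_X_mul_of_ne κ hik]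
        exact (hXT k).sub (isHomogeneous_smul (isHomogeneous_swapVars hf i k) κ)
  rcases key _ f hf with ⟨h, _⟩ | ⟨k, hk, h⟩
  · omega
  · obtain rfl : n = k := by omega
    exact h

/-- Euler's identity for Dunkl operators. -/
theorem sum_X_mul_dunklT (κ : ℝ) {n : ℕ} {f : MvPolynomial (Fin N) ℝ} (hf : f.IsHomogeneous n) :
    2 • ∑ i, X i * dunklT κ i f
      = (2 * n) • f + κ • ∑ i, ∑ j ∈ {i}ᶜ, (f - swapVars i j f) := by
  have h1 : ∀ i, X i * dunklT κ i f
      = X i * pderiv i f + κ • ∑ j ∈ {i}ᶜ, X i * divDiffFun i j f := by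
    intro i
    rw [dunklT_apply, mul_add, mul_smul_comm, Finset.mul_sum]
  have h2 : ∑ i, ∑ j ∈ {i}ᶜ, X i * divDiffFun i j f
      = ∑ i, ∑ j ∈ {i}ᶜ, -(X j * divDiffFun i j f) := by
    have hcomm := Finset.sum_comm' (s := (Finset.univ : Finset (Fin N)))
      (t := fun i => ({i}ᶜ : Finset (Fin N))) (t' := Finset.univ)
      (s' := fun i => ({i}ᶜ : Finset (Fin N)))
      (h := by intro x y; simp [eq_comm]) (f := fun i j => X i * divDiffFun i j f)
    rw [hcomm]
    refine Finset.sum_congr rfl fun i _ => Finset.sum_congr rfl fun j hj => ?_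
    rw [divDiffFun_comm (i := i) (j := j) (by simpa [eq_comm] using hj)]
    ring
  have h3 : ∑ i, ∑ j ∈ {i}ᶜ, (f - swapVars i j f)
      = 2 • ∑ i, ∑ j ∈ {i}ᶜ, X i * divDiffFun i j f := by
    rw [two_smul]
    nth_rw 2 [h2]
    rw [← Finset.sum_add_distrib]
    refine Finset.sum_congr rfl fun i _ => ?_
    rw [← Finset.sum_add_distrib]
    refine Finset.sum_congr rfl fun j _ => ?_
    rw [divDiffFun_spec]
    ring
  rw [h3, Finset.sum_congr rfl fun i _ => h1 i, Finset.sum_add_distrib, ← Finset.smul_sum,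
    hf.sum_X_mul_pderiv, smul_add, mul_smul, smul_comm κ 2]

/-- The subalgebra generated by the Dunkl operators. -/
def dunklSubalgebra (N : ℕ) (κ : ℝ) : Subalgebra ℝ (Module.End ℝ (MvPolynomial (Fin N) ℝ)) :=
  Algebra.adjoin ℝ (Set.range (dunklT κ))

theorem dunklSubalgebra_comm (κ : ℝ) : ∀ a ∈ Set.range (dunklT (N := N) κ),
    ∀ b ∈ Set.range (dunklT (N := N) κ), a * b = b * a := by
  rintro _ ⟨i, rfl⟩ _ ⟨j, rfl⟩
  exact LinearMap.ext fun f => dunklT_comm κ i j f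

open scoped IsMulCommutative in
theorem polyOfT_eq (κ : ℝ) : ∃ Φ : MvPolynomial (Fin N) ℝ →ₐ[ℝ]
    Module.End ℝ (MvPolynomial (Fin N) ℝ), (∀ i, Φ (X i) = dunklT κ i) ∧
      ∀ f, polyOfT κ f = Φ f := by
  have : IsMulCommutative (dunklSubalgebra N κ) :=
    Algebra.isMulCommutative_adjoin ℝ (dunklSubalgebra_comm κ)
  let t : Fin N → dunklSubalgebra N κ := fun i => ⟨dunklT κ i, Algebra.subset_adjoin ⟨i, rfl⟩⟩
  let ψ : MvPolynomial (Fin N) ℝ →ₐ[ℝ] dunklSubalgebra N κ := aeval t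
  let Φ : MvPolynomial (Fin N) ℝ →ₐ[ℝ] Module.End ℝ (MvPolynomial (Fin N) ℝ) :=
    (dunklSubalgebra N κ).val.comp ψ
  refine ⟨Φ, fun i => ?_, fun f => ?_⟩
  · change (ψ (X i) : Module.End ℝ (MvPolynomial (Fin N) ℝ)) = _
    simp only [ψ, aeval_X, t]
  · have : polyOfT κ = Φ.toLinearMap := by
      refine (basisMonomials (Fin N) ℝ).ext fun d => ?_
      rw [polyOfT, Module.Basis.constr_basis, coe_basisMonomials]
      change _ = (ψ (monomial d 1) : Module.End ℝ (MvPolynomial (Fin N) ℝ))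
      have h : ψ (monomial d 1) = (List.ofFn fun i : Fin N => t i ^ d i).prod := by
        simp only [ψ]
        rw [aeval_monomial, map_one, one_mul, Finsupp.prod_fintype _ _ (by simp), List.prod_ofFn]
      rw [h]
      have h' := map_list_prod (dunklSubalgebra N κ).val (List.ofFn fun i : Fin N => t i ^ d i)
      rw [List.map_ofFn] at h'
      exact h'.symm
    rw [this]; rfl

theorem polyOfT_X (κ : ℝ) (i : Fin N) : polyOfT κ (X i) = dunklT κ i := by
  obtain ⟨Φ, h1, h2⟩ := polyOfT_eq (N := N) κ
  rw [h2, h1]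

theorem polyOfT_mul (κ : ℝ) (f g : MvPolynomial (Fin N) ℝ) :
    polyOfT κ (f * g) = polyOfT κ f * polyOfT κ g := by
  obtain ⟨Φ, _, h2⟩ := polyOfT_eq (N := N) κ
  simp only [h2, map_mul]

theorem polyOfT_C (κ : ℝ) (a : ℝ) (g : MvPolynomial (Fin N) ℝ) :
    polyOfT κ (C a) g = a • g := by
  obtain ⟨Φ, _, h2⟩ := polyOfT_eq (N := N) κ
  rw [h2, ← algebraMap_eq, Φ.commutes]
  rfl

theorem polyOfT_pow (κ : ℝ) (f : MvPolynomial (Fin N) ℝ) (n : ℕ) :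
    polyOfT κ (f ^ n) = polyOfT κ f ^ n := by
  obtain ⟨Φ, _, h2⟩ := polyOfT_eq (N := N) κ
  simp only [h2, map_pow]

end DunklOperators

end PlanarDunkl

end

noncomputable section

namespace PlanarDunkl

section GeneratingPolynomials

open MvPolynomial

variable {N : ℕ}

theorem poch_zero (a : ℝ) : poch a 0 = 1 := by simp [poch]

theorem poch_succ (a : ℝ) (n : ℕ) : poch a (n + 1) = poch a n * (a + n) := by
  simp [poch, ascPochhammer_succ_eval]

theorem poch_succ_left (a : ℝ) (n : ℕ) : poch a (n + 1) = a * poch (a + 1) n := by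
  induction n generalizing a with
  | zero => simp [poch]
  | succ n ih => rw [poch_succ, ih, poch_succ]; push_cast; ring

theorem poch_pos {a : ℝ} (ha : 0 < a) (n : ℕ) : 0 < poch a n := ascPochhammer_pos n a ha

theorem poch_one_eq (n : ℕ) : poch 1 n = n.factorial := by
  simp [poch, ascPochhammer_eval_one]

theorem powSeries_one (a : MvPolynomial (Fin N) ℝ) :
    powSeries 1 a = PowerSeries.mk fun n => a ^ n := by
  ext1 n
  simp only [powSeries, PowerSeries.coeff_mk, poch_one_eq]
  rw [div_self (by positivity)]
  simp

theorem one_sub_mul_powSeries_one (a : MvPolynomial (Fin N) ℝ) :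
    (1 - PowerSeries.C a * PowerSeries.X) * powSeries 1 a = 1 := by
  rw [powSeries_one]
  ext1 n
  rw [sub_mul, one_mul, mul_assoc, map_sub, PowerSeries.coeff_C_mul]
  cases n with
  | zero => simp
  | succ n =>
    rw [PowerSeries.coeff_succ_X_mul]
    simp [PowerSeries.coeff_one, pow_succ']

/-- The coefficient of `rⁿ` in `∏_j (1 - r x_j)^{-κ}`. -/
def gegPoly (N : ℕ) (κ : ℝ) (n : ℕ) : MvPolynomial (Fin N) ℝ :=
  PowerSeries.coeff n (∏ j : Fin N, powSeries κ (X j))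

theorem gegPoly_zero (κ : ℝ) : gegPoly N κ 0 = 1 := by
  simp only [gegPoly, PowerSeries.coeff_zero_eq_constantCoeff, map_prod]
  refine Finset.prod_eq_one fun j _ => ?_
  rw [← PowerSeries.coeff_zero_eq_constantCoeff_apply]
  simp [powSeries, poch_zero]

theorem pPoly_zero (κ : ℝ) (i : Fin N) : pPoly κ 0 i = 1 := by
  have := gegPoly_zero (N := N) κ
  rw [gegPoly] at this
  rw [pPoly, PowerSeries.coeff_mul, Finset.Nat.antidiagonal_zero, Finset.sum_singleton, this,
    mul_one, powSeries_one]
  simp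

theorem pPoly_succ (κ : ℝ) (n : ℕ) (i : Fin N) :
    pPoly κ (n + 1) i = gegPoly N κ (n + 1) + X i * pPoly κ n i := by
  have h := congrArg (· * ∏ j : Fin N, powSeries κ (X j))
    (one_sub_mul_powSeries_one (X i : MvPolynomial (Fin N) ℝ))
  simp only [one_mul, mul_assoc, sub_mul] at h
  have := congrArg (PowerSeries.coeff (n + 1)) h
  rw [map_sub, PowerSeries.coeff_C_mul, PowerSeries.coeff_succ_X_mul] at this
  simp only [pPoly, gegPoly]
  linear_combination this

theorem coeff_prod_powSeries_isHomogeneous (κ : ℝ) (s : Finset (Fin N)) (n : ℕ) :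
    (PowerSeries.coeff n (∏ j ∈ s, powSeries κ (X j : MvPolynomial (Fin N) ℝ))).IsHomogeneous
      n := by
  classical
  induction s using Finset.induction_on generalizing n with
  | empty =>
    rw [Finset.prod_empty, PowerSeries.coeff_one]
    split_ifs with h
    · subst h; exact isHomogeneous_one _ _
    · exact isHomogeneous_zero _ _ _
  | insert a s ha ih =>
    rw [Finset.prod_insert ha, PowerSeries.coeff_mul]
    refine isHomogeneous_sum fun ab hab => ?_
    rw [Finset.HasAntidiagonal.mem_antidiagonal] at hab
    rw [← hab]
    refine IsHomogeneous.mul ?_ (ih _)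
    rw [powSeries, PowerSeries.coeff_mk, ← zero_add ab.1]
    exact (isHomogeneous_C _ _).mul (by simpa using (isHomogeneous_X ℝ a).pow ab.1)

theorem gegPoly_isHomogeneous (κ : ℝ) (n : ℕ) : (gegPoly N κ n).IsHomogeneous n :=
  coeff_prod_powSeries_isHomogeneous κ Finset.univ n

theorem pPoly_isHomogeneous (κ : ℝ) (n : ℕ) (i : Fin N) : (pPoly κ n i).IsHomogeneous n := by
  induction n with
  | zero => rw [pPoly_zero]; exact isHomogeneous_one _ _
  | succ n ih =>
    rw [pPoly_succ]
    refine (gegPoly_isHomogeneous κ (n + 1)).add ?_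
    rw [add_comm]
    exact (isHomogeneous_X ℝ i).mul ih

theorem rename_gegPoly (κ : ℝ) (n : ℕ) (σ : Equiv.Perm (Fin N)) :
    rename σ (gegPoly N κ n) = gegPoly N κ n := by
  have h : PowerSeries.map (rename σ : MvPolynomial (Fin N) ℝ →ₐ[ℝ] _).toRingHom
      (∏ j : Fin N, powSeries κ (X j)) = ∏ j : Fin N, powSeries κ (X j) := by
    rw [map_prod]
    refine Fintype.prod_equiv σ _ _ fun j => ?_
    ext1 m
    simp [powSeries]
  have := congrArg (PowerSeries.coeff n) h
  rw [PowerSeries.coeff_map] at this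
  exact this

theorem rename_pPoly (κ : ℝ) (n : ℕ) (i : Fin N) (σ : Equiv.Perm (Fin N)) :
    rename σ (pPoly κ n i) = pPoly κ n (σ i) := by
  induction n with
  | zero => simp [pPoly_zero]
  | succ n ih => rw [pPoly_succ, pPoly_succ, map_add, map_mul, ih, rename_gegPoly, rename_X]

theorem swapVars_pPoly_left (κ : ℝ) (n : ℕ) (i j : Fin N) :
    swapVars i j (pPoly κ n i) = pPoly κ n j := by
  rw [swapVars, rename_pPoly, Equiv.swap_apply_left]

theorem swapVars_pPoly_of_ne (κ : ℝ) (n : ℕ) {i j k : Fin N} (h : k ≠ i) (h' : k ≠ j) :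
    swapVars i j (pPoly κ n k) = pPoly κ n k := by
  rw [swapVars, rename_pPoly, Equiv.swap_apply_of_ne_of_ne h h']

theorem pderiv_coeff_prod_powSeries (κ : ℝ) (k : Fin N) (s : Finset (Fin N)) (hk : k ∉ s)
    (n : ℕ) :
    pderiv k (PowerSeries.coeff n (∏ j ∈ s, powSeries κ (X j : MvPolynomial (Fin N) ℝ)))
      = 0 := by
  classical
  induction s using Finset.induction_on generalizing n with
  | empty =>
    rw [Finset.prod_empty, PowerSeries.coeff_one]
    split_ifs <;> simp
  | insert a s ha ih =>
    simp only [Finset.mem_insert, not_or] at hk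
    rw [Finset.prod_insert ha, PowerSeries.coeff_mul, map_sum]
    refine Finset.sum_eq_zero fun ab _ => ?_
    rw [Derivation.leibniz, ih hk.2, powSeries, PowerSeries.coeff_mk, Derivation.leibniz,
      Derivation.leibniz_pow, pderiv_C, pderiv_X_of_ne (Ne.symm hk.1)]
    simp

theorem powSeries_deriv_aux (κ : ℝ) (a : MvPolynomial (Fin N) ℝ) :
    (PowerSeries.mk fun n => C (poch κ (n + 1) / (n.factorial : ℝ)) * a ^ n)
      = PowerSeries.C (C κ) * (powSeries 1 a * powSeries κ a) := by
  have h1 : (1 - PowerSeries.C a * PowerSeries.X) *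
      (PowerSeries.mk fun n => C (poch κ (n + 1) / (n.factorial : ℝ)) * a ^ n)
        = PowerSeries.C (C κ) * powSeries κ a := by
    ext1 n
    rw [sub_mul, one_mul, mul_assoc, map_sub, PowerSeries.coeff_C_mul, PowerSeries.coeff_C_mul]
    cases n with
    | zero => simp [powSeries, poch_succ, poch_zero]
    | succ n =>
      rw [PowerSeries.coeff_succ_X_mul]
      simp only [PowerSeries.coeff_mk, powSeries]
      have hc : poch κ (n + 1 + 1) / ((n + 1).factorial : ℝ) - poch κ (n + 1) / (n.factorial : ℝ)
          = κ * (poch κ (n + 1) / ((n + 1).factorial : ℝ)) := by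
        rw [poch_succ κ (n + 1), Nat.factorial_succ]
        have : (n.factorial : ℝ) ≠ 0 := by positivity
        push_cast
        field_simp
        ring
      have hC := congrArg (C : ℝ → MvPolynomial (Fin N) ℝ) hc
      rw [C_sub, C_mul] at hC
      linear_combination a ^ (n + 1) * hC
  linear_combination powSeries 1 a * h1 -
    (PowerSeries.mk fun n => C (poch κ (n + 1) / (n.factorial : ℝ)) * a ^ n)
      * one_sub_mul_powSeries_one a

theorem pderiv_gegPoly (κ : ℝ) (k : Fin N) (n : ℕ) :
    pderiv k (gegPoly N κ (n + 1)) = κ • pPoly κ n k := by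
  classical
  have hsplit : (∏ j : Fin N, powSeries κ (X j : MvPolynomial (Fin N) ℝ))
      = powSeries κ (X k) * ∏ j ∈ Finset.univ.erase k, powSeries κ (X j) :=
    (Finset.mul_prod_erase _ _ (Finset.mem_univ k)).symm
  have hp : κ • pPoly κ n k = PowerSeries.coeff n
      ((PowerSeries.mk fun n => C (poch κ (n + 1) / (n.factorial : ℝ)) * X k ^ n) *
        ∏ j ∈ Finset.univ.erase k, powSeries κ (X j)) := by
    rw [powSeries_deriv_aux, smul_eq_C_mul, pPoly, ← PowerSeries.coeff_C_mul, hsplit]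
    congr 1
    ring
  rw [hp, gegPoly, hsplit, PowerSeries.coeff_mul, PowerSeries.coeff_mul, map_sum,
    Finset.Nat.sum_antidiagonal_succ]
  have h0 : ∀ a b : ℕ, pderiv k (PowerSeries.coeff a (powSeries κ (X k)) *
      PowerSeries.coeff b (∏ j ∈ Finset.univ.erase k, powSeries κ (X j)))
      = pderiv k (PowerSeries.coeff a (powSeries κ (X k))) *
        PowerSeries.coeff b (∏ j ∈ Finset.univ.erase k, powSeries κ
          (X j : MvPolynomial (Fin N) ℝ)) := by
    intro a b
    rw [Derivation.leibniz, pderiv_coeff_prod_powSeries κ k _ (by simp)]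
    simp [mul_comm]
  simp only [h0]
  have hz : pderiv k (PowerSeries.coeff 0 (powSeries κ (X k : MvPolynomial (Fin N) ℝ))) = 0 := by
    rw [powSeries, PowerSeries.coeff_mk, pow_zero, mul_one, pderiv_C]
  rw [hz, zero_mul, zero_add]
  refine Finset.sum_congr rfl fun ab _ => ?_
  congr 1
  rw [powSeries, PowerSeries.coeff_mk, PowerSeries.coeff_mk, pderiv_C_mul, Derivation.leibniz_pow,
    pderiv_X_self]
  have : poch κ (ab.1 + 1) / (ab.1.factorial : ℝ)
      = poch κ (ab.1 + 1) / ((ab.1 + 1).factorial : ℝ) * (ab.1 + 1 : ℕ) := by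
    rw [Nat.factorial_succ]
    have : (ab.1.factorial : ℝ) ≠ 0 := by positivity
    push_cast
    field_simp
  rw [this, C_mul]
  simp only [Nat.add_sub_cancel, nsmul_eq_mul, smul_eq_mul, mul_one, map_natCast]
  ring

theorem dunklT_gegPoly (κ : ℝ) (k : Fin N) (n : ℕ) :
    dunklT κ k (gegPoly N κ (n + 1)) = κ • pPoly κ n k := by
  rw [dunklT_apply, pderiv_gegPoly, Finset.sum_eq_zero, smul_zero, add_zero]
  intro j hj
  exact divDiffFun_eq_zero (by simpa [eq_comm] using hj) (rename_gegPoly κ _ _)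

theorem dunklT_one (κ : ℝ) (k : Fin N) : dunklT κ k 1 = 0 := by
  rw [← C_1]; exact dunklT_C κ k 1

theorem dunklT_pPoly_of_ne (κ : ℝ) {k i : Fin N} (h : k ≠ i) (n : ℕ) :
    dunklT κ k (pPoly κ n i) = 0 := by
  induction n with
  | zero => rw [pPoly_zero, dunklT_one]
  | succ n ih =>
    rw [pPoly_succ, map_add, dunklT_gegPoly, dunklT_X_mul_of_ne κ h, ih, swapVars_comm,
      swapVars_pPoly_left]
    simp

theorem sum_pPoly (κ : ℝ) (n : ℕ) :
    κ • ∑ j, pPoly κ n j = (N * κ + n) • gegPoly N κ n := by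
  cases n with
  | zero => simp [pPoly_zero, gegPoly_zero, smul_eq_C_mul]; ring
  | succ n =>
    have h := (gegPoly_isHomogeneous (N := N) κ (n + 1)).sum_X_mul_pderiv
    simp only [pderiv_gegPoly, mul_smul_comm] at h
    simp only [pPoly_succ]
    rw [Finset.sum_add_distrib, smul_add, Finset.smul_sum (s := Finset.univ)
      (f := fun j => X j * pPoly κ n j), h]
    simp only [Finset.sum_const, Finset.card_univ, Fintype.card_fin, smul_eq_C_mul, nsmul_eq_mul]
    push_cast
    simp only [C_add, C_mul, map_natCast, map_one]
    ring

theorem dunklT_pPoly_self (κ : ℝ) (i : Fin N) (n : ℕ) :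
    dunklT κ i (pPoly κ (n + 1) i) = (N * κ + n + 1) • pPoly κ n i := by
  have hstep : ∀ n, dunklT κ i (pPoly κ (n + 1) i)
      = X i * dunklT κ i (pPoly κ n i) + pPoly κ n i + (N * κ + n) • gegPoly N κ n := by
    intro n
    rw [pPoly_succ, map_add, dunklT_gegPoly, dunklT_X_mul_self, ← sum_pPoly]
    have : ∑ j ∈ {i}ᶜ, swapVars i j (pPoly κ n i) = ∑ j ∈ {i}ᶜ, pPoly κ n j :=
      Finset.sum_congr rfl fun j _ => swapVars_pPoly_left κ n i j
    rw [this, ← Finset.add_sum_erase _ _ (Finset.mem_univ i), smul_add]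
    have : ({i}ᶜ : Finset (Fin N)) = Finset.univ.erase i := by ext; simp
    rw [this]
    abel
  induction n with
  | zero =>
    rw [hstep, pPoly_zero, gegPoly_zero, dunklT_one]
    simp only [smul_eq_C_mul, C_add, C_mul, C_1]
    ring
  | succ n ih =>
    rw [hstep, ih, pPoly_succ]
    push_cast
    simp only [smul_eq_C_mul, C_add, C_mul, C_1]
    ring

theorem divDiffFun_gegPoly_mul {i j : Fin N} (h : i ≠ j) (κ : ℝ) (n : ℕ) :
    divDiffFun i j (pPoly κ (n + 1) i)
      = pPoly κ n j + X i * divDiffFun i j (pPoly κ n i) := by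
  have hs := divDiffFun_spec i j (pPoly κ n i)
  rw [swapVars_pPoly_left] at hs
  rw [pPoly_succ, divDiffFun_add h, divDiffFun_eq_zero h (rename_gegPoly κ _ _),
    divDiffFun_mul h, divDiffFun_X_left h]
  linear_combination hs

theorem divDiffFun_pPoly_right {i j : Fin N} (h : i ≠ j) (κ : ℝ) (n : ℕ) :
    divDiffFun i j (pPoly κ n j) = -divDiffFun i j (pPoly κ n i) := by
  apply eq_divDiffFun h
  have hs := divDiffFun_spec i j (pPoly κ n i)
  have hs' := swapVars_pPoly_left κ n j i
  rw [swapVars_comm] at hs'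
  rw [hs']
  rw [swapVars_pPoly_left] at hs
  linear_combination -hs

/-- The exchange term in the action of `T_i` on `p_a(x_i; x) p_b(x_j; x)`. -/
def exch (κ : ℝ) (i j : Fin N) (a b : ℕ) : MvPolynomial (Fin N) ℝ :=
  (X i - X j) * (divDiffFun i j (pPoly κ a i) * divDiffFun i j (pPoly κ b i))

theorem exch_comm (κ : ℝ) (i j : Fin N) (a b : ℕ) : exch κ i j a b = exch κ i j b a := by
  simp only [exch]; ring

theorem exch_zero_left (κ : ℝ) {i j : Fin N} (h : i ≠ j) (b : ℕ) : exch κ i j 0 b = 0 := by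
  rw [exch, pPoly_zero, divDiffFun_eq_zero h (map_one _)]
  ring

theorem exch_zero_right (κ : ℝ) {i j : Fin N} (h : i ≠ j) (a : ℕ) : exch κ i j a 0 = 0 := by
  rw [exch_comm, exch_zero_left κ h]

theorem exch_sub_exch (κ : ℝ) {i j : Fin N} (h : i ≠ j) (a b : ℕ) :
    exch κ i j a (b + 1) - exch κ i j (a + 1) b
      = pPoly κ a i * pPoly κ b j - pPoly κ b i * pPoly κ a j := by
  have ha := divDiffFun_spec i j (pPoly κ a i)
  have hb := divDiffFun_spec i j (pPoly κ b i)
  rw [swapVars_pPoly_left] at ha hb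
  rw [exch, exch, divDiffFun_gegPoly_mul h, divDiffFun_gegPoly_mul h]
  linear_combination pPoly κ a j * hb - pPoly κ b j * ha

theorem dunklT_mul_pPoly_of_ne (κ : ℝ) {k i j : Fin N} (hki : k ≠ i) (hkj : k ≠ j)
    (hij : i ≠ j) (a b : ℕ) : dunklT κ k (pPoly κ a i * pPoly κ b j) = 0 := by
  rw [dunklT_mul, dunklT_pPoly_of_ne κ hki, dunklT_pPoly_of_ne κ hkj, Finset.sum_eq_zero]
  · simp
  · intro l hl
    have hl : k ≠ l := by simpa [eq_comm] using hl
    rcases eq_or_ne i l with rfl | hil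
    · rw [divDiffFun_eq_zero hl (swapVars_pPoly_of_ne κ b hkj.symm hij.symm)]
      ring
    · rw [divDiffFun_eq_zero hl (swapVars_pPoly_of_ne κ a hki.symm hil)]
      ring

theorem dunklT_mul_pPoly_left (κ : ℝ) {i j : Fin N} (hij : i ≠ j) (a b : ℕ) :
    dunklT κ i (pPoly κ a i * pPoly κ b j)
      = dunklT κ i (pPoly κ a i) * pPoly κ b j + κ • exch κ i j a b := by
  rw [dunklT_mul, dunklT_pPoly_of_ne κ hij, Finset.sum_eq_single j]
  · rw [divDiffFun_pPoly_right hij, exch]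
    simp only [smul_eq_C_mul]
    ring
  · intro l hl hlj
    have hl : i ≠ l := by simpa [eq_comm] using hl
    rw [divDiffFun_eq_zero hl (swapVars_pPoly_of_ne κ b hij.symm hlj.symm)]
    ring
  · intro h; simp [hij.symm] at h

theorem dunklT_mul_pPoly_right (κ : ℝ) {i j : Fin N} (hij : i ≠ j) (a b : ℕ) :
    dunklT κ j (pPoly κ a i * pPoly κ b j)
      = pPoly κ a i * dunklT κ j (pPoly κ b j) - κ • exch κ i j a b := by
  have : exch κ j i b a = -exch κ i j a b := by
    rw [exch, exch, divDiffFun_comm hij, divDiffFun_comm hij, divDiffFun_pPoly_right hij,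
      divDiffFun_pPoly_right hij]
    ring
  rw [mul_comm, dunklT_mul_pPoly_left κ hij.symm, this]
  simp only [smul_eq_C_mul]
  ring

end GeneratingPolynomials

end PlanarDunkl

end

noncomputable section

namespace PlanarDunkl

section ChebyshevExpansion

open PowerSeries in
/-- If `f` satisfies the Chebyshev recurrence `f (e + 1) + f (e - 1) = 2 c f e`, then the double
series `∑ f (a - b) p^a q^b t^(a+b)` is a rational function. -/
theorem mk_sum_antidiagonal_mul_quads {A : Type*} [CommRing A] (f : ℤ → A) (c p q : A)
    (hf : ∀ e, f (e + 1) + f (e - 1) = 2 * c * f e) :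
    (PowerSeries.mk fun n => ∑ ab ∈ Finset.HasAntidiagonal.antidiagonal n,
        f ((ab.1 : ℤ) - ab.2) * (p ^ ab.1 * q ^ ab.2)) *
      ((1 - PowerSeries.C (2 * c * p) * X + PowerSeries.C (p ^ 2) * X ^ 2) *
        (1 - PowerSeries.C (2 * c * q) * X + PowerSeries.C (q ^ 2) * X ^ 2))
      = PowerSeries.C (f 0) - PowerSeries.C (q * f 1) * X - PowerSeries.C (p * f (-1)) * X
        + PowerSeries.C (p * q * f 0) * X ^ 2 := by
  let V : ℤ → PowerSeries A := fun k => PowerSeries.mk fun n => ∑ ab ∈ Finset.HasAntidiagonal.antidiagonal n,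
    f ((ab.1 : ℤ) - ab.2 + k) * (p ^ ab.1 * q ^ ab.2)
  let L : ℤ → PowerSeries A := fun k => PowerSeries.mk fun n => f (k - n) * q ^ n
  have hV : ∀ k, V k = L k + PowerSeries.C p * X * V (k + 1) := by
    intro k
    ext1 n
    rw [map_add, mul_assoc, PowerSeries.coeff_C_mul]
    cases n with
    | zero => simp [V, L]
    | succ n =>
      rw [PowerSeries.coeff_succ_X_mul]
      simp only [V, L, PowerSeries.coeff_mk, Finset.Nat.sum_antidiagonal_succ, Finset.mul_sum]
      congr 1
      · congr 2
        · push_cast; ring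
        · ring
      · refine Finset.sum_congr rfl fun ab _ => ?_
        have : ((ab.1 + 1 : ℕ) : ℤ) - ab.2 + k = (ab.1 : ℤ) - ab.2 + (k + 1) := by
          push_cast; ring
        rw [this]
        ring
  have hL : ∀ k, L k = PowerSeries.C (f k) + PowerSeries.C q * X * L (k - 1) := by
    intro k
    ext1 n
    rw [map_add, mul_assoc, PowerSeries.coeff_C_mul]
    cases n with
    | zero => simp [L]
    | succ n =>
      rw [PowerSeries.coeff_succ_X_mul, PowerSeries.coeff_C]
      simp only [L, PowerSeries.coeff_mk]
      have : k - ((n + 1 : ℕ) : ℤ) = k - 1 - n := by push_cast; ring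
      rw [this]
      simp [pow_succ]
      ring
  have hV2 : V 1 + V (-1) = PowerSeries.C (2 * c) * V 0 := by
    ext1 n
    rw [map_add, PowerSeries.coeff_C_mul]
    simp only [V, PowerSeries.coeff_mk, Finset.mul_sum]
    rw [← Finset.sum_add_distrib]
    refine Finset.sum_congr rfl fun ab _ => ?_
    have := hf ((ab.1 : ℤ) - ab.2)
    rw [add_zero, ← sub_eq_add_neg]
    linear_combination (p ^ ab.1 * q ^ ab.2) * this
  have hL2 : ∀ k, L (k + 1) + L (k - 1) = PowerSeries.C (2 * c) * L k := by
    intro k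
    ext1 n
    rw [map_add, PowerSeries.coeff_C_mul]
    simp only [L, PowerSeries.coeff_mk]
    have := hf (k - n)
    rw [← mul_assoc, ← this]
    have e1 : k + 1 - (n : ℤ) = k - n + 1 := by ring
    have e2 : k - 1 - (n : ℤ) = k - n - 1 := by ring
    rw [e1, e2]
    ring
  have hV0 : (PowerSeries.mk fun n => ∑ ab ∈ Finset.HasAntidiagonal.antidiagonal n,
      f ((ab.1 : ℤ) - ab.2) * (p ^ ab.1 * q ^ ab.2)) = V 0 := by
    simp only [V, add_zero]
  rw [hV0]
  have a1 := hV 0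
  have a2 := hV (-1)
  have a3 := hL 0
  have a4 := hL 1
  have a5 := hL2 0
  have a6 := hL2 (-1)
  have a7 := hL (-1)
  simp only [zero_add, zero_sub, neg_add_cancel, sub_self] at a1 a2 a3 a4 a5 a6 a7
  simp only [map_mul, map_pow] at *
  linear_combination (1 - PowerSeries.C 2 * PowerSeries.C c * PowerSeries.C q * X
      + PowerSeries.C q ^ 2 * X ^ 2) * (a1 - PowerSeries.C p * X * a2
      + PowerSeries.C p * X * hV2)
    + (a3 - PowerSeries.C q * X * a4 + PowerSeries.C q * X * a5)
    - PowerSeries.C p * X * (a7 - PowerSeries.C q * X * a3 + PowerSeries.C q * X * a6)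

open PowerSeries in
theorem mk_sum_antidiagonal_of_even {A : Type*} [CommRing A] (f : ℤ → A) (c p q : A)
    (hf : ∀ e, f (e + 1) + f (e - 1) = 2 * c * f e) (h0 : f 0 = 1) (h1 : f 1 = c)
    (h1' : f (-1) = c) (v : PowerSeries A)
    (hv : (1 - PowerSeries.C (2 * c * p) * X + PowerSeries.C (p ^ 2) * X ^ 2) *
        (1 - PowerSeries.C (2 * c * q) * X + PowerSeries.C (q ^ 2) * X ^ 2) * v = 1) :
    (1 - PowerSeries.C (c * (p + q)) * X + PowerSeries.C (p * q) * X ^ 2) * v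
      = PowerSeries.mk fun n => ∑ ab ∈ Finset.HasAntidiagonal.antidiagonal n,
        f ((ab.1 : ℤ) - ab.2) * (p ^ ab.1 * q ^ ab.2) := by
  have h := mk_sum_antidiagonal_mul_quads f c p q hf
  rw [h0, h1, h1'] at h
  have h2 : (1 - PowerSeries.C (c * (p + q)) * X + PowerSeries.C (p * q) * X ^ 2)
      = PowerSeries.C 1 - PowerSeries.C (q * c) * X - PowerSeries.C (p * c) * X
        + PowerSeries.C (p * q * 1) * X ^ 2 := by
    simp only [map_mul, map_add, map_one]
    ring
  rw [h2, ← h, mul_assoc, hv, mul_one]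

open PowerSeries in
theorem mk_sum_antidiagonal_of_odd {A : Type*} [CommRing A] (f : ℤ → A) (c p q : A)
    (hf : ∀ e, f (e + 1) + f (e - 1) = 2 * c * f e) (h0 : f 0 = 0) (h1 : f 1 = 1)
    (h1' : f (-1) = -1) (v : PowerSeries A)
    (hv : (1 - PowerSeries.C (2 * c * p) * X + PowerSeries.C (p ^ 2) * X ^ 2) *
        (1 - PowerSeries.C (2 * c * q) * X + PowerSeries.C (q ^ 2) * X ^ 2) * v = 1) :
    PowerSeries.C (p - q) * X * v
      = PowerSeries.mk fun n => ∑ ab ∈ Finset.HasAntidiagonal.antidiagonal n,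
        f ((ab.1 : ℤ) - ab.2) * (p ^ ab.1 * q ^ ab.2) := by
  have h := mk_sum_antidiagonal_mul_quads f c p q hf
  rw [h0, h1, h1'] at h
  have h2 : PowerSeries.C (p - q) * X
      = PowerSeries.C 0 - PowerSeries.C (q * 1) * X - PowerSeries.C (p * -1) * X
        + PowerSeries.C (p * q * 0) * X ^ 2 := by
    simp only [map_mul, map_sub, map_one, map_neg, map_zero]
    ring
  rw [h2, ← h, mul_assoc, hv, mul_one]

theorem quad_mul_quad_mul_invQuads : quad 0 * quad 1 * invQuads = 1 := by
  apply PowerSeries.mul_invOfUnit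
  simp [quad]

open Polynomial.Chebyshev in
theorem coeff_u1 (n : ℕ) : PowerSeries.coeff n u1 = ∑ ab ∈ Finset.HasAntidiagonal.antidiagonal n,
    T Sym ((ab.1 : ℤ) - ab.2) * (symP 0 ^ ab.1 * symP 1 ^ ab.2) := by
  have h := mk_sum_antidiagonal_of_even (fun e => T Sym e) Polynomial.X (symP 0) (symP 1)
    (fun e => by rw [T_add_one]; ring) (T_zero _) (T_one _) (T_neg_one _) _
    quad_mul_quad_mul_invQuads
  rw [u1, h, PowerSeries.coeff_mk]

open Polynomial.Chebyshev in
theorem coeff_u2 (n : ℕ) : PowerSeries.coeff n u2 = ∑ ab ∈ Finset.HasAntidiagonal.antidiagonal n,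
    U Sym ((ab.1 : ℤ) - ab.2 - 1) * (symP 0 ^ ab.1 * symP 1 ^ ab.2) := by
  have h := mk_sum_antidiagonal_of_odd (fun e => U Sym (e - 1)) Polynomial.X (symP 0) (symP 1)
    (fun e => by
      have := U_add_one Sym (e - 1)
      rw [sub_add_cancel] at this
      rw [add_sub_cancel_right, this]; ring) (U_neg_one _) (U_zero _) (U_neg_two _) _
    quad_mul_quad_mul_invQuads
  rw [u2, h, PowerSeries.coeff_mk]

open MvPolynomial in
theorem psiInv_C_mul {N : ℕ} (hN : 2 ≤ N) (κ r : ℝ) (a b : ℕ) :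
    psiInv hN κ (C r * (X 0 ^ a * X 1 ^ b))
      = r • (pPoly κ a (idx1 hN) * pPoly κ b (idx2 hN)) := by
  have : (C r * (X 0 ^ a * X 1 ^ b) : Sym)
      = r • basisMonomials (Fin 2) ℝ (Finsupp.single 0 a + Finsupp.single 1 b) := by
    rw [coe_basisMonomials, smul_eq_C_mul, X_pow_eq_monomial, X_pow_eq_monomial, monomial_mul,
      one_mul]
  rw [this, map_smul, psiInv, Module.Basis.constr_basis]
  simp

open Polynomial.Chebyshev in
theorem phi_eq {N : ℕ} (hN : 2 ≤ N) (κ : ℝ) (n j : ℕ) :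
    phi hN κ n j = ∑ ab ∈ Finset.HasAntidiagonal.antidiagonal n, (T ℝ ((ab.1 : ℤ) - ab.2)).coeff j •
      (pPoly κ ab.1 (idx1 hN) * pPoly κ ab.2 (idx2 hN)) := by
  rw [phi, coeff_u1, Polynomial.finsetSum_coeff, map_sum]
  refine Finset.sum_congr rfl fun ab _ => ?_
  rw [← psiInv_C_mul, symP, symP, ← map_pow, ← map_pow, ← map_mul, Polynomial.coeff_mul_C,
    ← map_T (MvPolynomial.C : ℝ →+* Sym), Polynomial.coeff_map]

open Polynomial.Chebyshev in
theorem psi_eq {N : ℕ} (hN : 2 ≤ N) (κ : ℝ) (n j : ℕ) :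
    psi hN κ n j = ∑ ab ∈ Finset.HasAntidiagonal.antidiagonal n, (U ℝ ((ab.1 : ℤ) - ab.2 - 1)).coeff j •
      (pPoly κ ab.1 (idx1 hN) * pPoly κ ab.2 (idx2 hN)) := by
  rw [psi, coeff_u2, Polynomial.finsetSum_coeff, map_sum]
  refine Finset.sum_congr rfl fun ab _ => ?_
  rw [← psiInv_C_mul, symP, symP, ← map_pow, ← map_pow, ← map_mul, Polynomial.coeff_mul_C,
    ← map_U (MvPolynomial.C : ℝ →+* Sym), Polynomial.coeff_map]

open Polynomial.Chebyshev in
theorem phi_eq_zero {N : ℕ} (hN : 2 ≤ N) (κ : ℝ) {n j : ℕ} (h : n < j) : phi hN κ n j = 0 := by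
  rw [phi_eq]
  refine Finset.sum_eq_zero fun ab hab => ?_
  rw [Finset.HasAntidiagonal.mem_antidiagonal] at hab
  rw [Polynomial.coeff_eq_zero_of_natDegree_lt, zero_smul]
  rw [natDegree_T]
  omega

open Polynomial.Chebyshev in
theorem psi_eq_zero {N : ℕ} (hN : 2 ≤ N) (κ : ℝ) {n j : ℕ} (h : n ≤ j) : psi hN κ n j = 0 := by
  rw [psi_eq]
  refine Finset.sum_eq_zero fun ab hab => ?_
  rw [Finset.HasAntidiagonal.mem_antidiagonal] at hab
  rcases eq_or_ne ((ab.1 : ℤ) - ab.2) 0 with h0 | h0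
  · rw [h0]; simp
  rw [Polynomial.coeff_eq_zero_of_natDegree_lt, zero_smul]
  rw [natDegree_U]
  omega

theorem phi_isHomogeneous {N : ℕ} (hN : 2 ≤ N) (κ : ℝ) (n j : ℕ) :
    (phi hN κ n j).IsHomogeneous n := by
  rw [phi_eq]
  refine isHomogeneous_sum fun ab hab => ?_
  rw [Finset.HasAntidiagonal.mem_antidiagonal] at hab
  rw [← hab]
  exact isHomogeneous_smul ((pPoly_isHomogeneous κ _ _).mul (pPoly_isHomogeneous κ _ _)) _

theorem psi_isHomogeneous {N : ℕ} (hN : 2 ≤ N) (κ : ℝ) (n j : ℕ) :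
    (psi hN κ n j).IsHomogeneous n := by
  rw [psi_eq]
  refine isHomogeneous_sum fun ab hab => ?_
  rw [Finset.HasAntidiagonal.mem_antidiagonal] at hab
  rw [← hab]
  exact isHomogeneous_smul ((pPoly_isHomogeneous κ _ _).mul (pPoly_isHomogeneous κ _ _)) _

end ChebyshevExpansion

section LoweringRelations

variable {N : ℕ} (hN : 2 ≤ N) (κ : ℝ)

theorem idx1_ne_idx2 : idx1 hN ≠ idx2 hN := by
  simp [idx1, idx2]

theorem dunklT_sum_left (n : ℕ) (g : ℕ → ℕ → ℝ) :
    dunklT κ (idx1 hN) (∑ ab ∈ Finset.HasAntidiagonal.antidiagonal (n + 1), g ab.1 ab.2 •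
        (pPoly κ ab.1 (idx1 hN) * pPoly κ ab.2 (idx2 hN)))
      = ∑ ab ∈ Finset.HasAntidiagonal.antidiagonal n, ((N * κ + ab.1 + 1) * g (ab.1 + 1) ab.2) •
          (pPoly κ ab.1 (idx1 hN) * pPoly κ ab.2 (idx2 hN))
        + κ • ∑ ab ∈ Finset.HasAntidiagonal.antidiagonal (n + 1), g ab.1 ab.2 •
          exch κ (idx1 hN) (idx2 hN) ab.1 ab.2 := by
  have h12 := idx1_ne_idx2 hN
  rw [map_sum, Finset.smul_sum]
  simp only [map_smul, dunklT_mul_pPoly_left κ h12, smul_add, Finset.sum_add_distrib]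
  congr 1
  · rw [Finset.Nat.sum_antidiagonal_succ]
    simp only [pPoly_zero, dunklT_one, zero_mul, smul_zero, zero_add, dunklT_pPoly_self]
    refine Finset.sum_congr rfl fun ab _ => ?_
    simp only [MvPolynomial.smul_eq_C_mul, MvPolynomial.C_mul]
    ring
  · exact Finset.sum_congr rfl fun ab _ => smul_comm _ _ _

theorem dunklT_sum_right (n : ℕ) (g : ℕ → ℕ → ℝ) :
    dunklT κ (idx2 hN) (∑ ab ∈ Finset.HasAntidiagonal.antidiagonal (n + 1), g ab.1 ab.2 •
        (pPoly κ ab.1 (idx1 hN) * pPoly κ ab.2 (idx2 hN)))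
      = ∑ ab ∈ Finset.HasAntidiagonal.antidiagonal n, ((N * κ + ab.2 + 1) * g ab.1 (ab.2 + 1)) •
          (pPoly κ ab.1 (idx1 hN) * pPoly κ ab.2 (idx2 hN))
        - κ • ∑ ab ∈ Finset.HasAntidiagonal.antidiagonal (n + 1), g ab.1 ab.2 •
          exch κ (idx1 hN) (idx2 hN) ab.1 ab.2 := by
  have h12 := idx1_ne_idx2 hN
  rw [map_sum, Finset.smul_sum]
  simp only [map_smul, dunklT_mul_pPoly_right κ h12, smul_sub, Finset.sum_sub_distrib]
  congr 1
  · rw [Finset.Nat.sum_antidiagonal_succ']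
    simp only [pPoly_zero, dunklT_one, mul_zero, smul_zero, zero_add, dunklT_pPoly_self]
    refine Finset.sum_congr rfl fun ab _ => ?_
    simp only [MvPolynomial.smul_eq_C_mul, MvPolynomial.C_mul]
    ring
  · exact Finset.sum_congr rfl fun ab _ => smul_comm _ _ _

theorem Tsum_sum (n : ℕ) (g : ℕ → ℕ → ℝ) :
    Tsum hN κ (∑ ab ∈ Finset.HasAntidiagonal.antidiagonal (n + 1), g ab.1 ab.2 •
        (pPoly κ ab.1 (idx1 hN) * pPoly κ ab.2 (idx2 hN)))
      = ∑ ab ∈ Finset.HasAntidiagonal.antidiagonal n, ((N * κ + ab.1 + 1) * g (ab.1 + 1) ab.2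
          + (N * κ + ab.2 + 1) * g ab.1 (ab.2 + 1)) •
          (pPoly κ ab.1 (idx1 hN) * pPoly κ ab.2 (idx2 hN)) := by
  rw [Tsum, LinearMap.add_apply, dunklT_sum_left, dunklT_sum_right]
  simp only [add_smul, Finset.sum_add_distrib]
  abel

theorem Tdiff_sum (n : ℕ) (g : ℕ → ℕ → ℝ) :
    Tdiff hN κ (∑ ab ∈ Finset.HasAntidiagonal.antidiagonal (n + 1), g ab.1 ab.2 •
        (pPoly κ ab.1 (idx1 hN) * pPoly κ ab.2 (idx2 hN)))
      = ∑ ab ∈ Finset.HasAntidiagonal.antidiagonal n, ((N * κ + ab.1 + 1) * g (ab.1 + 1) ab.2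
          - (N * κ + ab.2 + 1) * g ab.1 (ab.2 + 1)) •
          (pPoly κ ab.1 (idx1 hN) * pPoly κ ab.2 (idx2 hN))
        + (2 * κ) • ∑ ab ∈ Finset.HasAntidiagonal.antidiagonal (n + 1), g ab.1 ab.2 •
          exch κ (idx1 hN) (idx2 hN) ab.1 ab.2 := by
  rw [Tdiff, LinearMap.sub_apply, dunklT_sum_left, dunklT_sum_right]
  simp only [sub_smul, Finset.sum_sub_distrib, mul_smul, two_smul]
  abel

theorem sum_smul_exch_eq_zero (n : ℕ) (g : ℕ → ℕ → ℝ) (hg : ∀ a b, g b a = -g a b) :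
    ∑ ab ∈ Finset.HasAntidiagonal.antidiagonal n, g ab.1 ab.2 • exch κ (idx1 hN) (idx2 hN) ab.1 ab.2 = 0 := by
  have h := Finset.Nat.sum_antidiagonal_swap (n := n)
    (f := fun ab => g ab.1 ab.2 • exch κ (idx1 hN) (idx2 hN) ab.1 ab.2)
  simp only [Prod.fst_swap, Prod.snd_swap] at h
  have h2 : ∀ ab : ℕ × ℕ, g ab.2 ab.1 • exch κ (idx1 hN) (idx2 hN) ab.2 ab.1
      = -(g ab.1 ab.2 • exch κ (idx1 hN) (idx2 hN) ab.1 ab.2) := by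
    intro ab
    rw [hg ab.1 ab.2, exch_comm, neg_smul]
  simp only [h2, Finset.sum_neg_distrib] at h
  exact self_eq_neg.1 h.symm

theorem sum_smul_exch_eq (n : ℕ) (g u : ℕ → ℕ → ℝ) (hu : ∀ a b, u b a = -u a b)
    (hgu : ∀ a b, 2 * g (a + 1) (b + 1) = u (a + 1) b - u a (b + 1)) :
    ∑ ab ∈ Finset.HasAntidiagonal.antidiagonal (n + 1), g ab.1 ab.2 • exch κ (idx1 hN) (idx2 hN) ab.1 ab.2
      = ∑ ab ∈ Finset.HasAntidiagonal.antidiagonal n, u ab.1 ab.2 •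
          (pPoly κ ab.1 (idx1 hN) * pPoly κ ab.2 (idx2 hN)) := by
  have h12 := idx1_ne_idx2 hN
  have hswap := Finset.Nat.sum_antidiagonal_swap (n := n)
    (f := fun ab => u ab.1 ab.2 • (pPoly κ ab.1 (idx1 hN) * pPoly κ ab.2 (idx2 hN)))
  simp only [Prod.fst_swap, Prod.snd_swap] at hswap
  have h2 : (2 : ℝ) • ∑ ab ∈ Finset.HasAntidiagonal.antidiagonal n, u ab.1 ab.2 •
      (pPoly κ ab.1 (idx1 hN) * pPoly κ ab.2 (idx2 hN))
      = ∑ ab ∈ Finset.HasAntidiagonal.antidiagonal n, u ab.1 ab.2 •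
        (exch κ (idx1 hN) (idx2 hN) ab.1 (ab.2 + 1)
          - exch κ (idx1 hN) (idx2 hN) (ab.1 + 1) ab.2) := by
    rw [two_smul]
    nth_rw 2 [← hswap]
    rw [← Finset.sum_add_distrib]
    refine Finset.sum_congr rfl fun ab _ => ?_
    rw [exch_sub_exch κ h12, hu ab.1 ab.2, neg_smul, smul_sub]
    abel
  let w : ℕ × ℕ → MvPolynomial (Fin N) ℝ := fun ab => exch κ (idx1 hN) (idx2 hN) ab.1 ab.2
  have hb : ∀ (F : ℕ × ℕ → ℝ), ∑ ab ∈ Finset.HasAntidiagonal.antidiagonal (n + 1), F ab • w ab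
      = ∑ ab ∈ Finset.HasAntidiagonal.antidiagonal n, F (ab.1, ab.2 + 1) • w (ab.1, ab.2 + 1) := by
    intro F
    rw [Finset.Nat.sum_antidiagonal_succ']
    simp only [w, exch_zero_right κ h12, smul_zero, zero_add]
  have ha : ∀ (F : ℕ × ℕ → ℝ), ∑ ab ∈ Finset.HasAntidiagonal.antidiagonal (n + 1), F ab • w ab
      = ∑ ab ∈ Finset.HasAntidiagonal.antidiagonal n, F (ab.1 + 1, ab.2) • w (ab.1 + 1, ab.2) := by
    intro F
    rw [Finset.Nat.sum_antidiagonal_succ]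
    simp only [w, exch_zero_left κ h12, smul_zero, zero_add]
  have h3 := hb (fun ab => u ab.1 (ab.2 - 1))
  have h4 := ha (fun ab => u (ab.1 - 1) ab.2)
  simp only [Nat.add_sub_cancel] at h3 h4
  apply smul_right_injective _ (two_ne_zero (α := ℝ))
  change (2 : ℝ) • _ = (2 : ℝ) • _
  rw [h2]
  simp only [smul_sub, Finset.sum_sub_distrib]
  change _ = ∑ ab ∈ Finset.HasAntidiagonal.antidiagonal n, u ab.1 ab.2 • w (ab.1, ab.2 + 1)
    - ∑ ab ∈ Finset.HasAntidiagonal.antidiagonal n, u ab.1 ab.2 • w (ab.1 + 1, ab.2)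
  rw [← h3, ← h4, ← Finset.sum_sub_distrib, Finset.smul_sum]
  refine Finset.sum_congr rfl fun ab _ => ?_
  rcases ab with ⟨a, b⟩
  cases a with
  | zero => simp [w, exch_zero_left κ h12]
  | succ a =>
    cases b with
    | zero => simp [w, exch_zero_right κ h12]
    | succ b =>
      simp only [Nat.add_sub_cancel]
      rw [← sub_smul, ← hgu, mul_smul]

open Polynomial Polynomial.Chebyshev

theorem coeff_X_mul_derivative (p : ℝ[X]) (j : ℕ) :
    (X * derivative p).coeff j = j * p.coeff j := by
  cases j with
  | zero => simp
  | succ j => rw [coeff_X_mul, coeff_derivative]; push_cast; ring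

theorem U_add_U_sub_two (e : ℤ) : U ℝ e + U ℝ (e - 2) = 2 * X * U ℝ (e - 1) := by
  rw [U_eq ℝ e]; ring

theorem U_sub_U_sub_two (e : ℤ) : U ℝ e - U ℝ (e - 2) = 2 * T ℝ e := by
  have := two_mul_T_eq_U_sub_U ℝ (e - 2)
  rw [sub_add_cancel] at this
  exact this.symm

theorem T_add_one_eq (e : ℤ) : T ℝ (e + 1) = X * T ℝ e - (1 - X ^ 2) * U ℝ (e - 1) := by
  have := T_eq_X_mul_T_sub_pol_U ℝ (e - 1)
  have h1 : e - 1 + 2 = e + 1 := by ring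
  rw [h1, sub_add_cancel] at this
  exact this

theorem T_sub_one_eq (e : ℤ) : T ℝ (e - 1) = X * T ℝ e + (1 - X ^ 2) * U ℝ (e - 1) := by
  rw [T_sub_one, T_add_one_eq]; ring

theorem one_sub_sq_mul_derivative_U (e : ℤ) :
    (1 - X ^ 2) * derivative (U ℝ (e - 1)) = X * U ℝ (e - 1) - (e : ℝ[X]) * T ℝ e := by
  have := add_one_mul_T_eq_poly_in_U (R := ℝ) (e - 1)
  rw [sub_add_cancel] at this
  push_cast at this
  linear_combination this

theorem Tsum_phi_pol (s : ℝ) (a b : ℕ) :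
    C (s + a + 1) * T ℝ ((a + 1 : ℕ) - b : ℤ) + C (s + b + 1) * T ℝ (a - (b + 1 : ℕ) : ℤ)
      = C (a + b + 2 + 2 * s) * (X * T ℝ (a - b : ℤ))
        - derivative (T ℝ (a - b : ℤ)) + X * (X * derivative (T ℝ (a - b : ℤ))) := by
  have e1 : ((a + 1 : ℕ) - b : ℤ) = (a - b : ℤ) + 1 := by push_cast; ring
  have e2 : (a - (b + 1 : ℕ) : ℤ) = (a - b : ℤ) - 1 := by push_cast; ring
  rw [e1, e2, T_add_one_eq, T_sub_one_eq, T_derivative_eq_U]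
  push_cast
  simp only [map_add, map_mul, map_natCast, map_one, map_ofNat]
  ring

theorem Tsum_psi_pol (s : ℝ) (a b : ℕ) :
    C (s + a + 1) * U ℝ ((a + 1 : ℕ) - b - 1 : ℤ) + C (s + b + 1) * U ℝ (a - (b + 1 : ℕ) - 1 : ℤ)
      = C (a + b + 3 + 2 * s) * (X * U ℝ (a - b - 1 : ℤ))
        - derivative (U ℝ (a - b - 1 : ℤ)) + X * (X * derivative (U ℝ (a - b - 1 : ℤ))) := by
  have e1 : ((a + 1 : ℕ) - b - 1 : ℤ) = (a - b : ℤ) := by push_cast; ring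
  have e2 : (a - (b + 1 : ℕ) - 1 : ℤ) = (a - b : ℤ) - 2 := by push_cast; ring
  have h1 := U_add_U_sub_two (a - b)
  have h2 := U_sub_U_sub_two (a - b)
  have h3 := one_sub_sq_mul_derivative_U (a - b)
  push_cast at h3
  rw [e1, e2]
  have hU : U ℝ (a - b : ℤ) = X * U ℝ (a - b - 1 : ℤ) + T ℝ (a - b : ℤ) := by
    have h22 : (2 : ℝ[X]) ≠ 0 := two_ne_zero
    apply mul_left_cancel₀ h22
    linear_combination h1 + h2
  have hU2 : U ℝ (a - b - 2 : ℤ) = X * U ℝ (a - b - 1 : ℤ) - T ℝ (a - b : ℤ) := by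
    linear_combination h1 - hU
  rw [hU, hU2]
  simp only [map_add, map_mul, map_natCast, map_one, map_ofNat]
  linear_combination h3

theorem Tdiff_psi_pol (s : ℝ) (a b : ℕ) :
    C (s + a + 1) * U ℝ ((a + 1 : ℕ) - b - 1 : ℤ) - C (s + b + 1) * U ℝ (a - (b + 1 : ℕ) - 1 : ℤ)
      = C (a + b + 2 + 2 * s) * T ℝ (a - b : ℤ) + X * derivative (T ℝ (a - b : ℤ)) := by
  have e1 : ((a + 1 : ℕ) - b - 1 : ℤ) = (a - b : ℤ) := by push_cast; ring
  have e2 : (a - (b + 1 : ℕ) - 1 : ℤ) = (a - b : ℤ) - 2 := by push_cast; ring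
  have h1 := U_add_U_sub_two (a - b)
  have h2 := U_sub_U_sub_two (a - b)
  rw [e1, e2, T_derivative_eq_U]
  have hU : U ℝ (a - b : ℤ) = X * U ℝ (a - b - 1 : ℤ) + T ℝ (a - b : ℤ) := by
    have h22 : (2 : ℝ[X]) ≠ 0 := two_ne_zero
    apply mul_left_cancel₀ h22
    linear_combination h1 + h2
  have hU2 : U ℝ (a - b - 2 : ℤ) = X * U ℝ (a - b - 1 : ℤ) - T ℝ (a - b : ℤ) := by
    linear_combination h1 - hU
  rw [hU, hU2]
  push_cast
  simp only [map_add, map_mul, map_natCast, map_one, map_ofNat]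
  ring

theorem Tdiff_phi_pol (s : ℝ) (a b : ℕ) :
    C (s + a + 1) * T ℝ ((a + 1 : ℕ) - b : ℤ) - C (s + b + 1) * T ℝ (a - (b + 1 : ℕ) : ℤ)
      = C (a + b + 3 + 2 * s) * (X * (X * U ℝ (a - b - 1 : ℤ)))
        - C (a + b + 2 + 2 * s) * U ℝ (a - b - 1 : ℤ)
        - X * derivative (U ℝ (a - b - 1 : ℤ))
        + X * (X * (X * derivative (U ℝ (a - b - 1 : ℤ)))) := by
  have e1 : ((a + 1 : ℕ) - b : ℤ) = (a - b : ℤ) + 1 := by push_cast; ring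
  have e2 : (a - (b + 1 : ℕ) : ℤ) = (a - b : ℤ) - 1 := by push_cast; ring
  have h3 := one_sub_sq_mul_derivative_U (a - b)
  push_cast at h3
  rw [e1, e2, T_add_one_eq, T_sub_one_eq]
  simp only [map_add, map_mul, map_natCast, map_one, map_ofNat]
  linear_combination X * h3

theorem Tsum_phi_zero (n : ℕ) : Tsum hN κ (phi hN κ (n + 1) 0) = -phi hN κ n 1 := by
  rw [phi_eq, phi_eq, Tsum_sum hN κ n (fun a b => (T ℝ ((a : ℤ) - b)).coeff 0),
    ← Finset.sum_neg_distrib]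
  refine Finset.sum_congr rfl fun ab _ => ?_
  rw [← neg_smul]
  congr 1
  have := congrArg (coeff · 0) (Tsum_phi_pol (N * κ) ab.1 ab.2)
  simp only [coeff_add, coeff_sub, coeff_C_mul, coeff_X_mul_zero, coeff_derivative] at this
  rw [this]
  norm_num

theorem Tsum_phi_succ (n j : ℕ) : Tsum hN κ (phi hN κ (n + 1) (j + 1))
    = (n + j + 2 + 2 * (N * κ)) • phi hN κ n j - ((j : ℝ) + 2) • phi hN κ n (j + 2) := by
  rw [phi_eq, phi_eq, phi_eq, Tsum_sum hN κ n (fun a b => (T ℝ ((a : ℤ) - b)).coeff (j + 1)),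
    Finset.smul_sum, Finset.smul_sum, ← Finset.sum_sub_distrib]
  refine Finset.sum_congr rfl fun ab hab => ?_
  rw [Finset.HasAntidiagonal.mem_antidiagonal] at hab
  rw [smul_smul, smul_smul, ← sub_smul]
  congr 1
  have := congrArg (coeff · (j + 1)) (Tsum_phi_pol (N * κ) ab.1 ab.2)
  simp only [coeff_add, coeff_sub, coeff_C_mul, coeff_X_mul, coeff_X_mul_derivative,
    coeff_derivative] at this
  rw [this, ← hab]
  push_cast
  ring

theorem Tsum_psi_zero (n : ℕ) : Tsum hN κ (psi hN κ (n + 1) 0) = -psi hN κ n 1 := by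
  rw [psi_eq, psi_eq, Tsum_sum hN κ n (fun a b => (U ℝ ((a : ℤ) - b - 1)).coeff 0),
    ← Finset.sum_neg_distrib]
  refine Finset.sum_congr rfl fun ab _ => ?_
  rw [← neg_smul]
  congr 1
  have := congrArg (coeff · 0) (Tsum_psi_pol (N * κ) ab.1 ab.2)
  simp only [coeff_add, coeff_sub, coeff_C_mul, coeff_X_mul_zero, coeff_derivative] at this
  rw [this]
  norm_num

theorem Tsum_psi_succ (n j : ℕ) : Tsum hN κ (psi hN κ (n + 1) (j + 1))
    = (n + j + 3 + 2 * (N * κ)) • psi hN κ n j - ((j : ℝ) + 2) • psi hN κ n (j + 2) := by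
  rw [psi_eq, psi_eq, psi_eq,
    Tsum_sum hN κ n (fun a b => (U ℝ ((a : ℤ) - b - 1)).coeff (j + 1)),
    Finset.smul_sum, Finset.smul_sum, ← Finset.sum_sub_distrib]
  refine Finset.sum_congr rfl fun ab hab => ?_
  rw [Finset.HasAntidiagonal.mem_antidiagonal] at hab
  rw [smul_smul, smul_smul, ← sub_smul]
  congr 1
  have := congrArg (coeff · (j + 1)) (Tsum_psi_pol (N * κ) ab.1 ab.2)
  simp only [coeff_add, coeff_sub, coeff_C_mul, coeff_X_mul, coeff_X_mul_derivative,
    coeff_derivative] at this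
  rw [this, ← hab]
  push_cast
  ring

theorem U_antisymm (a b : ℕ) :
    U ℝ ((b : ℤ) - a - 1) = -U ℝ ((a : ℤ) - b - 1) := by
  have := U_neg_sub_one ℝ ((a : ℤ) - b)
  rw [← this]
  congr 1
  ring

theorem Tdiff_psi (n j : ℕ) : Tdiff hN κ (psi hN κ (n + 1) j)
    = (n + j + 2 + 2 * (N * κ)) • phi hN κ n j := by
  rw [psi_eq, phi_eq, Tdiff_sum hN κ n (fun a b => (U ℝ ((a : ℤ) - b - 1)).coeff j),
    sum_smul_exch_eq_zero hN κ (n + 1) (fun a b => (U ℝ ((a : ℤ) - b - 1)).coeff j)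
      (fun a b => by rw [U_antisymm, coeff_neg]),
    smul_zero, add_zero, Finset.smul_sum]
  refine Finset.sum_congr rfl fun ab hab => ?_
  rw [Finset.HasAntidiagonal.mem_antidiagonal] at hab
  rw [smul_smul]
  congr 1
  have := congrArg (coeff · j) (Tdiff_psi_pol (N * κ) ab.1 ab.2)
  simp only [coeff_add, coeff_sub, coeff_C_mul, coeff_X_mul_derivative] at this
  rw [this, ← hab]
  push_cast
  ring

theorem Tdiff_phi_aux (n j : ℕ) : Tdiff hN κ (phi hN κ (n + 1) j)
    = ∑ ab ∈ Finset.HasAntidiagonal.antidiagonal n, ((C (N * κ + ab.1 + 1) * T ℝ ((ab.1 + 1 : ℕ) - ab.2 : ℤ)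
        - C (N * κ + ab.2 + 1) * T ℝ (ab.1 - (ab.2 + 1 : ℕ) : ℤ)).coeff j
        + 2 * κ * (U ℝ ((ab.1 : ℤ) - ab.2 - 1)).coeff j) •
      (pPoly κ ab.1 (idx1 hN) * pPoly κ ab.2 (idx2 hN)) := by
  rw [phi_eq, Tdiff_sum hN κ n (fun a b => (T ℝ ((a : ℤ) - b)).coeff j),
    sum_smul_exch_eq hN κ n (fun a b => (T ℝ ((a : ℤ) - b)).coeff j)
      (fun a b => (U ℝ ((a : ℤ) - b - 1)).coeff j)
      (fun a b => by rw [U_antisymm, coeff_neg]), Finset.smul_sum, ← Finset.sum_add_distrib]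
  · refine Finset.sum_congr rfl fun ab hab => ?_
    rw [smul_smul, ← add_smul, coeff_sub, coeff_C_mul, coeff_C_mul]
  · intro a b
    have h := congrArg (coeff · j) (U_sub_U_sub_two ((a : ℤ) - b))
    simp only [coeff_sub] at h
    have h2 : (2 * T ℝ ((a : ℤ) - b)).coeff j = 2 * (T ℝ ((a : ℤ) - b)).coeff j := by
      rw [← coeff_C_mul]; rfl
    rw [h2] at h
    have e0 : ((a + 1 : ℕ) : ℤ) - (b + 1 : ℕ) = a - b := by push_cast; ring
    have e1 : ((a + 1 : ℕ) : ℤ) - b - 1 = a - b := by push_cast; ring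
    have e2 : (a : ℤ) - (b + 1 : ℕ) - 1 = a - b - 2 := by push_cast; ring
    rw [e0, e1, e2, h]

theorem Tdiff_phi_zero (n : ℕ) : Tdiff hN κ (phi hN κ (n + 1) 0)
    = -(n + 2 + 2 * (N * κ) - 2 * κ) • psi hN κ n 0 := by
  rw [Tdiff_phi_aux, psi_eq, Finset.smul_sum]
  refine Finset.sum_congr rfl fun ab hab => ?_
  rw [Finset.HasAntidiagonal.mem_antidiagonal] at hab
  rw [smul_smul, Tdiff_phi_pol]
  congr 1
  simp only [coeff_add, coeff_sub, coeff_C_mul, coeff_X_mul_zero]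
  rw [← hab]
  push_cast
  ring

theorem Tdiff_phi_one (n : ℕ) : Tdiff hN κ (phi hN κ (n + 1) 1)
    = -(n + 3 + 2 * (N * κ) - 2 * κ) • psi hN κ n 1 := by
  rw [Tdiff_phi_aux, psi_eq, Finset.smul_sum]
  refine Finset.sum_congr rfl fun ab hab => ?_
  rw [Finset.HasAntidiagonal.mem_antidiagonal] at hab
  rw [smul_smul, Tdiff_phi_pol]
  congr 1
  have h1 : ∀ p : ℝ[X], (X * p).coeff 1 = p.coeff 0 := fun p => coeff_X_mul p 0
  simp only [coeff_add, coeff_sub, coeff_C_mul, h1, coeff_X_mul_zero, coeff_derivative]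
  rw [← hab]
  push_cast
  ring

theorem Tdiff_phi_add_two (n j : ℕ) : Tdiff hN κ (phi hN κ (n + 1) (j + 2))
    = (n + j + 3 + 2 * (N * κ)) • psi hN κ n j
      - (n + j + 4 + 2 * (N * κ) - 2 * κ) • psi hN κ n (j + 2) := by
  rw [Tdiff_phi_aux, psi_eq, psi_eq, Finset.smul_sum, Finset.smul_sum, ← Finset.sum_sub_distrib]
  refine Finset.sum_congr rfl fun ab hab => ?_
  rw [Finset.HasAntidiagonal.mem_antidiagonal] at hab
  rw [smul_smul, smul_smul, ← sub_smul, Tdiff_phi_pol]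
  congr 1
  have h2 : (X * derivative (U ℝ (ab.1 - ab.2 - 1 : ℤ))).coeff (j + 2)
      = (j + 2 : ℕ) * (U ℝ (ab.1 - ab.2 - 1 : ℤ)).coeff (j + 2) := coeff_X_mul_derivative _ _
  rw [coeff_add, coeff_sub, coeff_sub, h2]
  rw [show j + 2 = j + 1 + 1 from rfl]
  simp only [coeff_C_mul, coeff_X_mul, coeff_X_mul_derivative]
  rw [← hab]
  push_cast
  ring

end LoweringRelations

end PlanarDunkl

end

noncomputable section

namespace PlanarDunkl

section Contiguity

theorem gO_rec (n : ℕ) (v : ℝ) : gO (n + 2) v = (v + 3 * ((n : ℝ) + 1) + 1) * gO (n + 1) v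
    - ((n : ℝ) + 1) * (2 * ((n : ℝ) + 1) - 1) * gO n v := rfl

theorem gE_rec (n : ℕ) (v : ℝ) : gE (n + 2) v = (v + 3 * ((n : ℝ) + 1) + 2) * gE (n + 1) v
    - ((n : ℝ) + 1) * (2 * ((n : ℝ) + 1) + 1) * gE n v := rfl

/-- Both families of contiguity relations that connect `gO` and `gE`. -/
theorem gO_gE_contiguous (j : ℕ) (v : ℝ) :
    gO (j + 1) v = (2 * j + 1) * gO j v + v * gE j v ∧
      gO (j + 1) v = gE (j + 1) (v + 1) - 2 * (j + 1) * gE j (v + 1) := by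
  induction j using Nat.twoStepInduction with
  | zero => constructor <;> (simp [gO, gE]; try ring)
  | one => constructor <;> simp [gO, gE] <;> ring
  | more j h0 h1 =>
    constructor
    · rw [gO_rec (j + 1), gE_rec j]
      have e1 := h1.1
      have e0 := h0.1
      have e2 := gO_rec j v
      push_cast at *
      linear_combination (v + 3 * j + 5) * e1 - (j + 1) * (2 * j + 3) * e0 - (2 * j + 3) * e2
    · rw [gO_rec (j + 1), gE_rec (j + 1), gE_rec j]
      have e1 := h1.2
      have e0 := h0.2
      rw [gE_rec] at e1
      push_cast at *
      linear_combination (v + 3 * (j + 2) + 1) * e1 - (j + 2) * (2 * j + 3) * e0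

theorem gO_succ_eq (j : ℕ) (v : ℝ) : gO (j + 1) v = (2 * j + 1) * gO j v + v * gE j v :=
  (gO_gE_contiguous j v).1

theorem gO_succ_eq_gE (j : ℕ) (v : ℝ) :
    gO (j + 1) v = gE (j + 1) (v + 1) - 2 * (j + 1) * gE j (v + 1) :=
  (gO_gE_contiguous j v).2

theorem gO_succ_eq_shift (j : ℕ) (v : ℝ) :
    gO (j + 1) v = (2 * v + 2 * j + 1) * gO j v - v * gO j (v - 1) := by
  induction j using Nat.twoStepInduction with
  | zero => simp [gO]; ring
  | one => simp [gO]; ring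
  | more j h0 h1 =>
    have e1 := gO_rec (j + 1) v
    have e0 := gO_rec j v
    have f0 := gO_rec j (v - 1)
    push_cast at *
    linear_combination e1 - (2 * v + 2 * j + 5) * e0 + v * f0 + (v + 3 * j + 3) * h1
      - (j + 1) * (2 * j + 1) * h0 + 4 * e0

theorem gE_succ_eq_shift (j : ℕ) (v : ℝ) :
    gE (j + 1) v = (2 * v + 2 * j + 1) * gE j v - (v - 1) * gE j (v - 1) := by
  induction j using Nat.twoStepInduction with
  | zero => simp [gE]; ring
  | one => simp [gE]; ring
  | more j h0 h1 =>
    have e1 := gE_rec (j + 1) v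
    have e0 := gE_rec j v
    have f0 := gE_rec j (v - 1)
    push_cast at *
    linear_combination e1 - (2 * v + 2 * j + 5) * e0 + (v - 1) * f0 + (v + 3 * j + 4) * h1
      - (j + 1) * (2 * j + 3) * h0 + 4 * e0

end Contiguity

section HarmonicPolynomials

variable {N : ℕ} (hN : 2 ≤ N) (κ : ℝ)

theorem hPlus_even (m : ℕ) : hPlus hN κ (2 * m) = ∑ j ∈ Finset.range (m + 1),
    ((2 : ℝ)⁻¹ ^ j * (gO j (N * κ - κ + m) / poch (N * κ + m + 1) j)) •
      phi hN κ (2 * m) (2 * j) := by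
  have h : 2 * m / 2 = m := by omega
  simp only [hPlus, even_two_mul, if_true, h]

theorem hPlus_odd (m : ℕ) : hPlus hN κ (2 * m + 1) = ∑ j ∈ Finset.range (m + 1),
    ((2 : ℝ)⁻¹ ^ j * (gE j (N * κ - κ + m + 1) / poch (N * κ + m + 2) j)) •
      phi hN κ (2 * m + 1) (2 * j + 1) := by
  have h : (2 * m + 1) / 2 = m := by omega
  have h2 : ¬ Even (2 * m + 1) := by simp
  simp only [hPlus, h2, if_false, h]

theorem hMinus_even (m : ℕ) : hMinus hN κ (2 * m) = ∑ j ∈ Finset.range m,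
    ((2 : ℝ)⁻¹ ^ j * (gE j (N * κ - κ + m) / poch (N * κ + m + 2) j)) •
      psi hN κ (2 * m) (2 * j + 1) := by
  have h : 2 * m / 2 = m := by omega
  simp only [hMinus, even_two_mul, if_true, h]

theorem hMinus_odd (m : ℕ) : hMinus hN κ (2 * m + 1) = ∑ j ∈ Finset.range (m + 1),
    ((2 : ℝ)⁻¹ ^ j * (gO j (N * κ - κ + m) / poch (N * κ + m + 2) j)) •
      psi hN κ (2 * m + 1) (2 * j) := by
  have h : (2 * m + 1) / 2 = m := by omega
  have h2 : ¬ Even (2 * m + 1) := by simp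
  simp only [hMinus, h2, if_false, h]

theorem hPlus_isHomogeneous (n : ℕ) : (hPlus hN κ n).IsHomogeneous n := by
  rcases Nat.even_or_odd' n with ⟨m, rfl | rfl⟩
  · rw [hPlus_even]
    exact isHomogeneous_sum fun j _ => isHomogeneous_smul (phi_isHomogeneous hN κ _ _) _
  · rw [hPlus_odd]
    exact isHomogeneous_sum fun j _ => isHomogeneous_smul (phi_isHomogeneous hN κ _ _) _

theorem hMinus_isHomogeneous (n : ℕ) : (hMinus hN κ n).IsHomogeneous n := by
  rcases Nat.even_or_odd' n with ⟨m, rfl | rfl⟩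
  · rw [hMinus_even]
    exact isHomogeneous_sum fun j _ => isHomogeneous_smul (psi_isHomogeneous hN κ _ _) _
  · rw [hMinus_odd]
    exact isHomogeneous_sum fun j _ => isHomogeneous_smul (psi_isHomogeneous hN κ _ _) _

variable {κ}

/-- Applying an operator that lowers the index, when the first basis element has no lowered
term. -/
theorem map_sum_range_succ {V : Type*} [AddCommGroup V] [Module ℝ V] (S : Module.End ℝ V)
    (x y : ℕ → V) (a α β b : ℕ → ℝ) (K : ℕ)
    (h0 : S (x 0) = -(β 0 • y 0))
    (hS : ∀ j, S (x (j + 1)) = α j • y j - β (j + 1) • y (j + 1)) (hy : y K = 0)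
    (hb : ∀ j, a (j + 1) * α j - a j * β j = b j) :
    S (∑ j ∈ Finset.range (K + 1), a j • x j) = ∑ j ∈ Finset.range K, b j • y j := by
  rw [map_sum, Finset.sum_range_succ']
  simp only [map_smul, hS, h0, ← hb, sub_smul, smul_sub, Finset.sum_sub_distrib, mul_smul,
    smul_neg]
  have h1 : ∑ j ∈ Finset.range (K + 1), a j • β j • y j
      = ∑ j ∈ Finset.range K, a (j + 1) • β (j + 1) • y (j + 1) + a 0 • β 0 • y 0 :=
    Finset.sum_range_succ' _ _
  rw [Finset.sum_range_succ, hy, smul_zero, smul_zero, add_zero] at h1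
  rw [h1]
  abel

/-- Applying an operator that lowers the index. -/
theorem map_sum_range {V : Type*} [AddCommGroup V] [Module ℝ V] (S : Module.End ℝ V)
    (x y : ℕ → V) (a α β b : ℕ → ℝ) (K : ℕ)
    (hS : ∀ j, S (x j) = α j • y j - β (j + 1) • y (j + 1)) (hy : y K = 0)
    (hb0 : a 0 * α 0 = b 0)
    (hb : ∀ j, a (j + 1) * α (j + 1) - a j * β (j + 1) = b (j + 1)) :
    S (∑ j ∈ Finset.range K, a j • x j) = ∑ j ∈ Finset.range K, b j • y j := by
  cases K with
  | zero => simp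
  | succ K =>
    rw [map_sum, Finset.sum_range_succ' (fun j => b j • y j)]
    simp only [map_smul, hS, ← hb, ← hb0, sub_smul, smul_sub, Finset.sum_sub_distrib, mul_smul]
    rw [Finset.sum_range_succ' (fun j => a j • α j • y j),
      Finset.sum_range_succ (fun j => a j • β (j + 1) • y (j + 1)), hy]
    simp only [smul_zero]
    abel

variable (hκ : -1 / (N : ℝ) < κ)

include hN hκ in
theorem Nκ_gt : -1 < (N : ℝ) * κ := by
  have hN0 : (0 : ℝ) < N := by positivity
  rw [div_lt_iff₀ hN0] at hκ
  linarith

theorem poch_ne_zero_of {x : ℝ} (hx : -1 < x) (m j : ℕ) : poch (x + m + 1) j ≠ 0 := by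
  have : (0 : ℝ) ≤ m := by positivity
  exact (poch_pos (by linarith) j).ne'

theorem poch_ne_zero_of' {x : ℝ} (hx : -1 < x) (m j : ℕ) : poch (x + m + 2) j ≠ 0 := by
  have : (0 : ℝ) ≤ m := by positivity
  exact (poch_pos (by linarith) j).ne'

/-- A change of the base point in a Pochhammer denominator. -/
theorem add_div_poch {x : ℝ} (hx : 0 < x) (j : ℕ) :
    (x + j) / poch (x + 1) j = x / poch x j := by
  have h1 := poch_succ x j
  have h2 := poch_succ_left x j
  have h3 := (poch_pos hx j).ne'
  have h4 := (poch_pos (by linarith : 0 < x + 1) j).ne'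
  field_simp
  linear_combination h2 - h1

include hκ

theorem Tsum_hPlus_even (m : ℕ) : Tsum hN κ (hPlus hN κ (2 * (m + 1)))
    = (N * κ - κ + (m + 1 : ℕ)) • hPlus hN κ (2 * m + 1) := by
  have hx := Nκ_gt hN hκ
  rw [hPlus_even, hPlus_odd, Finset.smul_sum]
  simp only [smul_smul]
  refine map_sum_range_succ (Tsum hN κ) (fun j => phi hN κ (2 * (m + 1)) (2 * j))
    (fun j => phi hN κ (2 * m + 1) (2 * j + 1)) _
    (fun j => 2 * (N * κ + m + 2 + j)) (fun j => 2 * j + 1) _ (m + 1) ?_ ?_ ?_ ?_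
  · have := Tsum_phi_zero hN κ (2 * m + 1)
    rw [show 2 * m + 1 + 1 = 2 * (m + 1) by ring] at this
    simpa using this
  · intro j
    have := Tsum_phi_succ hN κ (2 * m + 1) (2 * j + 1)
    rw [show 2 * (m + 1) = 2 * m + 1 + 1 by ring, show 2 * (j + 1) = 2 * j + 1 + 1 by ring, this]
    congr 2
    · push_cast; ring
    · push_cast; ring
  · exact phi_eq_zero hN κ (by omega)
  · intro j
    have h1 := poch_ne_zero_of hx (m + 1) j
    have e : N * κ + (m : ℝ) + 2 = N * κ + (m + 1 : ℕ) + 1 := by push_cast; ring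
    have e2 : N * κ - κ + (m : ℝ) + 1 = N * κ - κ + (m + 1 : ℕ) := by push_cast; ring
    rw [e2, e, poch_succ, gO_succ_eq]
    have h2 : N * κ + (m + 1 : ℕ) + 1 + (j : ℝ) ≠ 0 := by
      have : (0 : ℝ) ≤ j := by positivity
      push_cast
      have : (0 : ℝ) ≤ m := by positivity
      linarith
    rw [pow_succ]
    field_simp
    ring

theorem Tsum_hPlus_odd (m : ℕ) : Tsum hN κ (hPlus hN κ (2 * m + 1))
    = (2 * (N * κ + m + 1)) • hPlus hN κ (2 * m) := by
  have hx := Nκ_gt hN hκ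
  have hm : (0 : ℝ) ≤ m := by positivity
  rw [hPlus_even, hPlus_odd, Finset.smul_sum]
  simp only [smul_smul]
  refine map_sum_range (Tsum hN κ) (fun j => phi hN κ (2 * m + 1) (2 * j + 1))
    (fun j => phi hN κ (2 * m) (2 * j)) _
    (fun j => 2 * (N * κ + m + 1 + j)) (fun j => 2 * j) _ (m + 1) ?_ ?_ ?_ ?_
  · intro j
    rw [Tsum_phi_succ hN κ (2 * m) (2 * j)]
    congr 2
    · push_cast; ring
    · push_cast; ring
  · exact phi_eq_zero hN κ (by omega)
  · simp [poch_zero, gO, gE]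
  · intro j
    have h1 := add_div_poch (by linarith : 0 < N * κ + (m : ℝ) + 1) (j + 1)
    have h3 := poch_ne_zero_of' hx m j
    have h2 : N * κ + (m : ℝ) + 2 + (j : ℝ) ≠ 0 := by
      have : (0 : ℝ) ≤ j := by positivity
      linarith
    rw [gO_succ_eq_gE, show 2 * (N * κ + (m : ℝ) + 1) * (2⁻¹ ^ (j + 1)
      * ((gE (j + 1) (N * κ - κ + m + 1) - 2 * (j + 1) * gE j (N * κ - κ + m + 1))
        / poch (N * κ + m + 1) (j + 1)))
      = 2 * 2⁻¹ ^ (j + 1)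
      * ((gE (j + 1) (N * κ - κ + m + 1) - 2 * (j + 1) * gE j (N * κ - κ + m + 1))
        * ((N * κ + (m : ℝ) + 1) / poch (N * κ + m + 1) (j + 1))) by ring, ← h1,
      show N * κ + (m : ℝ) + 1 + 1 = N * κ + m + 2 by ring, poch_succ, pow_succ]
    push_cast
    field_simp
    ring

theorem Tdiff_hPlus_even (m : ℕ) : Tdiff hN κ (hPlus hN κ (2 * (m + 1)))
    = -(N * κ - κ + (m + 1 : ℕ)) • hMinus hN κ (2 * m + 1) := by
  have hx := Nκ_gt hN hκ
  rw [hPlus_even, hMinus_odd, Finset.smul_sum]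
  simp only [smul_smul]
  refine map_sum_range_succ (Tdiff hN κ) (fun j => phi hN κ (2 * (m + 1)) (2 * j))
    (fun j => psi hN κ (2 * m + 1) (2 * j)) _
    (fun j => 2 * (N * κ + m + 2 + j)) (fun j => 2 * (N * κ - κ + (m + 1 : ℕ)) + 2 * j + 1)
    _ (m + 1) ?_ ?_ ?_ ?_
  · have := Tdiff_phi_zero hN κ (2 * m + 1)
    rw [mul_zero, show 2 * (m + 1) = 2 * m + 1 + 1 by ring, this, ← neg_smul]
    congr 1
    push_cast; ring
  · intro j
    have := Tdiff_phi_add_two hN κ (2 * m + 1) (2 * j)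
    rw [show 2 * (m + 1) = 2 * m + 1 + 1 by ring, show 2 * (j + 1) = 2 * j + 2 by ring, this]
    congr 2
    · push_cast; ring
    · push_cast; ring
  · exact psi_eq_zero hN κ (by omega)
  · intro j
    have h1 := poch_ne_zero_of hx (m + 1) j
    have e : N * κ + (m : ℝ) + 2 = N * κ + (m + 1 : ℕ) + 1 := by push_cast; ring
    have e2 : N * κ - κ + (m : ℝ) = N * κ - κ + (m + 1 : ℕ) - 1 := by push_cast; ring
    rw [e2, e, poch_succ, gO_succ_eq_shift]
    have h2 : N * κ + (m + 1 : ℕ) + 1 + (j : ℝ) ≠ 0 := by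
      have : (0 : ℝ) ≤ j := by positivity
      push_cast
      have : (0 : ℝ) ≤ m := by positivity
      linarith
    rw [pow_succ]
    field_simp
    ring

theorem Tdiff_hPlus_odd (m : ℕ) : Tdiff hN κ (hPlus hN κ (2 * m + 1))
    = -(N * κ - κ + m) • hMinus hN κ (2 * m) := by
  have hx := Nκ_gt hN hκ
  rw [hPlus_odd, hMinus_even, Finset.smul_sum]
  simp only [smul_smul]
  refine map_sum_range_succ (Tdiff hN κ) (fun j => phi hN κ (2 * m + 1) (2 * j + 1))
    (fun j => psi hN κ (2 * m) (2 * j + 1)) _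
    (fun j => 2 * (N * κ + m + 2 + j)) (fun j => 2 * (N * κ - κ + m + 1) + 2 * j + 1)
    _ m ?_ ?_ ?_ ?_
  · have := Tdiff_phi_one hN κ (2 * m)
    rw [mul_zero, zero_add, this, ← neg_smul]
    congr 1
    push_cast; ring
  · intro j
    have := Tdiff_phi_add_two hN κ (2 * m) (2 * j + 1)
    rw [show 2 * (j + 1) + 1 = 2 * j + 1 + 2 by ring, this]
    congr 2
    · push_cast; ring
    · push_cast; ring
  · exact psi_eq_zero hN κ (by omega)
  · intro j
    have h1 := poch_ne_zero_of' hx m j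
    have e2 : gE j (N * κ - κ + (m : ℝ)) = gE j (N * κ - κ + m + 1 - 1) := by congr 1; ring
    rw [poch_succ, gE_succ_eq_shift, e2]
    have h2 : N * κ + (m : ℝ) + 2 + (j : ℝ) ≠ 0 := by
      have : (0 : ℝ) ≤ j := by positivity
      have : (0 : ℝ) ≤ m := by positivity
      linarith
    rw [pow_succ]
    field_simp
    ring

theorem Tdiff_hMinus_odd (m : ℕ) : Tdiff hN κ (hMinus hN κ (2 * m + 1))
    = (2 * (N * κ + m + 1)) • hPlus hN κ (2 * m) := by
  have hx := Nκ_gt hN hκ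
  have hm : (0 : ℝ) ≤ m := by positivity
  rw [hPlus_even, hMinus_odd, Finset.smul_sum, map_sum]
  refine Finset.sum_congr rfl fun j _ => ?_
  rw [map_smul, Tdiff_psi, smul_smul, smul_smul]
  congr 1
  have h1 := add_div_poch (by linarith : 0 < N * κ + (m : ℝ) + 1) j
  rw [show N * κ + (m : ℝ) + 1 + 1 = N * κ + m + 2 by ring] at h1
  push_cast
  linear_combination (2 * 2⁻¹ ^ j * gO j (N * κ - κ + m)) * h1

theorem Tdiff_hMinus_even (m : ℕ) : Tdiff hN κ (hMinus hN κ (2 * (m + 1)))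
    = (2 * (N * κ + m + 2)) • hPlus hN κ (2 * m + 1) := by
  have hx := Nκ_gt hN hκ
  have hm : (0 : ℝ) ≤ m := by positivity
  rw [hPlus_odd, hMinus_even, Finset.smul_sum, map_sum]
  refine Finset.sum_congr rfl fun j _ => ?_
  rw [map_smul, show 2 * (m + 1) = 2 * m + 1 + 1 by ring, Tdiff_psi, smul_smul, smul_smul]
  congr 1
  have h1 := add_div_poch (by linarith : 0 < N * κ + (m : ℝ) + 2) j
  have e2 : N * κ - κ + (m + 1 : ℕ) = N * κ - κ + m + 1 := by push_cast; ring
  have e3 : N * κ + (m + 1 : ℕ) + 2 = N * κ + m + 2 + 1 := by push_cast; ring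
  rw [e2, e3]
  push_cast
  linear_combination (2 * 2⁻¹ ^ j * gE j (N * κ - κ + m + 1)) * h1

theorem Tsum_hMinus_odd (m : ℕ) : Tsum hN κ (hMinus hN κ (2 * m + 1))
    = (N * κ - κ + m) • hMinus hN κ (2 * m) := by
  have hx := Nκ_gt hN hκ
  rw [hMinus_even, hMinus_odd, Finset.smul_sum]
  simp only [smul_smul]
  refine map_sum_range_succ (Tsum hN κ) (fun j => psi hN κ (2 * m + 1) (2 * j))
    (fun j => psi hN κ (2 * m) (2 * j + 1)) _
    (fun j => 2 * (N * κ + m + 2 + j)) (fun j => 2 * j + 1) _ m ?_ ?_ ?_ ?_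
  · have := Tsum_psi_zero hN κ (2 * m)
    simpa using this
  · intro j
    have := Tsum_psi_succ hN κ (2 * m) (2 * j + 1)
    rw [show 2 * (j + 1) = 2 * j + 1 + 1 by ring, this]
    congr 2
    · push_cast; ring
    · push_cast; ring
  · exact psi_eq_zero hN κ (by omega)
  · intro j
    have h1 := poch_ne_zero_of' hx m j
    rw [poch_succ, gO_succ_eq]
    have h2 : N * κ + (m : ℝ) + 2 + (j : ℝ) ≠ 0 := by
      have : (0 : ℝ) ≤ j := by positivity
      have : (0 : ℝ) ≤ m := by positivity
      linarith
    rw [pow_succ]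
    field_simp
    ring

theorem Tsum_hMinus_even (m : ℕ) : Tsum hN κ (hMinus hN κ (2 * (m + 1)))
    = (2 * (N * κ + m + 2)) • hMinus hN κ (2 * m + 1) := by
  have hx := Nκ_gt hN hκ
  have hm : (0 : ℝ) ≤ m := by positivity
  rw [hMinus_even, hMinus_odd, Finset.smul_sum]
  simp only [smul_smul]
  refine map_sum_range (Tsum hN κ) (fun j => psi hN κ (2 * (m + 1)) (2 * j + 1))
    (fun j => psi hN κ (2 * m + 1) (2 * j)) _
    (fun j => 2 * (N * κ + m + 2 + j)) (fun j => 2 * j) _ (m + 1) ?_ ?_ ?_ ?_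
  · intro j
    rw [show 2 * (m + 1) = 2 * m + 1 + 1 by ring, Tsum_psi_succ hN κ (2 * m + 1) (2 * j)]
    congr 2
    · push_cast; ring
    · push_cast; ring
  · exact psi_eq_zero hN κ (by omega)
  · simp [poch_zero, gO, gE]
  · intro j
    have h1 := add_div_poch (by linarith : 0 < N * κ + (m : ℝ) + 2) (j + 1)
    have e2 : N * κ - κ + (m + 1 : ℕ) = N * κ - κ + m + 1 := by push_cast; ring
    have e3 : N * κ + (m + 1 : ℕ) + 2 = N * κ + m + 2 + 1 := by push_cast; ring
    have h3 : poch (N * κ + m + 2 + 1) j ≠ 0 := by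
      rw [← e3]; exact poch_ne_zero_of' hx (m + 1) j
    have h2 : N * κ + (m : ℝ) + 2 + 1 + (j : ℝ) ≠ 0 := by
      have : (0 : ℝ) ≤ j := by positivity
      linarith
    rw [e2, e3, gO_succ_eq_gE, show 2 * (N * κ + (m : ℝ) + 2) * (2⁻¹ ^ (j + 1)
      * ((gE (j + 1) (N * κ - κ + m + 1) - 2 * (j + 1) * gE j (N * κ - κ + m + 1))
        / poch (N * κ + m + 2) (j + 1)))
      = 2 * 2⁻¹ ^ (j + 1)
      * ((gE (j + 1) (N * κ - κ + m + 1) - 2 * (j + 1) * gE j (N * κ - κ + m + 1))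
        * ((N * κ + (m : ℝ) + 2) / poch (N * κ + m + 2) (j + 1))) by ring, ← h1,
      poch_succ, pow_succ]
    push_cast
    field_simp
    ring

end HarmonicPolynomials

end PlanarDunkl

end

noncomputable section

namespace PlanarDunkl

section Harmonicity

variable {N : ℕ} (hN : 2 ≤ N) {κ : ℝ}

/-- A polynomial annihilated by `T_1² + ⋯ + T_N²`. -/
def IsHarmonic (κ : ℝ) (f : MvPolynomial (Fin N) ℝ) : Prop :=
  ∑ i, dunklT κ i (dunklT κ i f) = 0

/-- A polynomial annihilated by `T_3, …, T_N`. -/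
def IsPlanar (κ : ℝ) (f : MvPolynomial (Fin N) ℝ) : Prop :=
  ∀ k, k ≠ idx1 hN → k ≠ idx2 hN → dunklT κ k f = 0

theorem IsHarmonic.dunklT {f : MvPolynomial (Fin N) ℝ} (hf : IsHarmonic κ f) (i : Fin N) :
    IsHarmonic κ (dunklT κ i f) := by
  have h := congrArg (PlanarDunkl.dunklT κ i) hf
  rw [map_sum, map_zero] at h
  rw [IsHarmonic, ← h]
  refine Finset.sum_congr rfl fun j _ => ?_
  rw [dunklT_comm κ j i, dunklT_comm κ j i]

theorem isPlanar_phi (n j : ℕ) : IsPlanar hN κ (phi hN κ n j) := by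
  intro k h1 h2
  rw [phi_eq, map_sum]
  refine Finset.sum_eq_zero fun ab _ => ?_
  rw [map_smul, dunklT_mul_pPoly_of_ne κ h1 h2 (idx1_ne_idx2 hN), smul_zero]

theorem isPlanar_psi (n j : ℕ) : IsPlanar hN κ (psi hN κ n j) := by
  intro k h1 h2
  rw [psi_eq, map_sum]
  refine Finset.sum_eq_zero fun ab _ => ?_
  rw [map_smul, dunklT_mul_pPoly_of_ne κ h1 h2 (idx1_ne_idx2 hN), smul_zero]

theorem isPlanar_sum {ι : Type*} {s : Finset ι} {f : ι → MvPolynomial (Fin N) ℝ} {a : ι → ℝ}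
    (hf : ∀ i ∈ s, IsPlanar hN κ (f i)) : IsPlanar hN κ (∑ i ∈ s, a i • f i) := by
  intro k h1 h2
  rw [map_sum]
  refine Finset.sum_eq_zero fun i hi => ?_
  rw [map_smul, hf i hi k h1 h2, smul_zero]

theorem isPlanar_hPlus (n : ℕ) : IsPlanar hN κ (hPlus hN κ n) := by
  rcases Nat.even_or_odd' n with ⟨m, rfl | rfl⟩
  · rw [hPlus_even]; exact isPlanar_sum hN fun j _ => isPlanar_phi hN _ _
  · rw [hPlus_odd]; exact isPlanar_sum hN fun j _ => isPlanar_phi hN _ _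

theorem isPlanar_hMinus (n : ℕ) : IsPlanar hN κ (hMinus hN κ n) := by
  rcases Nat.even_or_odd' n with ⟨m, rfl | rfl⟩
  · rw [hMinus_even]; exact isPlanar_sum hN fun j _ => isPlanar_psi hN _ _
  · rw [hMinus_odd]; exact isPlanar_sum hN fun j _ => isPlanar_psi hN _ _

theorem sum_dunklT_sq_eq {f : MvPolynomial (Fin N) ℝ} (hf : IsPlanar hN κ f) :
    ∑ i, dunklT κ i (dunklT κ i f)
      = dunklT κ (idx1 hN) (dunklT κ (idx1 hN) f)
        + dunklT κ (idx2 hN) (dunklT κ (idx2 hN) f) := by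
  rw [← Finset.sum_pair (f := fun i => dunklT κ i (dunklT κ i f)) (idx1_ne_idx2 hN)]
  symm
  apply Finset.sum_subset (Finset.subset_univ _)
  intro k _ hk
  simp only [Finset.mem_insert, Finset.mem_singleton, not_or] at hk
  rw [hf k hk.1 hk.2, map_zero]

theorem isHarmonic_of_Tsum_Tdiff {f : MvPolynomial (Fin N) ℝ} (hf : IsPlanar hN κ f)
    (h : Tsum hN κ (Tsum hN κ f) + Tdiff hN κ (Tdiff hN κ f) = 0) : IsHarmonic κ f := by
  rw [IsHarmonic, sum_dunklT_sq_eq hN hf]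
  simp only [Tsum, Tdiff, LinearMap.add_apply, LinearMap.sub_apply, map_add, map_sub] at h
  apply smul_right_injective _ (two_ne_zero (α := ℝ))
  change (2 : ℝ) • _ = (2 : ℝ) • (0 : MvPolynomial (Fin N) ℝ)
  rw [smul_zero, ← h, two_smul]
  abel

theorem hPlus_zero : hPlus hN κ 0 = 1 := by
  have := hPlus_even hN κ 0
  rw [mul_zero] at this
  rw [this]
  simp [gO, poch_zero, phi_eq, pPoly_zero]

theorem hMinus_zero : hMinus hN κ 0 = 0 := by
  have := hMinus_even hN κ 0
  rw [mul_zero] at this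
  rw [this]
  simp

theorem Tsum_one : Tsum hN κ 1 = 0 := by
  simp [Tsum, dunklT_one]

theorem Tdiff_one : Tdiff hN κ 1 = 0 := by
  simp [Tdiff, dunklT_one]

variable (hκ : -1 / (N : ℝ) < κ)

include hκ

theorem isHarmonic_hPlus (n : ℕ) : IsHarmonic κ (hPlus hN κ n) := by
  apply isHarmonic_of_Tsum_Tdiff hN (isPlanar_hPlus hN n)
  rcases Nat.even_or_odd' n with ⟨m, rfl | rfl⟩
  · cases m with
    | zero => rw [mul_zero, hPlus_zero, Tsum_one, Tdiff_one]; simp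
    | succ m =>
      rw [Tsum_hPlus_even hN hκ, Tdiff_hPlus_even hN hκ, map_smul, map_smul,
        Tsum_hPlus_odd hN hκ, Tdiff_hMinus_odd hN hκ, neg_smul, add_neg_cancel]
  · rw [Tsum_hPlus_odd hN hκ, Tdiff_hPlus_odd hN hκ, map_smul, map_smul]
    cases m with
    | zero => rw [mul_zero, hPlus_zero, hMinus_zero, Tsum_one]; simp
    | succ m =>
      rw [Tsum_hPlus_even hN hκ, Tdiff_hMinus_even hN hκ, smul_smul, smul_smul, ← add_smul]
      convert zero_smul ℝ _
      push_cast
      ring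

theorem isHarmonic_hMinus (n : ℕ) : IsHarmonic κ (hMinus hN κ n) := by
  apply isHarmonic_of_Tsum_Tdiff hN (isPlanar_hMinus hN n)
  rcases Nat.even_or_odd' n with ⟨m, rfl | rfl⟩
  · cases m with
    | zero => rw [mul_zero, hMinus_zero]; simp
    | succ m =>
      rw [Tsum_hMinus_even hN hκ, Tdiff_hMinus_even hN hκ, map_smul, map_smul,
        Tsum_hMinus_odd hN hκ, Tdiff_hPlus_odd hN hκ, neg_smul, smul_neg, add_neg_cancel]
  · rw [Tsum_hMinus_odd hN hκ, Tdiff_hMinus_odd hN hκ, map_smul, map_smul]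
    cases m with
    | zero => rw [mul_zero, hPlus_zero, hMinus_zero, Tdiff_one]; simp
    | succ m =>
      rw [Tsum_hMinus_even hN hκ, Tdiff_hPlus_even hN hκ, smul_smul, smul_smul, ← add_smul]
      convert zero_smul ℝ _
      push_cast
      ring

theorem Tsum_pow_hPlus_even (m : ℕ) : (Tsum hN κ ^ (2 * m)) (hPlus hN κ (2 * m))
    = MvPolynomial.C (2 ^ m * poch (N * κ - κ + 1) m * poch (N * κ + 1) m) := by
  induction m with
  | zero => simp [hPlus_zero, poch_zero]
  | succ m ih =>
    rw [show 2 * (m + 1) = 2 * m + 1 + 1 by ring, pow_succ, pow_succ, Module.End.mul_apply,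
      Module.End.mul_apply, show 2 * m + 1 + 1 = 2 * (m + 1) by ring, Tsum_hPlus_even hN hκ,
      map_smul, Tsum_hPlus_odd hN hκ, map_smul, map_smul, ih, smul_smul,
      MvPolynomial.smul_eq_C_mul, ← MvPolynomial.C_mul, poch_succ, poch_succ]
    congr 1
    push_cast
    ring

theorem Tsum_pow_hPlus_odd (m : ℕ) : (Tsum hN κ ^ (2 * m + 1)) (hPlus hN κ (2 * m + 1))
    = MvPolynomial.C (2 ^ (m + 1) * poch (N * κ - κ + 1) m * poch (N * κ + 1) (m + 1)) := by
  rw [pow_succ, Module.End.mul_apply, Tsum_hPlus_odd hN hκ, map_smul, Tsum_pow_hPlus_even hN hκ,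
    MvPolynomial.smul_eq_C_mul, ← MvPolynomial.C_mul, poch_succ (N * κ + 1)]
  congr 1
  ring

theorem Tsum_pow_hMinus_odd (m : ℕ) :
    (Tsum hN κ ^ (2 * m)) (Tdiff hN κ (hMinus hN κ (2 * m + 1)))
    = MvPolynomial.C (2 ^ (m + 1) * poch (N * κ - κ + 1) m * poch (N * κ + 1) (m + 1)) := by
  rw [Tdiff_hMinus_odd hN hκ, map_smul, Tsum_pow_hPlus_even hN hκ,
    MvPolynomial.smul_eq_C_mul, ← MvPolynomial.C_mul, poch_succ (N * κ + 1)]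
  congr 1
  ring

theorem Tsum_pow_hMinus_even (m : ℕ) :
    (Tsum hN κ ^ (2 * m + 1)) (Tdiff hN κ (hMinus hN κ (2 * (m + 1))))
    = MvPolynomial.C (2 ^ (m + 2) * poch (N * κ - κ + 1) m * poch (N * κ + 1) (m + 2)) := by
  rw [Tdiff_hMinus_even hN hκ, map_smul, Tsum_pow_hPlus_odd hN hκ,
    MvPolynomial.smul_eq_C_mul, ← MvPolynomial.C_mul, poch_succ (N * κ + 1) (m + 1)]
  congr 1
  push_cast
  ring

end Harmonicity

section Reduction

open MvPolynomial

variable {N : ℕ} (hN : 2 ≤ N)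

/-- The ideal generated by `x_1² + x_2²` and `x_3, …, x_N`. -/
def planarIdeal : Ideal (MvPolynomial (Fin N) ℝ) :=
  Ideal.span (insert (X (idx1 hN) ^ 2 + X (idx2 hN) ^ 2)
    (X '' {k | k ≠ idx1 hN ∧ k ≠ idx2 hN}))

theorem sq_add_sq_mem_planarIdeal : X (idx1 hN) ^ 2 + X (idx2 hN) ^ 2 ∈ planarIdeal hN :=
  Ideal.subset_span (Set.mem_insert _ _)

theorem X_mem_planarIdeal {k : Fin N} (h1 : k ≠ idx1 hN) (h2 : k ≠ idx2 hN) :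
    X k ∈ planarIdeal hN :=
  Ideal.subset_span (Set.mem_insert_of_mem _ ⟨k, ⟨h1, h2⟩, rfl⟩)

theorem exists_sub_mem_planarIdeal {n : ℕ} {f : MvPolynomial (Fin N) ℝ}
    (hf : f.IsHomogeneous n) : ∃ a b : ℝ, (n = 0 → b = 0) ∧
      f - (C a * (X (idx1 hN) + X (idx2 hN)) ^ n + C b *
        ((X (idx1 hN) + X (idx2 hN)) ^ (n - 1) * (X (idx1 hN) - X (idx2 hN))))
        ∈ planarIdeal hN := by
  refine isHomogeneous_induction (p := fun n f => ∃ a b : ℝ, (n = 0 → b = 0) ∧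
      f - (C a * (X (idx1 hN) + X (idx2 hN)) ^ n + C b *
        ((X (idx1 hN) + X (idx2 hN)) ^ (n - 1) * (X (idx1 hN) - X (idx2 hN))))
        ∈ planarIdeal hN) ?_ ?_ ?_ ?_ hf
  · intro a
    exact ⟨a, 0, fun _ => rfl, by simp⟩
  · intro n
    exact ⟨0, 0, fun _ => rfl, by simp⟩
  · rintro n f g ⟨a, b, h0, h⟩ ⟨a', b', h0', h'⟩
    refine ⟨a + a', b + b', fun hn => by rw [h0 hn, h0' hn, add_zero], ?_⟩
    convert (planarIdeal hN).add_mem h h' using 1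
    simp only [C_add]
    ring
  · rintro n i f - ⟨a, b, h0, h⟩
    have hq := sq_add_sq_mem_planarIdeal hN
    have hhalf : (C (2⁻¹ : ℝ) * 2 : MvPolynomial (Fin N) ℝ) = 1 := by
      have : (2 : MvPolynomial (Fin N) ℝ) = C 2 := rfl
      rw [this, ← C_mul, inv_mul_cancel₀ two_ne_zero, C_1]
    rcases eq_or_ne i (idx1 hN) with rfl | hi1
    · refine ⟨2⁻¹ * (a - b), 2⁻¹ * (a + b), by simp, ?_⟩
      convert (planarIdeal hN).add_mem ((planarIdeal hN).mul_mem_left (X (idx1 hN)) h)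
        ((planarIdeal hN).mul_mem_left (C b * (X (idx1 hN) + X (idx2 hN)) ^ (n - 1)) hq) using 1
      simp only [C_add, C_mul, C_sub]
      cases n with
      | zero =>
        rw [h0 rfl]
        simp only [map_zero, Nat.zero_sub, zero_add, Nat.sub_self]
        linear_combination (-C a * X (idx1 hN)) * hhalf
      | succ n =>
        simp only [Nat.add_sub_cancel]
        linear_combination ((X (idx1 hN) + X (idx2 hN)) ^ n * (-C a * X (idx1 hN) *
          (X (idx1 hN) + X (idx2 hN)) + C b * X (idx2 hN) * (X (idx1 hN) + X (idx2 hN)))) * hhalf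
    rcases eq_or_ne i (idx2 hN) with rfl | hi2
    · refine ⟨2⁻¹ * (a + b), 2⁻¹ * (b - a), by simp, ?_⟩
      convert (planarIdeal hN).sub_mem ((planarIdeal hN).mul_mem_left (X (idx2 hN)) h)
        ((planarIdeal hN).mul_mem_left (C b * (X (idx1 hN) + X (idx2 hN)) ^ (n - 1)) hq) using 1
      simp only [C_add, C_mul, C_sub]
      cases n with
      | zero =>
        rw [h0 rfl]
        simp only [map_zero, Nat.zero_sub, zero_add, Nat.sub_self]
        linear_combination (-C a * X (idx2 hN)) * hhalf
      | succ n =>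
        simp only [Nat.add_sub_cancel]
        linear_combination ((X (idx1 hN) + X (idx2 hN)) ^ n * (-C a * X (idx2 hN) *
          (X (idx1 hN) + X (idx2 hN)) - C b * X (idx1 hN) * (X (idx1 hN) + X (idx2 hN)))) * hhalf
    · refine ⟨0, 0, by simp, ?_⟩
      simp only [C_0, zero_mul, add_zero, sub_zero]
      rw [mul_comm]
      exact (planarIdeal hN).mul_mem_left _ (X_mem_planarIdeal hN hi1 hi2)

theorem evalPoint_eq_zero {f : MvPolynomial (Fin N) ℝ} (hf : f ∈ planarIdeal hN) :
    evalPoint hN f = 0 := by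
  have h12 := idx1_ne_idx2 hN
  let ev : MvPolynomial (Fin N) ℝ →ₐ[ℝ] ℂ := aeval (fun k : Fin N =>
    if k = idx1 hN then 1 + Complex.I else if k = idx2 hN then 1 - Complex.I else 0)
  have : planarIdeal hN ≤ RingHom.ker ev := by
    rw [planarIdeal, Ideal.span_le]
    rintro x (rfl | ⟨k, ⟨h1, h2⟩, rfl⟩)
    · simp only [SetLike.mem_coe, RingHom.mem_ker, map_add, map_pow, ev, aeval_X, if_true,
        if_neg h12.symm]
      linear_combination (2 : ℂ) * Complex.I_sq
    · simp [ev, h1, h2]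
  exact this hf

theorem polyOfT_apply_eq_zero {κ : ℝ} {h : MvPolynomial (Fin N) ℝ} (hp : IsPlanar hN κ h)
    (hh : IsHarmonic κ h) {f : MvPolynomial (Fin N) ℝ} (hf : f ∈ planarIdeal hN) :
    polyOfT κ f h = 0 := by
  have h2 : polyOfT κ (X (idx1 hN) ^ 2 + X (idx2 hN) ^ 2) h = 0 := by
    rw [IsHarmonic, sum_dunklT_sq_eq hN hp] at hh
    rw [map_add, LinearMap.add_apply, pow_two, pow_two, polyOfT_mul, polyOfT_mul,
      Module.End.mul_apply, Module.End.mul_apply, polyOfT_X, polyOfT_X, hh]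
  refine Submodule.span_induction (p := fun f _ => polyOfT κ f h = 0) ?_ ?_ ?_ ?_ hf
  · rintro x (rfl | ⟨k, ⟨h1, h2⟩, rfl⟩)
    · exact h2
    · rw [polyOfT_X, hp k h1 h2]
  · simp
  · intro x y _ _ hx hy
    rw [map_add, LinearMap.add_apply, hx, hy, add_zero]
  · intro a x _ hx
    rw [smul_eq_mul, polyOfT_mul, Module.End.mul_apply, hx, map_zero]

/-- The pairing of a homogeneous polynomial with a planar harmonic polynomial only depends on the
value of the former at `ζ`. -/
theorem exists_pairing_eq {κ : ℝ} {n : ℕ} {f h : MvPolynomial (Fin N) ℝ}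
    (hf : f.IsHomogeneous n) (hp : IsPlanar hN κ h) (hh : IsHarmonic κ h) : ∃ a b : ℝ,
      evalPoint hN f = 2 ^ n * (a + b * Complex.I) ∧
      pairing κ f h = a * eval 0 ((Tsum hN κ ^ n) h)
        + b * eval 0 ((Tsum hN κ ^ (n - 1)) (Tdiff hN κ h)) := by
  have h12 := idx1_ne_idx2 hN
  obtain ⟨a, b, hb, hmem⟩ := exists_sub_mem_planarIdeal hN hf
  refine ⟨a, b, ?_, ?_⟩
  · have h0 := evalPoint_eq_zero hN hmem
    simp only [evalPoint, map_sub, map_add, map_mul, map_pow, aeval_X, if_true, if_neg h12.symm,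
      aeval_C] at h0
    rw [sub_eq_zero] at h0
    rw [evalPoint, h0]
    have e1 : (1 + Complex.I + (1 - Complex.I)) = 2 := by ring
    have e2 : (1 + Complex.I - (1 - Complex.I)) = 2 * Complex.I := by ring
    rw [e1, e2]
    simp only [Complex.coe_algebraMap]
    cases n with
    | zero => rw [hb rfl]; simp
    | succ n => rw [Nat.add_sub_cancel]; ring
  · have h0 := polyOfT_apply_eq_zero hN hp hh hmem
    have hs : polyOfT κ (X (idx1 hN) + X (idx2 hN)) = Tsum hN κ := by
      rw [map_add, polyOfT_X, polyOfT_X, Tsum]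
    have hd : polyOfT κ (X (idx1 hN) - X (idx2 hN)) = Tdiff hN κ := by
      rw [map_sub, polyOfT_X, polyOfT_X, Tdiff]
    rw [map_sub, LinearMap.sub_apply, sub_eq_zero, map_add, LinearMap.add_apply, polyOfT_mul,
      polyOfT_mul, polyOfT_mul, Module.End.mul_apply, Module.End.mul_apply, Module.End.mul_apply,
      polyOfT_pow, polyOfT_pow, hs, hd, polyOfT_C, polyOfT_C] at h0
    rw [pairing, h0, map_add, smul_eval, smul_eval]

end Reduction

end PlanarDunkl

end

noncomputable section

namespace PlanarDunkl

section PolynomialFunctions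

/-- A complex-valued function of a real variable that is given by a polynomial. -/
def IsPolyFun (f : ℝ → ℂ) : Prop :=
  ∃ p : Polynomial ℂ, ∀ x : ℝ, f x = p.eval (x : ℂ)

namespace IsPolyFun

theorem const (c : ℂ) : IsPolyFun fun _ => c := ⟨Polynomial.C c, by simp⟩

theorem id : IsPolyFun fun x => (x : ℂ) := ⟨Polynomial.X, by simp⟩

theorem add {f g : ℝ → ℂ} (hf : IsPolyFun f) (hg : IsPolyFun g) :
    IsPolyFun fun x => f x + g x := by
  obtain ⟨p, hp⟩ := hf
  obtain ⟨q, hq⟩ := hg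
  exact ⟨p + q, fun x => by simp only [hp, hq, Polynomial.eval_add]⟩

theorem mul {f g : ℝ → ℂ} (hf : IsPolyFun f) (hg : IsPolyFun g) :
    IsPolyFun fun x => f x * g x := by
  obtain ⟨p, hp⟩ := hf
  obtain ⟨q, hq⟩ := hg
  exact ⟨p * q, fun x => by simp only [hp, hq, Polynomial.eval_mul]⟩

theorem sum {ι : Type*} {s : Finset ι} {f : ι → ℝ → ℂ} (hf : ∀ i ∈ s, IsPolyFun (f i)) :
    IsPolyFun fun x => ∑ i ∈ s, f i x := by
  classical
  induction s using Finset.induction_on with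
  | empty => simpa using const 0
  | insert a s ha ih =>
    simp only [Finset.sum_insert ha]
    exact (hf a (Finset.mem_insert_self _ _)).add
      (ih fun i hi => hf i (Finset.mem_insert_of_mem hi))

theorem poch {a b : ℝ} (n : ℕ) : IsPolyFun fun x => ((poch (a * x + b) n : ℝ) : ℂ) := by
  induction n with
  | zero => simpa [poch_zero] using const 1
  | succ n ih =>
    simp only [poch_succ, Complex.ofReal_mul]
    refine ih.mul ?_
    simp only [Complex.ofReal_add, Complex.ofReal_mul, Complex.ofReal_natCast]
    exact (((const a).mul id).add (const b)).add (const n)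

/-- Two polynomial functions that agree at all negative integers agree everywhere. -/
theorem eq_of_neg_nat {f g : ℝ → ℂ} (hf : IsPolyFun f) (hg : IsPolyFun g)
    (h : ∀ k : ℕ, f (-k - 1) = g (-k - 1)) (x : ℝ) : f x = g x := by
  obtain ⟨p, hp⟩ := hf
  obtain ⟨q, hq⟩ := hg
  have : p = q := by
    apply Polynomial.eq_of_infinite_eval_eq
    refine Set.Infinite.mono (s := Set.range fun k : ℕ => (-(k : ℂ) - 1)) ?_ ?_
    · rintro _ ⟨k, rfl⟩
      have := h k
      rw [hp, hq] at this
      simpa using this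
    · apply Set.infinite_range_of_injective
      intro a b hab
      simpa using hab
  rw [hp, hq, this]

end IsPolyFun

theorem isPolyFun_sConst (n j : ℕ) (β : ℝ) : IsPolyFun fun κ => ((sConst n j κ β : ℝ) : ℂ) := by
  simp only [sConst, Complex.ofReal_sum]
  refine IsPolyFun.sum fun l _ => IsPolyFun.sum fun i _ => ?_
  simp only [div_eq_mul_inv, Complex.ofReal_mul]
  refine (((IsPolyFun.mul ?_ ?_).mul (IsPolyFun.const _)).mul (IsPolyFun.const _)).mul
    (IsPolyFun.const _)
  · simpa using IsPolyFun.poch (a := 1) (b := 1) l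
  · have := IsPolyFun.poch (a := 2) (b := β + 2 * l) (n + i - (2 * l + j))
    simpa only [← add_assoc] using this

end PolynomialFunctions

section BinomialSeries

open PowerSeries

/-- The series `(1 - z X)^{-κ}` over the complex numbers. -/
def binSeries (κ : ℝ) (z : ℂ) : ℂ⟦X⟧ :=
  PowerSeries.mk fun n => ((poch κ n / (n.factorial : ℝ) : ℝ) : ℂ) * z ^ n

theorem one_sub_mul_binSeries (κ : ℝ) (z : ℂ) :
    (1 - C z * X) * binSeries κ z = binSeries (κ - 1) z := by
  ext1 n
  rw [sub_mul, one_mul, mul_assoc, map_sub, coeff_C_mul]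
  cases n with
  | zero => simp [binSeries, poch_zero]
  | succ n =>
    rw [coeff_succ_X_mul]
    simp only [binSeries, coeff_mk]
    have h1 := poch_succ κ n
    have h2 := poch_succ_left (κ - 1) n
    rw [sub_add_cancel] at h2
    have h : poch (κ - 1) (n + 1) / ((n + 1).factorial : ℝ)
        = poch κ (n + 1) / ((n + 1).factorial : ℝ) - poch κ n / (n.factorial : ℝ) := by
      rw [h1, h2, Nat.factorial_succ]
      have : (n.factorial : ℝ) ≠ 0 := by positivity
      push_cast
      field_simp
      ring
    rw [h]
    push_cast
    ring

theorem binSeries_zero (z : ℂ) : binSeries 0 z = 1 := by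
  ext1 n
  cases n with
  | zero => simp [binSeries, poch_zero]
  | succ n => simp [binSeries, poch_succ_left, coeff_one]

theorem binSeries_zero_right (κ : ℝ) : binSeries κ 0 = 1 := by
  ext1 n
  cases n with
  | zero => simp [binSeries, poch_zero]
  | succ n => simp [binSeries, coeff_one]

theorem binSeries_neg (k : ℕ) (z : ℂ) : binSeries (-k) z = (1 - C z * X) ^ k := by
  induction k with
  | zero => simp [binSeries_zero]
  | succ k ih =>
    rw [pow_succ', ← ih, one_sub_mul_binSeries]
    congr 1
    push_cast; ring

theorem binSeries_one_mul (k : ℕ) (z : ℂ) :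
    binSeries 1 z * binSeries (-k - 1) z = (1 - C z * X) ^ k := by
  have h1 := one_sub_mul_binSeries 1 z
  rw [sub_self, binSeries_zero] at h1
  have h2 : binSeries (-k - 1) z = (1 - C z * X) ^ (k + 1) := by
    rw [← binSeries_neg]; congr 1; push_cast; ring
  rw [h2, pow_succ]
  linear_combination (1 - C z * X) ^ k * h1

theorem isPolyFun_coeff_mul {F G : ℝ → ℂ⟦X⟧} (hF : ∀ n, IsPolyFun fun κ => coeff n (F κ))
    (hG : ∀ n, IsPolyFun fun κ => coeff n (G κ)) (n : ℕ) :
    IsPolyFun fun κ => coeff n (F κ * G κ) := by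
  simp only [coeff_mul]
  exact IsPolyFun.sum fun ab _ => (hF _).mul (hG _)

theorem isPolyFun_coeff_binSeries (z : ℂ) (n : ℕ) :
    IsPolyFun fun κ => coeff n (binSeries κ z) := by
  simp only [binSeries, coeff_mk, div_eq_mul_inv, Complex.ofReal_mul]
  refine (IsPolyFun.mul ?_ (IsPolyFun.const _)).mul (IsPolyFun.const _)
  simpa using IsPolyFun.poch (a := 1) (b := 0) n

/-- The values at `ζ` of the polynomials `p_n(x_i; x)`, as a generating function; `z` is the
`i`-th coordinate of `ζ`. -/
def pSeries (κ : ℝ) (z : ℂ) : ℂ⟦X⟧ :=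
  binSeries 1 z * (binSeries κ (1 + Complex.I) * binSeries κ (1 - Complex.I))

theorem isPolyFun_coeff_pSeries (z : ℂ) (n : ℕ) :
    IsPolyFun fun κ => coeff n (pSeries κ z) :=
  isPolyFun_coeff_mul (fun _ => IsPolyFun.const _)
    (isPolyFun_coeff_mul (isPolyFun_coeff_binSeries _) (isPolyFun_coeff_binSeries _)) n

theorem map_powSeries {N : ℕ} (κ : ℝ) (ev : MvPolynomial (Fin N) ℝ →ₐ[ℝ] ℂ)
    (a : MvPolynomial (Fin N) ℝ) :
    PowerSeries.map ev.toRingHom (powSeries κ a) = binSeries κ (ev a) := by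
  ext1 n
  rw [coeff_map, powSeries, binSeries, coeff_mk, coeff_mk]
  change ev _ = _
  rw [map_mul, map_pow, ← MvPolynomial.algebraMap_eq, AlgHom.commutes]
  rfl

theorem evalPoint_pPoly {N : ℕ} (hN : 2 ≤ N) (κ : ℝ) (n : ℕ) :
    evalPoint hN (pPoly κ n (idx1 hN)) = coeff n (pSeries κ (1 + Complex.I)) ∧
      evalPoint hN (pPoly κ n (idx2 hN)) = coeff n (pSeries κ (1 - Complex.I)) := by
  have h12 := idx1_ne_idx2 hN
  let ev : MvPolynomial (Fin N) ℝ →ₐ[ℝ] ℂ := MvPolynomial.aeval (fun k : Fin N =>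
    if k = idx1 hN then 1 + Complex.I else if k = idx2 hN then 1 - Complex.I else 0)
  have hev : ∀ f, evalPoint hN f = ev.toRingHom f := fun f => rfl
  have e1 : ev (MvPolynomial.X (idx1 hN)) = 1 + Complex.I := by simp [ev]
  have e2 : ev (MvPolynomial.X (idx2 hN)) = 1 - Complex.I := by simp [ev, h12.symm]
  have hprod : ∏ j : Fin N, binSeries κ (ev (MvPolynomial.X j))
      = binSeries κ (1 + Complex.I) * binSeries κ (1 - Complex.I) := by
    rw [← e1, ← e2]
    refine Finset.prod_eq_mul (f := fun j => binSeries κ (ev (MvPolynomial.X j)))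
      (idx1 hN) (idx2 hN) h12 ?_ (by simp) (by simp)
    rintro j - ⟨h1, h2⟩
    have : ev (MvPolynomial.X j) = 0 := by simp [ev, h1, h2]
    rw [this, binSeries_zero_right]
  constructor
  · rw [hev, pPoly, ← coeff_map, map_mul, map_prod]
    simp only [map_powSeries]
    rw [hprod, e1, pSeries]
  · rw [hev, pPoly, ← coeff_map, map_mul, map_prod]
    simp only [map_powSeries]
    rw [hprod, e2, pSeries]

end BinomialSeries

section TrinomialExpansion

open PowerSeries

theorem poch_neg_nat (M d : ℕ) : poch (-(M : ℝ)) d = (-1) ^ d * (d.factorial * M.choose d) := by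
  induction d with
  | zero => simp [poch_zero]
  | succ d ih =>
    rw [poch_succ, ih]
    rcases le_or_gt d M with h | h
    · have h1 := Nat.choose_succ_right_eq M d
      have h2 : (M.choose (d + 1) : ℝ) * (d + 1) = M.choose d * (M - d) := by
        rw [← Nat.cast_sub h]
        exact_mod_cast h1
      rw [Nat.factorial_succ, pow_succ]
      push_cast
      linear_combination ((-1) ^ d * (d.factorial : ℝ)) * h2
    · rw [Nat.choose_eq_zero_of_lt h, Nat.choose_eq_zero_of_lt (by omega : M < d + 1)]
      simp

theorem coeff_C_add_C_mul_X_pow (x y : ℂ) (d m : ℕ) :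
    coeff m ((C x + C y * X) ^ d) = d.choose m * x ^ (d - m) * y ^ m := by
  rw [add_comm, add_pow, map_sum]
  have : ∀ k ∈ Finset.range (d + 1),
      coeff m ((C y * X) ^ k * (C x) ^ (d - k) * ((d.choose k : ℕ) : ℂ⟦X⟧))
        = if m = k then d.choose k * x ^ (d - k) * y ^ k else 0 := by
    intro k _
    have : (C y * X) ^ k * (C x) ^ (d - k) * ((d.choose k : ℕ) : ℂ⟦X⟧)
        = C (d.choose k * x ^ (d - k) * y ^ k) * X ^ k := by
      simp only [map_mul, map_pow, map_natCast, mul_pow]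
      ring
    rw [this, coeff_C_mul, coeff_X_pow]
    split_ifs <;> simp
  rw [Finset.sum_congr rfl this, Finset.sum_ite_eq]
  split_ifs with h
  · rfl
  · rw [Nat.choose_eq_zero_of_lt (by simpa using h)]
    simp

/-- The coefficients of a power of a quadratic polynomial. -/
theorem coeff_quadratic_pow (x y : ℂ) (M n : ℕ) :
    coeff n ((1 - X * (C x + C y * X)) ^ M) = ∑ b ∈ Finset.range (n / 2 + 1),
      ((poch (-(M : ℝ)) (n - b) / ((n - 2 * b).factorial * b.factorial) : ℝ) : ℂ)
        * x ^ (n - 2 * b) * y ^ b := by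
  have h1 : (1 - X * (C x + C y * X)) ^ M = ∑ d ∈ Finset.range (M + n + 1),
      C ((-1) ^ d * (M.choose d : ℂ)) * (X ^ d * (C x + C y * X) ^ d) := by
    rw [sub_eq_neg_add, add_pow]
    rw [Finset.sum_subset (Finset.range_subset_range.2 (by omega : M + 1 ≤ M + n + 1))]
    · refine Finset.sum_congr rfl fun d _ => ?_
      rw [neg_pow, mul_pow]
      simp only [one_pow, map_mul, map_pow, map_neg, map_one, map_natCast]
      ring
    · intro d _ hd
      rw [Nat.choose_eq_zero_of_lt (by simpa using hd)]
      simp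
  rw [h1, map_sum]
  have h2 : ∀ d ∈ Finset.range (M + n + 1),
      coeff n (C ((-1) ^ d * (M.choose d : ℂ)) * (X ^ d * (C x + C y * X) ^ d))
        = if d ≤ n then (-1) ^ d * (M.choose d : ℂ) *
          (d.choose (n - d) * x ^ (d - (n - d)) * y ^ (n - d)) else 0 := by
    intro d _
    rw [coeff_C_mul, coeff_X_pow_mul']
    split_ifs
    · rw [coeff_C_add_C_mul_X_pow]
    · rw [mul_zero]
  rw [Finset.sum_congr rfl h2]
  rw [← Finset.sum_subset (Finset.range_subset_range.2 (by omega : n + 1 ≤ M + n + 1))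
    (fun d _ hd => if_neg (by simpa using hd)), ← Finset.sum_range_reflect]
  rw [← Finset.sum_subset (Finset.range_subset_range.2 (by omega : n / 2 + 1 ≤ n + 1))]
  · refine Finset.sum_congr rfl fun b hb => ?_
    have hb : b ≤ n / 2 := by simpa [Nat.lt_succ_iff] using hb
    have e1 : n + 1 - 1 - b = n - b := by omega
    have e2 : n - (n - b) = b := by omega
    have e3 : n - b - b = n - 2 * b := by omega
    rw [e1, if_pos (by omega), e2, e3, poch_neg_nat]
    have h3 := Nat.choose_mul_factorial_mul_factorial (by omega : b ≤ n - b)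
    rw [e3] at h3
    have h4 : (((n - b).choose b : ℕ) : ℂ)
        = (((n - b).factorial / ((n - 2 * b).factorial * b.factorial) : ℝ) : ℂ) := by
      rw [← h3]
      have h5 : (b.factorial : ℝ) ≠ 0 := by positivity
      have h6 : ((n - 2 * b).factorial : ℝ) ≠ 0 := by positivity
      rw [← Complex.ofReal_natCast]
      congr 1
      push_cast
      field_simp
    rw [h4]
    push_cast
    ring
  · intro b hb hb'
    simp only [Finset.mem_range, not_lt] at hb hb'
    have e1 : n + 1 - 1 - b = n - b := by omega
    have e2 : n - (n - b) = b := by omega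
    rw [e1, e2, Nat.choose_eq_zero_of_lt (by omega : n - b < b)]
    simp

/-- The coefficients of `q^e (q² - w)^k`, where `w` is a multiple of `X²`. -/
theorem coeff_pow_mul_sub_pow (q : ℂ⟦X⟧) (w : ℂ) (e k n : ℕ) :
    coeff n (q ^ e * (q ^ 2 - C w * X ^ 2) ^ k) = ∑ l ∈ Finset.range (n / 2 + 1),
      ((poch (-(k : ℝ)) l / l.factorial : ℝ) : ℂ) * w ^ l
        * coeff (n - 2 * l) (q ^ (2 * (k - l) + e)) := by
  have h1 : q ^ e * (q ^ 2 - C w * X ^ 2) ^ k = ∑ l ∈ Finset.range (k + n + 1),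
      C (((poch (-(k : ℝ)) l / l.factorial : ℝ) : ℂ) * w ^ l)
        * (X ^ (2 * l) * q ^ (2 * (k - l) + e)) := by
    rw [sub_eq_neg_add, add_pow, Finset.mul_sum]
    rw [Finset.sum_subset (Finset.range_subset_range.2 (by omega : k + 1 ≤ k + n + 1))]
    · refine Finset.sum_congr rfl fun l _ => ?_
      have h : ((poch (-(k : ℝ)) l / l.factorial : ℝ) : ℂ) = (-1) ^ l * (k.choose l : ℕ) := by
        rw [poch_neg_nat]
        have h5 : (l.factorial : ℂ) ≠ 0 := by exact_mod_cast l.factorial_ne_zero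
        push_cast
        field_simp
      rw [h, neg_pow, mul_pow, ← pow_mul, ← pow_mul, pow_add]
      simp only [map_mul, map_pow, map_neg, map_one, map_natCast]
      ring
    · intro d _ hd
      rw [Nat.choose_eq_zero_of_lt (by simpa using hd)]
      simp
  rw [h1, map_sum]
  simp only [coeff_C_mul, coeff_X_pow_mul']
  rw [← Finset.sum_subset (Finset.range_subset_range.2 (by omega : n / 2 + 1 ≤ k + n + 1))]
  · refine Finset.sum_congr rfl fun l hl => ?_
    have hl : l ≤ n / 2 := by simpa [Nat.lt_succ_iff] using hl
    rw [if_pos (by omega)]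
  · intro l _ hl
    simp only [Finset.mem_range, not_lt] at hl
    rw [if_neg (by omega), mul_zero]

/-- The coefficient of `c ^ (n - 2 (i + b))` that stems from the indices `l`, `i`, `b`. -/
def sCoeff (n : ℕ) (α β : ℝ) (l i b : ℕ) : ℝ :=
  poch (α + 1) l / l.factorial * 4 ^ l * (l.choose i * (-1) ^ (l - i)) *
    (poch (2 * α + β + 2 * l) (n - 2 * l - b)
      / ((n - 2 * l - 2 * b).factorial * b.factorial)) * 2 ^ (n - 2 * l - 2 * b) * (-2) ^ b

theorem sConst_eq (n j : ℕ) (α β : ℝ) :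
    sConst n j α β = ∑ l ∈ Finset.range (n / 2 + 1), ∑ i ∈ Finset.range (l + 1),
      ∑ b ∈ Finset.range ((n - 2 * l) / 2 + 1), if i + b = j then sCoeff n α β l i b else 0 := by
  rw [sConst]
  refine Finset.sum_congr rfl fun l hl => ?_
  have hl : l ≤ n / 2 := by simpa [Nat.lt_succ_iff] using hl
  have h1 : ∀ i ∈ Finset.range (l + 1), (∑ b ∈ Finset.range ((n - 2 * l) / 2 + 1),
      if i + b = j then sCoeff n α β l i b else 0)
      = if i ≤ j ∧ l + j ≤ i + n / 2 then sCoeff n α β l i (j - i) else 0 := by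
    intro i _
    split_ifs with h
    · rw [Finset.sum_eq_single (j - i)]
      · rw [if_pos (by omega)]
      · intro b _ hb
        rw [if_neg (by omega)]
      · intro hb
        simp only [Finset.mem_range, not_lt] at hb
        omega
    · refine Finset.sum_eq_zero fun b hb => if_neg ?_
      simp only [Finset.mem_range] at hb
      omega
  rw [Finset.sum_congr rfl h1, ← Finset.sum_filter]
  have h2 : (Finset.range (l + 1)).filter (fun i => i ≤ j ∧ l + j ≤ i + n / 2)
      = Finset.Icc (l + j - n / 2) (min l j) := by
    ext i
    simp only [Finset.mem_filter, Finset.mem_range, Finset.mem_Icc]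
    omega
  rw [h2]
  refine Finset.sum_congr rfl fun i hi => ?_
  simp only [Finset.mem_Icc] at hi
  obtain ⟨b, rfl⟩ : ∃ b, j = i + b := ⟨j - i, by omega⟩
  obtain ⟨r, rfl⟩ : ∃ r, l = i + r := ⟨l - i, by omega⟩
  obtain ⟨a, rfl⟩ : ∃ a, n = a + 2 * b + 2 * (i + r) := ⟨n - 2 * b - 2 * (i + r), by omega⟩
  have e1 : a + 2 * b + 2 * (i + r) + i - (2 * (i + r) + (i + b)) = a + b := by omega
  have e2 : i + r - i = r := by omega
  have e3 : i + b - i = b := by omega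
  have e4 : a + 2 * b + 2 * (i + r) + 2 * i - (2 * (i + r) + 2 * (i + b)) = a := by omega
  have e5 : a + 2 * b + 2 * (i + r) + i - (i + b) = a + b + 2 * (i + r) := by omega
  have e6 : a + 2 * b + 2 * (i + r) - 2 * (i + r) - b = a + b := by omega
  have e7 : a + 2 * b + 2 * (i + r) - 2 * (i + r) - 2 * b = a := by omega
  rw [sCoeff, e1, e2, e3, e4, e5, e6, e7]
  have hc : ((i + r).choose i : ℝ) = (i + r).factorial / (i.factorial * r.factorial) := by
    have h := Nat.choose_mul_factorial_mul_factorial (by omega : i ≤ i + r)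
    rw [e2] at h
    rw [← h]
    have h5 : (i.factorial : ℝ) ≠ 0 := by positivity
    have h6 : (r.factorial : ℝ) ≠ 0 := by positivity
    push_cast
    field_simp
  rw [hc]
  have h5 : (i.factorial : ℝ) ≠ 0 := by positivity
  have h6 : (r.factorial : ℝ) ≠ 0 := by positivity
  have h7 : ((i + r).factorial : ℝ) ≠ 0 := by positivity
  have h8 : (b.factorial : ℝ) ≠ 0 := by positivity
  have h9 : (a.factorial : ℝ) ≠ 0 := by positivity
  have hs : (-1 : ℝ) ^ (i + r + (i + b)) = (-1) ^ r * (-1) ^ b := by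
    rw [show i + r + (i + b) = 2 * i + (r + b) by ring, pow_add, pow_mul]
    simp [pow_add]
  have h4 : (4 : ℝ) ^ (i + r) = 2 ^ (2 * (i + r)) := by rw [pow_mul]; norm_num
  have h2b : (-2 : ℝ) ^ b = (-1) ^ b * 2 ^ b := by rw [← mul_pow]; norm_num
  rw [hs, h4, h2b, pow_add, pow_add (2 : ℝ) a b]
  field_simp

/-- The polynomial in `c` whose coefficients are the constants `S(n, j; α, β)`. -/
def sPoly (n : ℕ) (α β : ℝ) : Polynomial ℂ :=
  ∑ l ∈ Finset.range (n / 2 + 1), ∑ i ∈ Finset.range (l + 1),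
    ∑ b ∈ Finset.range ((n - 2 * l) / 2 + 1),
      Polynomial.C ((sCoeff n α β l i b : ℝ) : ℂ) * Polynomial.X ^ (n - 2 * (i + b))

theorem coeff_sPoly {n j : ℕ} (hj : j ≤ n / 2) (α β : ℝ) :
    (sPoly n α β).coeff (n - 2 * j) = ((sConst n j α β : ℝ) : ℂ) := by
  rw [sPoly, sConst_eq, Polynomial.finsetSum_coeff]
  push_cast
  refine Finset.sum_congr rfl fun l hl => ?_
  rw [Polynomial.finsetSum_coeff]
  refine Finset.sum_congr rfl fun i hi => ?_
  rw [Polynomial.finsetSum_coeff]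
  refine Finset.sum_congr rfl fun b hb => ?_
  simp only [Finset.mem_range] at hl hi hb
  rw [Polynomial.coeff_C_mul, Polynomial.coeff_X_pow]
  have : n - 2 * j = n - 2 * (i + b) ↔ i + b = j := by omega
  simp only [this]
  split_ifs <;> simp

theorem eval_sPoly (n k e : ℕ) (c : ℂ) :
    (sPoly n (-k - 1) (2 - e)).eval c
      = coeff n ((1 - X * (C (2 * c) + C (-2) * X)) ^ e *
        ((1 - X * (C (2 * c) + C (-2) * X)) ^ 2 - C (4 * (1 - c ^ 2)) * X ^ 2) ^ k) := by
  rw [coeff_pow_mul_sub_pow, sPoly, Polynomial.eval_finsetSum]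
  refine Finset.sum_congr rfl fun l hl => ?_
  have hl : l ≤ n / 2 := by simpa [Nat.lt_succ_iff] using hl
  rcases lt_or_ge k l with hkl | hkl
  · have h0 : poch (-(k : ℝ)) l = 0 := by
      rw [poch_neg_nat, Nat.choose_eq_zero_of_lt hkl]; simp
    rw [h0, Polynomial.eval_finsetSum]
    simp only [zero_div, Complex.ofReal_zero, zero_mul]
    refine Finset.sum_eq_zero fun i _ => ?_
    rw [Polynomial.eval_finsetSum]
    refine Finset.sum_eq_zero fun b _ => ?_
    rw [sCoeff, sub_add_cancel, h0]
    simp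
  · have hM : 2 * (-(k : ℝ) - 1) + (2 - e) + 2 * l = -((2 * (k - l) + e : ℕ) : ℝ) := by
      push_cast [hkl]; ring
    rw [coeff_quadratic_pow, mul_pow, sub_eq_add_neg (1 : ℂ), add_pow, ← mul_assoc, mul_assoc,
      Finset.sum_mul_sum, Finset.mul_sum, Polynomial.eval_finsetSum]
    refine Finset.sum_congr rfl fun i hi => ?_
    have hi : i ≤ l := by simpa [Nat.lt_succ_iff] using hi
    rw [Polynomial.eval_finsetSum, Finset.mul_sum]
    refine Finset.sum_congr rfl fun b hb => ?_
    simp only [Finset.mem_range] at hb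
    rw [sCoeff, sub_add_cancel, hM]
    have hexp : n - 2 * (i + b) = 2 * (l - i) + (n - 2 * l - 2 * b) := by omega
    rw [hexp, Polynomial.eval_mul, Polynomial.eval_C, Polynomial.eval_pow, Polynomial.eval_X,
      mul_pow, neg_pow (c ^ 2), ← pow_mul, pow_add]
    push_cast
    ring

end TrinomialExpansion

section SpecialValues

open PowerSeries

theorem rescale_one_sub (z w : ℂ) :
    PowerSeries.rescale z (1 - C w * X) = 1 - C z * C w * X := by
  rw [map_sub, map_one, map_mul, PowerSeries.rescale_X]
  have : PowerSeries.rescale z (C w) = C w := by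
    ext1 n
    rw [coeff_rescale, coeff_C]
    split_ifs with h
    · rw [h]; simp
    · simp
  rw [this]
  ring

theorem pSeries_neg_left (k : ℕ) : pSeries (-k - 1) (1 + Complex.I)
    = (1 - C (1 + Complex.I) * X) ^ k * (1 - C (1 - Complex.I) * X) ^ (k + 1) := by
  have h : binSeries (-k - 1) (1 - Complex.I) = (1 - C (1 - Complex.I) * X) ^ (k + 1) := by
    rw [← binSeries_neg]; congr 1; push_cast; ring
  rw [pSeries, ← mul_assoc, binSeries_one_mul, h]

theorem pSeries_neg_right (k : ℕ) : pSeries (-k - 1) (1 - Complex.I)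
    = (1 - C (1 + Complex.I) * X) ^ (k + 1) * (1 - C (1 - Complex.I) * X) ^ k := by
  have h : binSeries (-k - 1) (1 + Complex.I) = (1 - C (1 + Complex.I) * X) ^ (k + 1) := by
    rw [← binSeries_neg]; congr 1; push_cast; ring
  rw [pSeries, mul_left_comm, binSeries_one_mul, h]

/-- The generating function of the products `p_a(ζ_1; ζ) p_b(ζ_2; ζ)` for negative integral
parameter. -/
theorem rescale_pSeries_mul (k : ℕ) {z w c : ℂ} (hzw : z * w = 1) (hc : z + w = 2 * c) :
    PowerSeries.rescale z (pSeries (-k - 1) (1 + Complex.I)) *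
        PowerSeries.rescale w (pSeries (-k - 1) (1 - Complex.I))
      = ((1 - X * (C (2 * c) + C (-2) * X)) ^ 2 - C (4 * (1 - c ^ 2)) * X ^ 2) ^ k *
        ((1 - C z * C (1 - Complex.I) * X) * (1 - C w * C (1 + Complex.I) * X)) := by
  have hI : (C Complex.I : ℂ⟦X⟧) ^ 2 = -1 := by
    rw [← map_pow, Complex.I_sq, map_neg, map_one]
  have hzw' : (C z : ℂ⟦X⟧) * C w = 1 := by rw [← map_mul, hzw, map_one]
  have hf : ∀ u : ℂ, (1 - C u * C (1 + Complex.I) * X) * (1 - C u * C (1 - Complex.I) * X)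
      = (1 - 2 * C u * X + 2 * C u ^ 2 * X ^ 2 : ℂ⟦X⟧) := by
    intro u
    simp only [map_add, map_sub, map_one]
    linear_combination (-(C u : ℂ⟦X⟧) ^ 2 * X ^ 2) * hI
  have hQ : (1 - 2 * C z * X + 2 * C z ^ 2 * X ^ 2 : ℂ⟦X⟧) *
      (1 - 2 * C w * X + 2 * C w ^ 2 * X ^ 2)
      = (1 - X * (C (2 * c) + C (-2) * X)) ^ 2 - C (4 * (1 - c ^ 2)) * X ^ 2 := by
    have h4 : 4 * (1 - c ^ 2) = 4 - (z + w) ^ 2 := by rw [hc]; ring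
    rw [h4, ← hc]
    simp only [map_add, map_sub, map_pow, map_neg, map_ofNat]
    linear_combination (-4 * (C z + C w) * X ^ 3 + 4 * (C z * C w + 1) * X ^ 4 : ℂ⟦X⟧) * hzw'
  rw [pSeries_neg_left, pSeries_neg_right, ← hQ, ← hf z, ← hf w]
  simp only [map_mul, map_pow, rescale_one_sub, mul_pow, pow_succ]
  ac_rfl

theorem coeff_rescale_mul (F G : ℂ⟦X⟧) (z w : ℂ) (n : ℕ) :
    coeff n (PowerSeries.rescale z F * PowerSeries.rescale w G)
      = ∑ ab ∈ Finset.HasAntidiagonal.antidiagonal n,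
        z ^ ab.1 * w ^ ab.2 * (coeff ab.1 F * coeff ab.2 G) := by
  rw [coeff_mul]
  refine Finset.sum_congr rfl fun ab _ => ?_
  rw [coeff_rescale, coeff_rescale]
  ring

open Polynomial.Chebyshev

/-- `∑ φ_{n,j}(ζ) c^j` as a polynomial in `c`. -/
def phiValPoly (κ : ℝ) (n : ℕ) : Polynomial ℂ :=
  ∑ ab ∈ Finset.HasAntidiagonal.antidiagonal n, T ℂ ((ab.1 : ℤ) - ab.2) * Polynomial.C
    (coeff ab.1 (pSeries κ (1 + Complex.I)) * coeff ab.2 (pSeries κ (1 - Complex.I)))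

/-- `∑ ψ_{n,j}(ζ) c^j` as a polynomial in `c`. -/
def psiValPoly (κ : ℝ) (n : ℕ) : Polynomial ℂ :=
  ∑ ab ∈ Finset.HasAntidiagonal.antidiagonal n, U ℂ ((ab.1 : ℤ) - ab.2 - 1) * Polynomial.C
    (coeff ab.1 (pSeries κ (1 + Complex.I)) * coeff ab.2 (pSeries κ (1 - Complex.I)))

theorem evalPoint_sum_smul {N : ℕ} (hN : 2 ≤ N) (κ : ℝ) (n : ℕ) (g : ℕ × ℕ → ℝ) :
    evalPoint hN (∑ ab ∈ Finset.HasAntidiagonal.antidiagonal n,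
      g ab • (pPoly κ ab.1 (idx1 hN) * pPoly κ ab.2 (idx2 hN)))
      = ∑ ab ∈ Finset.HasAntidiagonal.antidiagonal n, (g ab : ℂ) *
        (coeff ab.1 (pSeries κ (1 + Complex.I)) * coeff ab.2 (pSeries κ (1 - Complex.I))) := by
  rw [evalPoint, map_sum]
  refine Finset.sum_congr rfl fun ab _ => ?_
  rw [map_smul, map_mul, ← (evalPoint_pPoly hN κ _).1, ← (evalPoint_pPoly hN κ _).2]
  exact Complex.real_smul

theorem evalPoint_phi_eq_coeff {N : ℕ} (hN : 2 ≤ N) (κ : ℝ) (n j : ℕ) :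
    evalPoint hN (phi hN κ n j) = (phiValPoly κ n).coeff j := by
  rw [phi_eq, evalPoint_sum_smul hN κ n (fun ab => (T ℝ ((ab.1 : ℤ) - ab.2)).coeff j), phiValPoly,
    Polynomial.finsetSum_coeff]
  refine Finset.sum_congr rfl fun ab _ => ?_
  rw [Polynomial.coeff_mul_C, ← map_T Complex.ofRealHom, Polynomial.coeff_map]
  rfl

theorem evalPoint_psi_eq_coeff {N : ℕ} (hN : 2 ≤ N) (κ : ℝ) (n j : ℕ) :
    evalPoint hN (psi hN κ n j) = (psiValPoly κ n).coeff j := by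
  rw [psi_eq, evalPoint_sum_smul hN κ n (fun ab => (U ℝ ((ab.1 : ℤ) - ab.2 - 1)).coeff j),
    psiValPoly, Polynomial.finsetSum_coeff]
  refine Finset.sum_congr rfl fun ab _ => ?_
  rw [Polynomial.coeff_mul_C, ← map_U Complex.ofRealHom, Polynomial.coeff_map]
  rfl

theorem exp_mul_cos_add (θ : ℂ) : Complex.exp (θ * Complex.I) * Complex.exp (-θ * Complex.I) = 1 ∧
    Complex.exp (θ * Complex.I) + Complex.exp (-θ * Complex.I) = 2 * Complex.cos θ ∧
    Complex.exp (θ * Complex.I) - Complex.exp (-θ * Complex.I)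
      = 2 * Complex.I * Complex.sin θ := by
  refine ⟨?_, ?_, ?_⟩
  · rw [← Complex.exp_add, ← Complex.exp_zero]; congr 1; ring
  · rw [Complex.two_cos]
  · have := Complex.two_sin θ
    linear_combination (-Complex.I) * this +
      (Complex.exp (θ * Complex.I) - Complex.exp (-θ * Complex.I)) * Complex.I_sq

theorem exp_pow_mul_exp_pow (θ : ℂ) (a b : ℕ) :
    Complex.exp (θ * Complex.I) ^ a * Complex.exp (-θ * Complex.I) ^ b
      = Complex.exp (((a : ℂ) - b) * θ * Complex.I) := by
  rw [← Complex.exp_nat_mul, ← Complex.exp_nat_mul, ← Complex.exp_add]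
  congr 1
  ring

theorem phiValPoly_neg (k n : ℕ) : phiValPoly (-k - 1) n = sPoly n (-k - 1) 1 := by
  refine Polynomial.funext fun c => ?_
  obtain ⟨θ, rfl⟩ := Complex.cos_surjective c
  obtain ⟨h1, h2, h3⟩ := exp_mul_cos_add θ
  set z := Complex.exp (θ * Complex.I) with hz
  set w := Complex.exp (-θ * Complex.I) with hw
  have hL : 2 * (phiValPoly (-k - 1) n).eval (Complex.cos θ)
      = coeff n (PowerSeries.rescale z (pSeries (-k - 1) (1 + Complex.I)) *
          PowerSeries.rescale w (pSeries (-k - 1) (1 - Complex.I)))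
        + coeff n (PowerSeries.rescale w (pSeries (-k - 1) (1 + Complex.I)) *
          PowerSeries.rescale z (pSeries (-k - 1) (1 - Complex.I))) := by
    rw [coeff_rescale_mul, coeff_rescale_mul, ← Finset.sum_add_distrib, phiValPoly,
      Polynomial.eval_finsetSum, Finset.mul_sum]
    refine Finset.sum_congr rfl fun ab _ => ?_
    rw [Polynomial.eval_mul, Polynomial.eval_C, T_complex_cos]
    have e1 := exp_pow_mul_exp_pow θ ab.1 ab.2
    have e2 := exp_pow_mul_exp_pow θ ab.2 ab.1
    rw [← hz, ← hw] at e1 e2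
    have e3 := Complex.two_cos (((ab.1 : ℂ) - ab.2) * θ)
    have e4 : -(((ab.1 : ℂ) - ab.2) * θ) * Complex.I
        = ((ab.2 : ℂ) - ab.1) * θ * Complex.I := by ring
    rw [e4, ← e1, ← e2] at e3
    push_cast
    linear_combination (coeff ab.1 (pSeries (-k - 1) (1 + Complex.I))
      * coeff ab.2 (pSeries (-k - 1) (1 - Complex.I))) * e3
  have hR := eval_sPoly n k 1 (Complex.cos θ)
  rw [show (2 : ℝ) - (1 : ℕ) = 1 by norm_num] at hR
  rw [hR]
  apply mul_left_cancel₀ (two_ne_zero (α := ℂ))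
  rw [hL, rescale_pSeries_mul k h1 h2, rescale_pSeries_mul k (by rw [mul_comm, h1])
    (by rw [add_comm, h2]), ← map_add, ← mul_add, ← coeff_C_mul]
  congr 1
  have hzw' : (C z : ℂ⟦X⟧) * C w = 1 := by rw [← map_mul, h1, map_one]
  have hI : (C Complex.I : ℂ⟦X⟧) ^ 2 = -1 := by
    rw [← map_pow, Complex.I_sq, map_neg, map_one]
  have hq : ((1 - C z * C (1 - Complex.I) * X) * (1 - C w * C (1 + Complex.I) * X)
      + (1 - C w * C (1 - Complex.I) * X) * (1 - C z * C (1 + Complex.I) * X) : ℂ⟦X⟧)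
      = C 2 * (1 - X * (C (2 * Complex.cos θ) + C (-2) * X)) := by
    rw [← h2]
    simp only [map_add, map_sub, map_neg, map_one, map_ofNat]
    linear_combination (4 * X ^ 2 : ℂ⟦X⟧) * hzw' - (2 * C z * C w * X ^ 2 : ℂ⟦X⟧) * hI
  rw [hq]
  ring

theorem psiValPoly_neg (k n : ℕ) : psiValPoly (-k - 1) (n + 1)
    = Polynomial.C (2 * Complex.I) * sPoly n (-k - 1) 2 := by
  have hX : (1 - Polynomial.X ^ 2 : Polynomial ℂ) ≠ 0 := by
    intro h
    have := congrArg (Polynomial.eval 0) h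
    simp at this
  apply mul_left_cancel₀ hX
  refine Polynomial.funext fun c => ?_
  obtain ⟨θ, rfl⟩ := Complex.cos_surjective c
  obtain ⟨h1, h2, h3⟩ := exp_mul_cos_add θ
  set z := Complex.exp (θ * Complex.I) with hz
  set w := Complex.exp (-θ * Complex.I) with hw
  have hL : 2 * Complex.I * ((psiValPoly (-k - 1) (n + 1)).eval (Complex.cos θ) * Complex.sin θ)
      = coeff (n + 1) (PowerSeries.rescale z (pSeries (-k - 1) (1 + Complex.I)) *
          PowerSeries.rescale w (pSeries (-k - 1) (1 - Complex.I)))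
        - coeff (n + 1) (PowerSeries.rescale w (pSeries (-k - 1) (1 + Complex.I)) *
          PowerSeries.rescale z (pSeries (-k - 1) (1 - Complex.I))) := by
    rw [coeff_rescale_mul, coeff_rescale_mul, ← Finset.sum_sub_distrib, psiValPoly,
      Polynomial.eval_finsetSum, Finset.sum_mul, Finset.mul_sum]
    refine Finset.sum_congr rfl fun ab _ => ?_
    have e0 := U_complex_cos θ ((ab.1 : ℤ) - ab.2 - 1)
    rw [Polynomial.eval_mul, Polynomial.eval_C]
    have e1 := exp_pow_mul_exp_pow θ ab.1 ab.2
    have e2 := exp_pow_mul_exp_pow θ ab.2 ab.1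
    rw [← hz, ← hw] at e1 e2
    have e3 := (exp_mul_cos_add (((ab.1 : ℂ) - ab.2) * θ)).2.2
    have e4 : -(((ab.1 : ℂ) - ab.2) * θ) * Complex.I
        = ((ab.2 : ℂ) - ab.1) * θ * Complex.I := by ring
    rw [e4, ← e1, ← e2] at e3
    push_cast at e0
    rw [sub_add_cancel] at e0
    linear_combination (coeff ab.1 (pSeries (-k - 1) (1 + Complex.I))
      * coeff ab.2 (pSeries (-k - 1) (1 - Complex.I))) * (2 * Complex.I * e0 - e3)
  have hR := eval_sPoly n k 0 (Complex.cos θ)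
  rw [show (2 : ℝ) - (0 : ℕ) = 2 by norm_num, pow_zero, one_mul] at hR
  rw [rescale_pSeries_mul k h1 h2, rescale_pSeries_mul k (by rw [mul_comm, h1])
    (by rw [add_comm, h2]), ← map_sub, ← mul_sub] at hL
  have hq : ((1 - C z * C (1 - Complex.I) * X) * (1 - C w * C (1 + Complex.I) * X)
      - (1 - C w * C (1 - Complex.I) * X) * (1 - C z * C (1 + Complex.I) * X) : ℂ⟦X⟧)
      = C (2 * Complex.I * Complex.sin θ * (2 * Complex.I)) * X := by
    rw [← h3]
    simp only [map_add, map_sub, map_one, map_mul, map_ofNat]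
    ring
  rw [hq, mul_left_comm (_ ^ k), coeff_C_mul, coeff_succ_mul_X, ← hR] at hL
  have hs := Complex.sin_sq_add_cos_sq θ
  simp only [Polynomial.eval_mul, Polynomial.eval_sub, Polynomial.eval_one, Polynomial.eval_pow,
    Polynomial.eval_X, Polynomial.eval_C]
  have hs' : 1 - Complex.cos θ ^ 2 = Complex.sin θ ^ 2 := by linear_combination -hs
  rw [hs']
  apply mul_left_cancel₀ (mul_ne_zero two_ne_zero Complex.I_ne_zero)
  linear_combination Complex.sin θ * hL

theorem isPolyFun_phiVal (n j : ℕ) : IsPolyFun fun κ => (phiValPoly κ n).coeff j := by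
  simp only [phiValPoly, Polynomial.finsetSum_coeff, Polynomial.coeff_mul_C]
  exact IsPolyFun.sum fun ab _ => (IsPolyFun.const _).mul
    ((isPolyFun_coeff_pSeries _ _).mul (isPolyFun_coeff_pSeries _ _))

theorem isPolyFun_psiVal (n j : ℕ) : IsPolyFun fun κ => (psiValPoly κ n).coeff j := by
  simp only [psiValPoly, Polynomial.finsetSum_coeff, Polynomial.coeff_mul_C]
  exact IsPolyFun.sum fun ab _ => (IsPolyFun.const _).mul
    ((isPolyFun_coeff_pSeries _ _).mul (isPolyFun_coeff_pSeries _ _))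

theorem evalPoint_phi {N : ℕ} (hN : 2 ≤ N) (κ : ℝ) {n j : ℕ} (hj : j ≤ n / 2) :
    evalPoint hN (phi hN κ n (n - 2 * j)) = ((sConst n j κ 1 : ℝ) : ℂ) := by
  rw [evalPoint_phi_eq_coeff]
  refine IsPolyFun.eq_of_neg_nat (isPolyFun_phiVal n (n - 2 * j)) (isPolyFun_sConst n j 1) ?_ κ
  intro k
  rw [phiValPoly_neg, coeff_sPoly hj]

theorem evalPoint_psi {N : ℕ} (hN : 2 ≤ N) (κ : ℝ) {n j : ℕ} (hj : j ≤ n / 2) :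
    evalPoint hN (psi hN κ (n + 1) (n - 2 * j))
      = 2 * Complex.I * ((sConst n j κ 2 : ℝ) : ℂ) := by
  rw [evalPoint_psi_eq_coeff]
  refine IsPolyFun.eq_of_neg_nat (isPolyFun_psiVal (n + 1) (n - 2 * j))
    ((IsPolyFun.const _).mul (isPolyFun_sConst n j 2)) ?_ κ
  intro k
  rw [psiValPoly_neg, Polynomial.coeff_C_mul, coeff_sPoly hj]

end SpecialValues

end PlanarDunkl

end

noncomputable section

namespace PlanarDunkl

section Growth

/-- Functions on `ℝᴺ` that grow more slowly than every `e^{δ|x|²}`. -/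
def IsSubGaussian {N : ℕ} (f : EuclideanSpace ℝ (Fin N) → ℝ) : Prop :=
  ∀ δ : ℝ, 0 < δ → ∃ C, 0 ≤ C ∧ ∀ x, |f x| ≤ C * Real.exp (δ * ‖x‖ ^ 2)

namespace IsSubGaussian

variable {N : ℕ} {f g : EuclideanSpace ℝ (Fin N) → ℝ}

theorem const (c : ℝ) : IsSubGaussian fun _ : EuclideanSpace ℝ (Fin N) => c :=
  fun δ hδ => ⟨|c|, abs_nonneg c, fun x =>
    le_mul_of_one_le_right (abs_nonneg c) (Real.one_le_exp (by positivity))⟩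

theorem add (hf : IsSubGaussian f) (hg : IsSubGaussian g) :
    IsSubGaussian fun x => f x + g x := by
  intro δ hδ
  obtain ⟨C, hC0, hC⟩ := hf δ hδ
  obtain ⟨D, hD0, hD⟩ := hg δ hδ
  refine ⟨C + D, add_nonneg hC0 hD0, fun x => ?_⟩
  rw [add_mul]
  exact (abs_add_le _ _).trans (add_le_add (hC x) (hD x))

theorem mul (hf : IsSubGaussian f) (hg : IsSubGaussian g) :
    IsSubGaussian fun x => f x * g x := by
  intro δ hδ
  obtain ⟨C, hC0, hC⟩ := hf (δ / 2) (half_pos hδ)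
  obtain ⟨D, hD0, hD⟩ := hg (δ / 2) (half_pos hδ)
  refine ⟨C * D, mul_nonneg hC0 hD0, fun x => ?_⟩
  have h : Real.exp (δ * ‖x‖ ^ 2)
      = Real.exp (δ / 2 * ‖x‖ ^ 2) * Real.exp (δ / 2 * ‖x‖ ^ 2) := by
    rw [← Real.exp_add]; congr 1; ring
  rw [abs_mul, h, mul_mul_mul_comm]
  exact mul_le_mul (hC x) (hD x) (abs_nonneg _) (by positivity)

theorem coord (i : Fin N) : IsSubGaussian fun x : EuclideanSpace ℝ (Fin N) => x i := by
  intro δ hδ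
  refine ⟨1 + 1 / δ, by positivity, fun x => ?_⟩
  have h1 : |x i| ≤ ‖x‖ := by simpa using PiLp.norm_apply_le x i
  have h2 : δ * ‖x‖ ^ 2 + 1 ≤ Real.exp (δ * ‖x‖ ^ 2) := Real.add_one_le_exp _
  have h3 : ‖x‖ ≤ (1 + 1 / δ) * (δ * ‖x‖ ^ 2 + 1) := by
    have : (1 + 1 / δ) * (δ * ‖x‖ ^ 2 + 1) = δ * ‖x‖ ^ 2 + 1 + ‖x‖ ^ 2 + 1 / δ := by
      field_simp; ring
    rw [this]
    have : 0 < 1 / δ := by positivity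
    have : 0 ≤ δ * ‖x‖ ^ 2 := by positivity
    nlinarith [sq_nonneg (‖x‖ - 1)]
  exact h1.trans (h3.trans (mul_le_mul_of_nonneg_left h2 (by positivity)))

theorem evalE (P : MvPolynomial (Fin N) ℝ) : IsSubGaussian (evalE P) := by
  induction P using MvPolynomial.induction_on with
  | C a =>
    have : PlanarDunkl.evalE (N := N) (MvPolynomial.C a) = fun _ => a := by
      ext x; simp [PlanarDunkl.evalE]
    rw [this]
    exact const a
  | add p q hp hq =>
    have : PlanarDunkl.evalE (p + q) = fun x => PlanarDunkl.evalE p x + PlanarDunkl.evalE q x := by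
      ext x; simp [PlanarDunkl.evalE]
    rw [this]
    exact hp.add hq
  | mul_X p k hp =>
    have : PlanarDunkl.evalE (p * MvPolynomial.X k) = fun x => PlanarDunkl.evalE p x * x k := by
      ext x; simp [PlanarDunkl.evalE]
    rw [this]
    exact hp.mul (coord k)

theorem rpow (hf : IsSubGaussian f) {κ : ℝ} (hκ : 0 ≤ κ) (hf0 : ∀ x, 0 ≤ f x) :
    IsSubGaussian fun x => f x ^ κ := by
  rcases hκ.eq_or_lt with rfl | hκ
  · simpa using const (N := N) 1
  intro δ hδ
  obtain ⟨C, hC0, hC⟩ := hf (δ / κ) (by positivity)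
  refine ⟨C ^ κ, by positivity, fun x => ?_⟩
  have h : Real.exp (δ * ‖x‖ ^ 2) = Real.exp (δ / κ * ‖x‖ ^ 2) ^ κ := by
    rw [← Real.exp_mul]; congr 1; field_simp
  rw [h, ← Real.mul_rpow hC0 (Real.exp_pos _).le, abs_of_nonneg (Real.rpow_nonneg (hf0 x) _)]
  exact Real.rpow_le_rpow (hf0 x) ((le_abs_self _).trans (hC x)) hκ.le

theorem prod {ι : Type*} (s : Finset ι) {f : ι → EuclideanSpace ℝ (Fin N) → ℝ}
    (hf : ∀ i, IsSubGaussian (f i)) : IsSubGaussian fun x => ∏ i ∈ s, f i x := by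
  classical
  induction s using Finset.induction_on with
  | empty => simpa using const (N := N) 1
  | insert a s ha ih => simpa [Finset.prod_insert ha] using (hf a).mul ih

/-- A weight that is integrable against every Gaussian stays so after multiplication by a
subgaussian function. -/
theorem integrable_mul (hf : IsSubGaussian f) (hfm : Measurable f)
    {V : EuclideanSpace ℝ (Fin N) → ℝ}
    (hV : ∀ δ : ℝ, 0 < δ → Integrable fun x => V x * Real.exp (-δ * ‖x‖ ^ 2))
    {δ : ℝ} (hδ : 0 < δ) : Integrable fun x => f x * (V x * Real.exp (-δ * ‖x‖ ^ 2)) := by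
  obtain ⟨C, hC0, hC⟩ := hf (δ / 2) (half_pos hδ)
  refine Integrable.mono' ((hV (δ / 2) (half_pos hδ)).norm.const_mul C)
    (hfm.aestronglyMeasurable.mul (hV δ hδ).aestronglyMeasurable) (.of_forall fun x => ?_)
  have h : Real.exp (-(δ / 2) * ‖x‖ ^ 2)
      = Real.exp (δ / 2 * ‖x‖ ^ 2) * Real.exp (-δ * ‖x‖ ^ 2) := by
    rw [← Real.exp_add]; congr 1; ring
  simp only [norm_mul, Real.norm_eq_abs, Real.abs_exp]
  rw [h]
  calc |f x| * (|V x| * Real.exp (-δ * ‖x‖ ^ 2))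
      ≤ C * Real.exp (δ / 2 * ‖x‖ ^ 2) * (|V x| * Real.exp (-δ * ‖x‖ ^ 2)) :=
        mul_le_mul_of_nonneg_right (hC x) (by positivity)
    _ = _ := by ring

end IsSubGaussian

end Growth

section Integrability

variable {N : ℕ}

theorem continuous_coord (i : Fin N) : Continuous fun x : EuclideanSpace ℝ (Fin N) => x i :=
  (EuclideanSpace.proj i : EuclideanSpace ℝ (Fin N) →L[ℝ] ℝ).continuous

theorem continuous_evalE (P : MvPolynomial (Fin N) ℝ) : Continuous (evalE P) := by
  unfold evalE
  exact (MvPolynomial.continuous_eval P).comp (continuous_pi continuous_coord)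

theorem measurable_weight (κ : ℝ) : Measurable (weight (N := N) κ) := by
  unfold weight
  refine Finset.measurable_prod _ fun i _ => Finset.measurable_prod _ fun j _ => ?_
  exact (((continuous_coord i).sub (continuous_coord j)).measurable.abs).pow_const _

theorem weight_nonneg (κ : ℝ) (x : EuclideanSpace ℝ (Fin N)) : 0 ≤ weight κ x :=
  Finset.prod_nonneg fun _ _ => Finset.prod_nonneg fun _ _ => Real.rpow_nonneg (abs_nonneg _) _

theorem integrable_exp_neg_norm_sq {δ : ℝ} (hδ : 0 < δ) :
    Integrable fun x : EuclideanSpace ℝ (Fin N) => Real.exp (-δ * ‖x‖ ^ 2) := by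
  have h := GaussianFourier.integrable_cexp_neg_mul_sq_norm_add (b := δ) (by simpa using hδ) 0
    (0 : EuclideanSpace ℝ (Fin N))
  refine h.norm.congr (.of_forall fun x => ?_)
  simp only [zero_mul, add_zero, Complex.norm_exp]
  congr 1
  norm_cast

theorem integrable_abs_rpow_mul_exp {s δ : ℝ} (hs : -1 < s) (hδ : 0 < δ) :
    Integrable fun t : ℝ => |t| ^ s * Real.exp (-δ * t ^ 2) := by
  have h := (integrable_fun_norm_addHaar (volume : Measure ℝ)
    (f := fun t : ℝ => t ^ s * Real.exp (-δ * t ^ 2))).2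
    (by simpa using integrableOn_rpow_mul_exp_neg_mul_sq hδ hs)
  simpa using h

/-- The linear change of variables `y_i = x_i`, `y_j = x_j - x_i` for `j ≠ i`. -/
def shear (i : Fin N) : (Fin N → ℝ) ≃ₗ[ℝ] (Fin N → ℝ) where
  toFun x j := if j = i then x i else x j - x i
  invFun y j := if j = i then y i else y j + y i
  map_add' x y := by ext j; dsimp only [Pi.add_apply]; split_ifs <;> ring
  map_smul' c x := by
    ext j; dsimp only [Pi.smul_apply, smul_eq_mul, RingHom.id_apply]; split_ifs <;> ring
  left_inv x := by ext j; by_cases h : j = i <;> simp [h]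
  right_inv x := by ext j; by_cases h : j = i <;> simp [h]

theorem integrable_comp_linearEquiv (e : (Fin N → ℝ) ≃ₗ[ℝ] (Fin N → ℝ)) {f : (Fin N → ℝ) → ℝ}
    (hf : Integrable f) : Integrable (f ∘ e) := by
  have hdet : LinearMap.det (e : (Fin N → ℝ) →ₗ[ℝ] (Fin N → ℝ)) ≠ 0 :=
    (LinearEquiv.isUnit_det' e).ne_zero
  have hmap := Real.map_linearMap_volume_pi_eq_smul_volume_pi hdet
  have hem : Measurable e := e.toContinuousLinearEquiv.continuous.measurable
  have h : Integrable f (Measure.map e volume) := by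
    have : Measure.map e volume = _ := hmap
    rw [this]
    exact hf.smul_measure ENNReal.ofReal_ne_top
  exact h.comp_measurable hem

theorem sum_shear_sq_le (i : Fin N) (x : Fin N → ℝ) :
    ∑ j, shear i x j ^ 2 ≤ (2 * N + 3) * ∑ j, x j ^ 2 := by
  have hi : x i ^ 2 ≤ ∑ j, x j ^ 2 :=
    Finset.single_le_sum (f := fun j => x j ^ 2) (fun j _ => sq_nonneg _) (Finset.mem_univ i)
  have h : ∀ j, shear i x j ^ 2 ≤ 2 * x j ^ 2 + 2 * x i ^ 2 := by
    intro j
    simp only [shear, LinearEquiv.coe_mk, LinearMap.coe_mk, AddHom.coe_mk]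
    split_ifs with h
    · nlinarith [sq_nonneg (x j), sq_nonneg (x i)]
    · nlinarith [sq_nonneg (x j + x i)]
  refine (Finset.sum_le_sum fun j _ => h j).trans ?_
  rw [Finset.sum_add_distrib, ← Finset.mul_sum, Finset.sum_const, Finset.card_univ,
    Fintype.card_fin, nsmul_eq_mul]
  have hN : (0 : ℝ) ≤ N := Nat.cast_nonneg N
  nlinarith [mul_le_mul_of_nonneg_left hi hN, sq_nonneg (x i)]

/-- The star-shaped weights `∏_{j ≠ i} |x_j - x_i|^s` are integrable against every Gaussian. -/
theorem integrable_star {s δ : ℝ} (hs : -1 < s) (hδ : 0 < δ) (i : Fin N) :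
    Integrable fun x : EuclideanSpace ℝ (Fin N) =>
      (∏ j ∈ {i}ᶜ, |x j - x i| ^ s) * Real.exp (-δ * ‖x‖ ^ 2) := by
  set η : ℝ := δ / (2 * N + 3) with hη
  have hη0 : 0 < η := by positivity
  have h1 : Integrable fun y : Fin N → ℝ =>
      ∏ j, (if j = i then (fun t : ℝ => Real.exp (-η * t ^ 2))
        else fun t => |t| ^ s * Real.exp (-η * t ^ 2)) (y j) := by
    refine Integrable.fintype_prod (f := fun j => if j = i then (fun t : ℝ => Real.exp (-η * t ^ 2))
        else fun t => |t| ^ s * Real.exp (-η * t ^ 2)) fun j => ?_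
    split_ifs
    · exact integrable_exp_neg_mul_sq hη0
    · exact integrable_abs_rpow_mul_exp hs hη0
  have h2 := (PiLp.volume_preserving_ofLp (Fin N)).integrable_comp_of_integrable
    (integrable_comp_linearEquiv (shear i) h1)
  refine Integrable.mono' h2 ?_ (.of_forall fun x => ?_)
  · refine Measurable.aestronglyMeasurable ?_
    refine Measurable.mul (Finset.measurable_prod _ fun j _ =>
      (((continuous_coord j).sub (continuous_coord i)).measurable.abs).pow_const _) ?_
    exact (by fun_prop : Continuous fun x : EuclideanSpace ℝ (Fin N) =>
      Real.exp (-δ * ‖x‖ ^ 2)).measurable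
  · have hpos : 0 ≤ ∏ j ∈ ({i}ᶜ : Finset (Fin N)), |x j - x i| ^ s :=
      Finset.prod_nonneg fun _ _ => Real.rpow_nonneg (abs_nonneg _) _
    rw [Real.norm_eq_abs, abs_mul, Real.abs_exp, abs_of_nonneg hpos]
    have h3 : ∏ j, (if j = i then (fun t : ℝ => Real.exp (-η * t ^ 2))
        else fun t => |t| ^ s * Real.exp (-η * t ^ 2)) (shear i x.ofLp j)
        = (∏ j ∈ {i}ᶜ, |x j - x i| ^ s) * Real.exp (-η * ∑ j, shear i x.ofLp j ^ 2) := by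
      rw [Finset.mul_sum, Real.exp_sum, ← Finset.prod_compl_mul_prod {i},
        ← Finset.prod_compl_mul_prod {i} (fun j => Real.exp _), ← mul_assoc,
        ← Finset.prod_mul_distrib, Finset.prod_singleton, Finset.prod_singleton, if_pos rfl]
      congr 1
      refine Finset.prod_congr rfl fun j hj => ?_
      have hj : j ≠ i := by simpa using hj
      simp only [if_neg hj, shear, LinearEquiv.coe_mk, LinearMap.coe_mk, AddHom.coe_mk]
    have h4 : ‖x‖ ^ 2 = ∑ j, x j ^ 2 := by
      rw [EuclideanSpace.norm_sq_eq]; simp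
    simp only [Function.comp_apply]
    rw [h3]
    refine mul_le_mul_of_nonneg_left (Real.exp_le_exp.2 ?_) hpos
    rw [h4, neg_mul, neg_mul, neg_le_neg_iff, hη, div_mul_eq_mul_div, div_le_iff₀ (by positivity),
      mul_assoc]
    refine mul_le_mul_of_nonneg_left ?_ hδ.le
    rw [mul_comm]
    exact sum_shear_sq_le i x.ofLp

theorem weight_eq_prod_compl (κ : ℝ) (x : EuclideanSpace ℝ (Fin N)) :
    weight κ x = ∏ i, ∏ j ∈ {i}ᶜ, |x j - x i| ^ κ := by
  rw [weight, ← Finset.prod_prod_Ioi_mul_eq_prod_prod_off_diag (fun j i => |x j - x i| ^ κ)]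
  refine Finset.prod_congr rfl fun i _ => Finset.prod_congr rfl fun j _ => ?_
  rw [abs_sub_comm (x j), ← sq, mul_comm 2 κ, Real.rpow_mul (abs_nonneg _), Real.rpow_two]

theorem weight_le_sum_star (hN : N ≠ 0) (κ : ℝ) (x : EuclideanSpace ℝ (Fin N)) :
    weight κ x ≤ ∑ i, (N : ℝ)⁻¹ * ∏ j ∈ {i}ᶜ, |x j - x i| ^ (N * κ) := by
  have hN' : (N : ℝ) ≠ 0 := Nat.cast_ne_zero.2 hN
  rw [weight_eq_prod_compl]
  have h := Real.geom_mean_le_arith_mean_weighted Finset.univ (fun _ : Fin N => (N : ℝ)⁻¹)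
    (fun i => ∏ j ∈ {i}ᶜ, |x j - x i| ^ (N * κ)) (fun _ _ => by positivity)
    (by simp [hN']) (fun i _ => Finset.prod_nonneg fun _ _ => Real.rpow_nonneg (abs_nonneg _) _)
  refine le_trans (le_of_eq ?_) h
  refine Finset.prod_congr rfl fun i _ => ?_
  rw [← Real.finsetProd_rpow _ _ fun j _ => Real.rpow_nonneg (abs_nonneg _) _]
  refine Finset.prod_congr rfl fun j _ => ?_
  rw [← Real.rpow_mul (abs_nonneg _)]
  congr 1
  field_simp

theorem integrable_weight_of_neg (hN : N ≠ 0) {κ : ℝ} (hκ : -1 < N * κ) {δ : ℝ} (hδ : 0 < δ) :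
    Integrable fun x : EuclideanSpace ℝ (Fin N) => weight κ x * Real.exp (-δ * ‖x‖ ^ 2) := by
  have h : Integrable fun x : EuclideanSpace ℝ (Fin N) => ∑ i : Fin N, (N : ℝ)⁻¹ *
      ((∏ j ∈ {i}ᶜ, |x j - x i| ^ (N * κ)) * Real.exp (-δ * ‖x‖ ^ 2)) :=
    integrable_finsetSum _ fun i _ => (integrable_star hκ hδ i).const_mul _
  refine Integrable.mono' h ?_ (.of_forall fun x => ?_)
  · exact ((measurable_weight κ).mul (by fun_prop : Continuous fun x : EuclideanSpace ℝ (Fin N) =>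
      Real.exp (-δ * ‖x‖ ^ 2)).measurable).aestronglyMeasurable
  · rw [Real.norm_eq_abs, abs_mul, Real.abs_exp, abs_of_nonneg (weight_nonneg κ x)]
    simp only [← mul_assoc]
    rw [← Finset.sum_mul]
    exact mul_le_mul_of_nonneg_right (weight_le_sum_star hN κ x) (Real.exp_pos _).le

/-- The regularized weight `∏_{i<j} ((x_i - x_j)² + ε)^κ`. -/
def regWeight (κ ε : ℝ) (x : EuclideanSpace ℝ (Fin N)) : ℝ :=
  ∏ i : Fin N, ∏ j ∈ Finset.Ioi i, ((x i - x j) ^ 2 + ε) ^ κ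

theorem regWeight_zero (κ : ℝ) (x : EuclideanSpace ℝ (Fin N)) :
    regWeight κ 0 x = weight κ x := by
  refine Finset.prod_congr rfl fun i _ => Finset.prod_congr rfl fun j _ => ?_
  rw [add_zero, Real.rpow_mul (abs_nonneg _), Real.rpow_two, sq_abs]

theorem measurable_regWeight (κ ε : ℝ) : Measurable (regWeight (N := N) κ ε) := by
  unfold regWeight
  refine Finset.measurable_prod _ fun i _ => Finset.measurable_prod _ fun j _ => ?_
  exact ((((continuous_coord i).sub (continuous_coord j)).measurable.pow_const 2).add_const
    ε).pow_const _

theorem regWeight_nonneg (κ : ℝ) {ε : ℝ} (hε : 0 ≤ ε) (x : EuclideanSpace ℝ (Fin N)) :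
    0 ≤ regWeight κ ε x :=
  Finset.prod_nonneg fun _ _ => Finset.prod_nonneg fun _ _ => Real.rpow_nonneg (by positivity) _

/-- Almost every point has pairwise distinct coordinates. -/
theorem ae_coord_ne : ∀ᵐ x : EuclideanSpace ℝ (Fin N), ∀ i j : Fin N, i ≠ j → x i ≠ x j := by
  rw [ae_all_iff]; intro i
  rw [ae_all_iff]; intro j
  rw [Filter.eventually_imp_distrib_left]
  intro hij
  let p : Submodule ℝ (EuclideanSpace ℝ (Fin N)) :=
    LinearMap.ker ((EuclideanSpace.proj i - EuclideanSpace.proj j :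
      EuclideanSpace ℝ (Fin N) →L[ℝ] ℝ) : EuclideanSpace ℝ (Fin N) →ₗ[ℝ] ℝ)
  have hp : p ≠ ⊤ := by
    intro h
    have : EuclideanSpace.single i (1 : ℝ) ∈ p := by rw [h]; trivial
    simp [p, hij] at this
  have h0 := Measure.addHaar_submodule (volume : Measure (EuclideanSpace ℝ (Fin N))) p hp
  rw [ae_iff]
  refine measure_mono_null (fun x hx => ?_) h0
  simp only [not_not, Set.mem_ofPred_eq, ne_eq] at hx
  simp [p, hx]

/-- The regularized weights have a common bound that is integrable against every Gaussian. -/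
theorem exists_dominating (hN : N ≠ 0) {κ : ℝ} (hκ : -1 < N * κ) :
    ∃ V : EuclideanSpace ℝ (Fin N) → ℝ,
      (∀ δ : ℝ, 0 < δ → Integrable fun x => V x * Real.exp (-δ * ‖x‖ ^ 2)) ∧
      ∀ᵐ x, ∀ ε ∈ Set.Icc (0 : ℝ) 1, regWeight κ ε x ≤ V x := by
  rcases le_or_gt 0 κ with h0 | h0
  · refine ⟨regWeight κ 1, fun δ hδ => ?_, .of_forall fun x ε hε => ?_⟩
    · have h1 : IsSubGaussian (regWeight (N := N) κ 1) := by
        refine .prod _ fun i => .prod _ fun j => .rpow ?_ h0 fun x => by positivity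
        have h2 : (fun x : EuclideanSpace ℝ (Fin N) => (x i - x j) ^ 2 + 1)
            = evalE ((MvPolynomial.X i - MvPolynomial.X j) ^ 2 + 1) := by
          ext x; simp [evalE]
        rw [h2]
        exact .evalE _
      simpa using h1.integrable_mul (measurable_regWeight κ 1) (V := fun _ => 1)
        (fun δ hδ => by simpa using integrable_exp_neg_norm_sq hδ) hδ
    · have := hε.1
      refine Finset.prod_le_prod (fun i _ => Finset.prod_nonneg fun j _ =>
        Real.rpow_nonneg (by positivity) _) fun i _ => ?_
      refine Finset.prod_le_prod (fun j _ => Real.rpow_nonneg (by positivity) _) fun j _ => ?_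
      exact Real.rpow_le_rpow (by positivity) (by linarith [hε.2]) h0
  · refine ⟨weight κ, fun δ hδ => integrable_weight_of_neg hN hκ hδ, ?_⟩
    filter_upwards [ae_coord_ne] with x hx ε hε
    have := hε.1
    rw [← regWeight_zero]
    refine Finset.prod_le_prod (fun i _ => Finset.prod_nonneg fun j _ =>
        Real.rpow_nonneg (by positivity) _) fun i _ => ?_
    refine Finset.prod_le_prod (fun j _ => Real.rpow_nonneg (by positivity) _) fun j hj => ?_
    have h1 : x i - x j ≠ 0 := sub_ne_zero.2 (hx i j (Finset.mem_Ioi.1 hj).ne)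
    exact Real.rpow_le_rpow_of_nonpos (by positivity) (by linarith) h0.le

end Integrability

end PlanarDunkl

end

noncomputable section

namespace PlanarDunkl

section IntegrationByParts

variable {N : ℕ}

theorem prod_ite_eq_prod_compl (f : Fin N → ℝ) (a : Fin N) :
    (∏ b, if a = b then 1 else f b) = ∏ b ∈ {a}ᶜ, f b := by
  rw [← Finset.prod_compl_mul_prod {a}, Finset.prod_singleton, if_pos rfl, mul_one]
  refine Finset.prod_congr rfl fun b hb => if_neg ?_
  have : b ≠ a := by simpa using hb
  exact this.symm

theorem regWeight_eq_prod (κ : ℝ) {ε : ℝ} (hε : 0 ≤ ε) (x : EuclideanSpace ℝ (Fin N)) :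
    regWeight κ ε x = ∏ a, ∏ b, if a = b then 1 else ((x a - x b) ^ 2 + ε) ^ (κ / 2) := by
  simp only [prod_ite_eq_prod_compl]
  rw [regWeight,
    ← Finset.prod_prod_Ioi_mul_eq_prod_prod_off_diag
      (fun b a => ((x a - x b) ^ 2 + ε) ^ (κ / 2))]
  refine Finset.prod_congr rfl fun i _ => Finset.prod_congr rfl fun j _ => ?_
  have h : (0 : ℝ) ≤ (x i - x j) ^ 2 + ε := by positivity
  rw [show (x j - x i) ^ 2 = (x i - x j) ^ 2 by ring, ← sq,
    ← Real.rpow_mul_natCast h, Nat.cast_ofNat, div_mul_cancel₀ κ two_ne_zero]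

/-- The action of a permutation on the coordinates. -/
def permCoord (τ : Equiv.Perm (Fin N)) :
    EuclideanSpace ℝ (Fin N) ≃ₗᵢ[ℝ] EuclideanSpace ℝ (Fin N) :=
  LinearIsometryEquiv.piLpCongrLeft 2 ℝ ℝ τ.symm

theorem permCoord_apply (τ : Equiv.Perm (Fin N)) (x : EuclideanSpace ℝ (Fin N)) (k : Fin N) :
    permCoord τ x k = x (τ k) := rfl

theorem regWeight_permCoord (κ : ℝ) {ε : ℝ} (hε : 0 ≤ ε) (τ : Equiv.Perm (Fin N))
    (x : EuclideanSpace ℝ (Fin N)) : regWeight κ ε (permCoord τ x) = regWeight κ ε x := by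
  rw [regWeight_eq_prod κ hε, regWeight_eq_prod κ hε,
    ← Equiv.prod_comp τ fun a => ∏ b, if a = b then 1 else ((x a - x b) ^ 2 + ε) ^ (κ / 2)]
  refine Finset.prod_congr rfl fun a _ => ?_
  rw [← Equiv.prod_comp τ fun b => if τ a = b then 1 else ((x (τ a) - x b) ^ 2 + ε) ^ (κ / 2)]
  simp only [permCoord_apply, EmbeddingLike.apply_eq_iff_eq]

theorem evalE_permCoord_swap (i j : Fin N) (f : MvPolynomial (Fin N) ℝ)
    (x : EuclideanSpace ℝ (Fin N)) :
    evalE f (permCoord (Equiv.swap i j) x) = evalE (swapVars i j f) x := by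
  rw [evalE, evalE, swapVars, MvPolynomial.eval_rename]
  rfl

/-- The regularized weight times the Gaussian density, up to a constant. -/
def gaussWeight (κ ε : ℝ) (x : EuclideanSpace ℝ (Fin N)) : ℝ :=
  regWeight κ ε x * Real.exp (-(1 / 2) * ‖x‖ ^ 2)

theorem gaussWeight_nonneg (κ : ℝ) {ε : ℝ} (hε : 0 ≤ ε) (x : EuclideanSpace ℝ (Fin N)) :
    0 ≤ gaussWeight κ ε x :=
  mul_nonneg (regWeight_nonneg κ hε x) (Real.exp_pos _).le

theorem measurable_gaussWeight (κ ε : ℝ) : Measurable (gaussWeight (N := N) κ ε) :=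
  (measurable_regWeight κ ε).mul (by fun_prop : Continuous fun x : EuclideanSpace ℝ (Fin N) =>
      Real.exp (-(1 / 2) * ‖x‖ ^ 2)).measurable

theorem gaussWeight_permCoord (κ : ℝ) {ε : ℝ} (hε : 0 ≤ ε) (τ : Equiv.Perm (Fin N))
    (x : EuclideanSpace ℝ (Fin N)) : gaussWeight κ ε (permCoord τ x) = gaussWeight κ ε x := by
  rw [gaussWeight, gaussWeight, regWeight_permCoord κ hε, LinearIsometryEquiv.norm_map]

theorem exists_integrable_bound (hN : N ≠ 0) {κ : ℝ} (hκ : -1 < N * κ)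
    (P : MvPolynomial (Fin N) ℝ) : ∃ B : EuclideanSpace ℝ (Fin N) → ℝ, Integrable B ∧
      ∀ᵐ x, ∀ ε ∈ Set.Icc (0 : ℝ) 1, |evalE P x * gaussWeight κ ε x| ≤ B x := by
  obtain ⟨V, hV, hle⟩ := exists_dominating hN hκ
  refine ⟨_, ((IsSubGaussian.evalE P).integrable_mul (continuous_evalE P).measurable hV
    (half_pos one_pos)).norm, ?_⟩
  filter_upwards [hle] with x hx ε hε
  rw [abs_mul, norm_mul, Real.norm_eq_abs, Real.norm_eq_abs, gaussWeight, abs_mul, abs_mul,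
    abs_of_nonneg (regWeight_nonneg κ hε.1 x)]
  gcongr
  exact (hx ε hε).trans (le_abs_self _)

theorem integrable_evalE_mul_gaussWeight (hN : N ≠ 0) {κ : ℝ} (hκ : -1 < N * κ)
    (P : MvPolynomial (Fin N) ℝ) {ε : ℝ} (hε : ε ∈ Set.Icc (0 : ℝ) 1) :
    Integrable fun x => evalE P x * gaussWeight κ ε x := by
  obtain ⟨B, hB, hle⟩ := exists_integrable_bound hN hκ P
  refine hB.mono' ((continuous_evalE P).measurable.mul
    (measurable_gaussWeight κ ε)).aestronglyMeasurable ?_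
  filter_upwards [hle] with x hx
  exact hx ε hε

theorem hasDerivAt_evalE (P : MvPolynomial (Fin N) ℝ) (i : Fin N)
    (x : EuclideanSpace ℝ (Fin N)) :
    HasDerivAt (fun t : ℝ => evalE P (x + t • EuclideanSpace.single i 1))
      (evalE (MvPolynomial.pderiv i P) x) 0 := by
  induction P using MvPolynomial.induction_on with
  | C a => simpa [evalE] using hasDerivAt_const (0 : ℝ) a
  | add p q hp hq => simpa [evalE] using hp.fun_add hq
  | mul_X p k hp =>
    have hk : HasDerivAt (fun t : ℝ => x k + t * (Pi.single i 1 : Fin N → ℝ) k)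
        ((Pi.single i 1 : Fin N → ℝ) k) 0 := by
      simpa using ((hasDerivAt_id (0 : ℝ)).mul_const ((Pi.single i 1 : Fin N → ℝ) k)).const_add (x k)
    have h := hp.fun_mul hk
    have e : (Pi.single i 1 : Fin N → ℝ) k = MvPolynomial.eval (fun i => x i)
        (MvPolynomial.pderiv i (MvPolynomial.X k : MvPolynomial (Fin N) ℝ)) := by
      rw [MvPolynomial.pderiv_X]
      by_cases hik : i = k
      · subst hik; simp
      · simp [Ne.symm hik]
    have hfun : (fun t : ℝ => evalE (p * MvPolynomial.X k) (x + t • EuclideanSpace.single i 1))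
        = fun t => evalE p (x + t • EuclideanSpace.single i 1)
          * (x k + t * (Pi.single i 1 : Fin N → ℝ) k) := by
      ext t
      rw [evalE, map_mul, MvPolynomial.eval_X]
      rfl
    rw [hfun]
    refine h.congr_deriv ?_
    rw [e]
    simp [evalE]
    ring

theorem hasDerivAt_exp_norm_sq (i : Fin N) (x : EuclideanSpace ℝ (Fin N)) :
    HasDerivAt (fun t : ℝ => Real.exp (-(1 / 2) * ‖x + t • EuclideanSpace.single i (1 : ℝ)‖ ^ 2))
      (-x i * Real.exp (-(1 / 2) * ‖x‖ ^ 2)) 0 := by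
  have h : HasDerivAt (fun t : ℝ => ‖x + t • EuclideanSpace.single i (1 : ℝ)‖ ^ 2) (2 * x i) 0 := by
    have h := (hasStrictFDerivAt_norm_sq x).hasFDerivAt.hasLineDerivAt
      (EuclideanSpace.single i (1 : ℝ))
    simpa [HasLineDerivAt, EuclideanSpace.inner_single_right] using h
  refine (h.const_mul (-(1 / 2))).exp.congr_deriv ?_
  simp
  ring

theorem hasDerivAt_regWeight (κ : ℝ) {ε : ℝ} (hε : 0 < ε) (i : Fin N)
    (x : EuclideanSpace ℝ (Fin N)) :
    HasDerivAt (fun t : ℝ => regWeight κ ε (x + t • EuclideanSpace.single i 1))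
      (2 * κ * (∑ j, (x i - x j) / ((x i - x j) ^ 2 + ε)) * regWeight κ ε x) 0 := by
  have hlog : ∀ y : EuclideanSpace ℝ (Fin N), regWeight κ ε y
      = Real.exp (κ / 2 * ∑ a, ∑ b, if a = b then 0 else Real.log ((y a - y b) ^ 2 + ε)) := by
    intro y
    rw [regWeight_eq_prod κ hε.le, Finset.mul_sum, Real.exp_sum]
    refine Finset.prod_congr rfl fun a _ => ?_
    rw [Finset.mul_sum, Real.exp_sum]
    refine Finset.prod_congr rfl fun b _ => ?_
    split_ifs
    · simp
    · rw [Real.rpow_def_of_pos (by positivity), mul_comm]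
  set e : Fin N → ℝ := Pi.single i 1 with he
  have hterm : ∀ a b : Fin N, HasDerivAt (fun t : ℝ => if a = b then 0 else
      Real.log ((x a + t * e a - (x b + t * e b)) ^ 2 + ε))
      (2 * ((x a - x b) / ((x a - x b) ^ 2 + ε)) * (e a - e b)) 0 := by
    intro a b
    by_cases hab : a = b
    · subst hab
      simpa using hasDerivAt_const (0 : ℝ) (0 : ℝ)
    · simp only [if_neg hab]
      have h1 : HasDerivAt (fun t : ℝ => x a + t * e a - (x b + t * e b)) (e a - e b) 0 := by
        have := (((hasDerivAt_id (0 : ℝ)).mul_const (e a)).const_add (x a)).fun_sub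
          (((hasDerivAt_id (0 : ℝ)).mul_const (e b)).const_add (x b))
        simpa using this
      have h2 := ((h1.fun_pow 2).add_const ε).log (by simp; positivity)
      refine h2.congr_deriv ?_
      simp
      ring
  have hsum := HasDerivAt.fun_sum (u := Finset.univ) fun a _ =>
    HasDerivAt.fun_sum (u := Finset.univ) fun b _ => hterm a b
  have h3 := (hsum.const_mul (κ / 2)).exp
  have hS : ∑ a, ∑ b, 2 * ((x a - x b) / ((x a - x b) ^ 2 + ε)) * (e a - e b)
      = 4 * ∑ j, (x i - x j) / ((x i - x j) ^ 2 + ε) := by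
    have hA : ∑ a, ∑ b, (x a - x b) / ((x a - x b) ^ 2 + ε) * e a
        = ∑ j, (x i - x j) / ((x i - x j) ^ 2 + ε) := by
      rw [Finset.sum_comm]
      refine Finset.sum_congr rfl fun b _ => ?_
      rw [Finset.sum_eq_single i]
      · simp [he]
      · intro a _ ha; simp [he, ha]
      · simp
    have hB : ∑ a, ∑ b, (x a - x b) / ((x a - x b) ^ 2 + ε) * e b
        = -∑ j, (x i - x j) / ((x i - x j) ^ 2 + ε) := by
      rw [← Finset.sum_neg_distrib]
      refine Finset.sum_congr rfl fun a _ => ?_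
      rw [Finset.sum_eq_single i]
      · rw [he, Pi.single_eq_same, mul_one, ← neg_div, neg_sub,
          show (x a - x i) ^ 2 = (x i - x a) ^ 2 by ring]
      · intro a _ ha; simp [he, ha]
      · simp
    simp only [mul_sub, Finset.sum_sub_distrib, mul_assoc, ← Finset.mul_sum]
    rw [hA, hB]
    ring
  rw [hS] at h3
  have hfun : (fun t : ℝ => regWeight κ ε (x + t • EuclideanSpace.single i 1))
      = fun t => Real.exp (κ / 2 * ∑ a, ∑ b, if a = b then 0 else
        Real.log ((x a + t * e a - (x b + t * e b)) ^ 2 + ε)) := by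
    ext t
    rw [hlog]
    rfl
  rw [hfun, hlog x]
  refine h3.congr_deriv ?_
  simp only [zero_mul, add_zero]
  ring

theorem abs_div_sq_add_le {ε : ℝ} (hε : ε ∈ Set.Ioc (0 : ℝ) 1) (t : ℝ) :
    |t / (t ^ 2 + ε)| ≤ ε⁻¹ := by
  have h0 := hε.1
  have h1 := hε.2
  rw [abs_div, abs_of_pos (by positivity : 0 < t ^ 2 + ε), div_le_iff₀ (by positivity), mul_add,
    inv_mul_cancel₀ h0.ne']
  have h2 : (1 : ℝ) ≤ ε⁻¹ := (one_le_inv₀ h0).2 h1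
  have h3 : |t| ^ 2 = t ^ 2 := sq_abs t
  nlinarith [sq_nonneg (|t| - 1), sq_nonneg t]

theorem integral_divergence (hN : N ≠ 0) {κ : ℝ} (hκ : -1 < N * κ) {ε : ℝ}
    (hε : ε ∈ Set.Ioc (0 : ℝ) 1) (F : MvPolynomial (Fin N) ℝ) (i : Fin N) :
    ∫ x, (evalE (MvPolynomial.pderiv i F - MvPolynomial.X i * F) x * gaussWeight κ ε x
      + ∑ j, 2 * κ * ((x i - x j) / ((x i - x j) ^ 2 + ε) * (evalE F x * gaussWeight κ ε x)))
      = 0 := by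
  have hε' : ε ∈ Set.Icc (0 : ℝ) 1 := ⟨hε.1.le, hε.2⟩
  have hd : ∀ x, HasLineDerivAt ℝ (fun x => evalE F x * gaussWeight κ ε x)
      (evalE (MvPolynomial.pderiv i F - MvPolynomial.X i * F) x * gaussWeight κ ε x
      + ∑ j, 2 * κ * ((x i - x j) / ((x i - x j) ^ 2 + ε) * (evalE F x * gaussWeight κ ε x))) x
      (EuclideanSpace.single i 1) := by
    intro x
    have h := (hasDerivAt_evalE F i x).fun_mul
      ((hasDerivAt_regWeight κ hε.1 i x).fun_mul (hasDerivAt_exp_norm_sq i x))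
    refine HasDerivAt.congr_deriv h ?_
    simp only [zero_smul, add_zero]
    rw [← Finset.mul_sum, ← Finset.sum_mul, gaussWeight]
    simp only [evalE, map_sub, map_mul, MvPolynomial.eval_X]
    ring
  have hI1 := integrable_evalE_mul_gaussWeight hN hκ F hε'
  have hI2 : Integrable fun x =>
      (evalE (MvPolynomial.pderiv i F - MvPolynomial.X i * F) x * gaussWeight κ ε x
      + ∑ j, 2 * κ * ((x i - x j) / ((x i - x j) ^ 2 + ε) * (evalE F x * gaussWeight κ ε x))) := by
    refine (integrable_evalE_mul_gaussWeight hN hκ _ hε').add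
      (integrable_finsetSum _ fun j _ => (hI1.bdd_mul (c := ε⁻¹) ?_ ?_).const_mul _)
    · have := (continuous_coord i).sub (continuous_coord j)
      exact (this.measurable.div ((this.measurable.pow_const 2).add_const ε)).aestronglyMeasurable
    · exact .of_forall fun x => abs_div_sq_add_le hε _
  have h := integral_bilinear_hasLineDerivAt_right_eq_neg_left_of_integrable
    (μ := (volume : Measure (EuclideanSpace ℝ (Fin N))))
    (f := fun _ => (1 : ℝ)) (f' := fun _ => 0) (B := ContinuousLinearMap.mul ℝ ℝ)
    (v := EuclideanSpace.single i 1)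
    (g := fun x => evalE F x * gaussWeight κ ε x)
    (g' := fun x => evalE (MvPolynomial.pderiv i F - MvPolynomial.X i * F) x * gaussWeight κ ε x
      + ∑ j, 2 * κ * ((x i - x j) / ((x i - x j) ^ 2 + ε) * (evalE F x * gaussWeight κ ε x)))
    (by simp) (by simpa using hI2) (by simpa using hI1)
    (fun x _ => by simpa [HasLineDerivAt] using hasDerivAt_const (0 : ℝ) (1 : ℝ))
    (fun x _ => hd x)
  simpa using h

theorem integral_comp_permCoord (τ : Equiv.Perm (Fin N)) (f : EuclideanSpace ℝ (Fin N) → ℝ) :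
    ∫ x, f (permCoord τ x) = ∫ x, f x :=
  (permCoord τ).measurePreserving.integral_comp
    (permCoord τ).toHomeomorph.measurableEmbedding f

theorem integral_symmetrize (hN : N ≠ 0) {κ : ℝ} (hκ : -1 < N * κ) {ε : ℝ}
    (hε : ε ∈ Set.Ioc (0 : ℝ) 1) (F : MvPolynomial (Fin N) ℝ) {i j : Fin N} :
    2 * ∫ x : EuclideanSpace ℝ (Fin N),
        (x i - x j) / ((x i - x j) ^ 2 + ε) * (evalE F x * gaussWeight κ ε x)
      = ∫ x : EuclideanSpace ℝ (Fin N), (x i - x j) ^ 2 / ((x i - x j) ^ 2 + ε) *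
        (evalE (divDiffFun i j F) x * gaussWeight κ ε x) := by
  have hε' : ε ∈ Set.Icc (0 : ℝ) 1 := ⟨hε.1.le, hε.2⟩
  have hint : ∀ P : MvPolynomial (Fin N) ℝ, Integrable fun x : EuclideanSpace ℝ (Fin N) =>
      (x i - x j) / ((x i - x j) ^ 2 + ε) * (evalE P x * gaussWeight κ ε x) := by
    intro P
    refine (integrable_evalE_mul_gaussWeight hN hκ P hε').bdd_mul (c := ε⁻¹) ?_ ?_
    · have := (continuous_coord i).sub (continuous_coord j)
      exact (this.measurable.div ((this.measurable.pow_const 2).add_const ε)).aestronglyMeasurable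
    · exact .of_forall fun x => abs_div_sq_add_le hε _
  have h := integral_comp_permCoord (Equiv.swap i j) fun x : EuclideanSpace ℝ (Fin N) =>
    (x i - x j) / ((x i - x j) ^ 2 + ε) * (evalE F x * gaussWeight κ ε x)
  simp only [permCoord_apply, Equiv.swap_apply_left, Equiv.swap_apply_right,
    evalE_permCoord_swap, gaussWeight_permCoord κ hε.1.le] at h
  have h2 : ∫ x : EuclideanSpace ℝ (Fin N),
      (x j - x i) / ((x j - x i) ^ 2 + ε) * (evalE (swapVars i j F) x * gaussWeight κ ε x)
      = -∫ x : EuclideanSpace ℝ (Fin N),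
      (x i - x j) / ((x i - x j) ^ 2 + ε) * (evalE (swapVars i j F) x * gaussWeight κ ε x) := by
    rw [← integral_neg]
    refine integral_congr_ae (.of_forall fun x => ?_)
    simp only
    rw [show (x j - x i) ^ 2 = (x i - x j) ^ 2 by ring, ← neg_sub (x i) (x j), neg_div, neg_mul]
  rw [two_mul]
  nth_rw 2 [← h]
  rw [h2, ← sub_eq_add_neg, ← integral_sub (hint F) (hint _)]
  refine integral_congr_ae (.of_forall fun x => ?_)
  have h3 : evalE F x - evalE (swapVars i j F) x = (x i - x j) * evalE (divDiffFun i j F) x := by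
    have := congrArg (MvPolynomial.eval fun k => x k) (divDiffFun_spec i j F)
    simpa [evalE] using this
  simp only
  rw [← mul_sub, ← sub_mul, h3]
  ring

end IntegrationByParts

end PlanarDunkl

end

noncomputable section

namespace PlanarDunkl

section GaussianFunctional

open MvPolynomial Filter Topology

variable {N : ℕ} {κ : ℝ}

theorem tendsto_gaussWeight (κ : ℝ) {x : EuclideanSpace ℝ (Fin N)}
    (hx : ∀ i j : Fin N, i ≠ j → x i ≠ x j) :
    Tendsto (fun ε => gaussWeight κ ε x) (𝓝 0) (𝓝 (gaussWeight κ 0 x)) := by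
  refine Tendsto.mul_const _ (tendsto_finsetProd _ fun i _ => tendsto_finsetProd _ fun j hj => ?_)
  have h1 : x i - x j ≠ 0 := sub_ne_zero.2 (hx i j (Finset.mem_Ioi.1 hj).ne)
  refine Tendsto.rpow_const (tendsto_const_nhds.add tendsto_id) (Or.inl ?_)
  simpa using h1

/-- The integral of a polynomial against `w_κ(x) e^{-|x|²/2}`. -/
def gaussInt (hN : N ≠ 0) (hκ : -1 < N * κ) : MvPolynomial (Fin N) ℝ →ₗ[ℝ] ℝ where
  toFun F := ∫ x, evalE F x * gaussWeight κ 0 x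
  map_add' F G := by
    rw [← integral_add (integrable_evalE_mul_gaussWeight hN hκ F (by simp))
      (integrable_evalE_mul_gaussWeight hN hκ G (by simp))]
    simp only [evalE, map_add, add_mul]
  map_smul' c F := by
    simp only [evalE, smul_eval, mul_assoc, RingHom.id_apply, smul_eq_mul, integral_const_mul]

theorem gaussInt_apply (hN : N ≠ 0) (hκ : -1 < N * κ) (F : MvPolynomial (Fin N) ℝ) :
    gaussInt hN hκ F = ∫ x, evalE F x * gaussWeight κ 0 x := rfl

theorem tendsto_integral_gaussWeight (hN : N ≠ 0) (hκ : -1 < N * κ)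
    (P : MvPolynomial (Fin N) ℝ) {ε : ℕ → ℝ} (hε : ∀ n, ε n ∈ Set.Icc (0 : ℝ) 1)
    (hε0 : Tendsto ε atTop (𝓝 0)) {m : ℕ → EuclideanSpace ℝ (Fin N) → ℝ}
    (hm : ∀ n, Measurable (m n)) (hm1 : ∀ n x, |m n x| ≤ 1)
    (hmt : ∀ᵐ x, Tendsto (fun n => m n x) atTop (𝓝 1)) :
    Tendsto (fun n => ∫ x, m n x * (evalE P x * gaussWeight κ (ε n) x)) atTop
      (𝓝 (gaussInt hN hκ P)) := by
  obtain ⟨B, hB, hle⟩ := exists_integrable_bound hN hκ P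
  rw [gaussInt_apply]
  refine tendsto_integral_of_dominated_convergence B (fun n => ?_) hB (fun n => ?_) ?_
  · exact ((hm n).mul ((continuous_evalE P).measurable.mul
      (measurable_gaussWeight κ _))).aestronglyMeasurable
  · filter_upwards [hle] with x hx
    rw [norm_mul, Real.norm_eq_abs, Real.norm_eq_abs]
    exact (mul_le_of_le_one_left (abs_nonneg _) (hm1 n x)).trans (hx _ (hε n))
  · filter_upwards [hmt, ae_coord_ne] with x h1 h2
    simpa using h1.mul (((tendsto_gaussWeight κ h2).comp hε0).const_mul (evalE P x))

/-- The transpose of a Dunkl operator with respect to the Gaussian weight, applied to `1`. -/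
theorem gaussInt_dunklT (hN : N ≠ 0) (hκ : -1 < N * κ) (i : Fin N)
    (F : MvPolynomial (Fin N) ℝ) :
    gaussInt hN hκ (dunklT κ i F) = gaussInt hN hκ (X i * F) := by
  let ε : ℕ → ℝ := fun n => 1 / ((n : ℝ) + 1)
  have hε : ∀ n, ε n ∈ Set.Ioc (0 : ℝ) 1 := fun n =>
    ⟨Nat.one_div_pos_of_nat, by
      rw [div_le_one (by positivity)]; linarith [Nat.cast_nonneg (α := ℝ) n]⟩
  have hε' : ∀ n, ε n ∈ Set.Icc (0 : ℝ) 1 := fun n => ⟨(hε n).1.le, (hε n).2⟩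
  have hε0 : Tendsto ε atTop (𝓝 0) := tendsto_one_div_add_atTop_nhds_zero_nat
  have hmeas : ∀ j : Fin N, Measurable fun x : EuclideanSpace ℝ (Fin N) => x i - x j := fun j =>
    ((continuous_coord i).sub (continuous_coord j)).measurable
  have h1 := tendsto_integral_gaussWeight hN hκ (pderiv i F - X i * F) hε' hε0
    (m := fun _ _ => 1) (fun _ => measurable_const) (by simp) (by simp)
  have h2 : ∀ j ∈ ({i}ᶜ : Finset (Fin N)), Tendsto (fun n => ∫ x : EuclideanSpace ℝ (Fin N),
      (x i - x j) ^ 2 / ((x i - x j) ^ 2 + ε n) *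
        (evalE (divDiffFun i j F) x * gaussWeight κ (ε n) x)) atTop
      (𝓝 (gaussInt hN hκ (divDiffFun i j F))) := by
    intro j hj
    have hj : j ≠ i := by simpa using hj
    refine tendsto_integral_gaussWeight hN hκ _ hε' hε0 (fun n => ?_) (fun n x => ?_) ?_
    · exact ((hmeas j).pow_const 2).div (((hmeas j).pow_const 2).add_const _)
    · have := (hε n).1
      rw [abs_of_nonneg (by positivity), div_le_one (by positivity)]
      linarith
    · filter_upwards [ae_coord_ne] with x hx
      have h : (x i - x j) ^ 2 ≠ 0 := pow_ne_zero 2 (sub_ne_zero.2 (hx i j hj.symm))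
      have := Tendsto.div (tendsto_const_nhds (x := (x i - x j) ^ 2))
        ((tendsto_const_nhds (x := (x i - x j) ^ 2)).add hε0) (by simpa using h)
      rw [add_zero, div_self h] at this
      exact this
  have h3 : ∀ n, (∫ x, 1 * (evalE (pderiv i F - X i * F) x * gaussWeight κ (ε n) x))
      + κ * ∑ j ∈ {i}ᶜ, ∫ x : EuclideanSpace ℝ (Fin N), (x i - x j) ^ 2 /
        ((x i - x j) ^ 2 + ε n) * (evalE (divDiffFun i j F) x * gaussWeight κ (ε n) x) = 0 := by
    intro n
    have hint : ∀ j, Integrable fun x : EuclideanSpace ℝ (Fin N) =>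
        2 * κ * ((x i - x j) / ((x i - x j) ^ 2 + ε n) * (evalE F x * gaussWeight κ (ε n) x)) := by
      intro j
      refine ((integrable_evalE_mul_gaussWeight hN hκ F (hε' n)).bdd_mul (c := (ε n)⁻¹)
        ((hmeas j).div (((hmeas j).pow_const 2).add_const _)).aestronglyMeasurable ?_).const_mul _
      exact .of_forall fun x => abs_div_sq_add_le (hε n) _
    have h := integral_divergence hN hκ (hε n) F i
    rw [integral_add (integrable_evalE_mul_gaussWeight hN hκ _ (hε' n))
      (integrable_finsetSum _ fun j _ => hint j), integral_finsetSum _ fun j _ => hint j,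
      ← Finset.sum_compl_add_sum {i}, Finset.sum_singleton] at h
    simp only [one_mul]
    rw [← h]
    congr 1
    simp only [sub_self, zero_div, zero_mul, mul_zero, integral_zero, add_zero]
    rw [Finset.mul_sum]
    refine Finset.sum_congr rfl fun j _ => ?_
    rw [← integral_symmetrize hN hκ (hε n) F, integral_const_mul]
    ring
  have h4 := h1.add ((tendsto_finsetSum _ h2).const_mul κ)
  simp only [h3] at h4
  have h5 := tendsto_nhds_unique h4 tendsto_const_nhds
  rw [dunklT_apply, map_add, map_smul, map_sum, smul_eq_mul]
  rw [map_sub] at h5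
  linarith

theorem gaussInt_swapVars (hN : N ≠ 0) (hκ : -1 < N * κ) (i j : Fin N)
    (F : MvPolynomial (Fin N) ℝ) :
    gaussInt hN hκ (swapVars i j F) = gaussInt hN hκ F := by
  rw [gaussInt_apply, gaussInt_apply,
    ← integral_comp_permCoord (Equiv.swap i j) fun x => evalE F x * gaussWeight κ 0 x]
  simp only [evalE_permCoord_swap, gaussWeight_permCoord κ le_rfl]

theorem gaussInt_X_mul_mul (hN : N ≠ 0) (hκ : -1 < N * κ) (i : Fin N)
    (f g : MvPolynomial (Fin N) ℝ) :
    gaussInt hN hκ (X i * f * g)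
      = gaussInt hN hκ (f * dunklT κ i g) + gaussInt hN hκ (dunklT κ i f * g) := by
  have h : ∀ j ∈ ({i}ᶜ : Finset (Fin N)),
      gaussInt hN hκ ((X i - X j) * (divDiffFun i j f * divDiffFun i j g)) = 0 := by
    intro j hj
    have hj : i ≠ j := by simpa [eq_comm] using hj
    have h1 := gaussInt_swapVars hN hκ i j ((X i - X j) * (divDiffFun i j f * divDiffFun i j g))
    rw [map_mul (swapVars i j), map_mul (swapVars i j), swapVars_divDiffFun hj,
      swapVars_divDiffFun hj, map_sub (swapVars i j),
      swapVars_X_left, swapVars_X_right, ← neg_sub, neg_mul, map_neg] at h1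
    linarith
  rw [mul_assoc, ← gaussInt_dunklT, dunklT_mul, map_sub, map_add, map_smul, map_sum,
    Finset.sum_eq_zero h, smul_zero, sub_zero, add_comm]

theorem gaussInt_of_isHarmonic (hN : N ≠ 0) (hκ : -1 < N * κ) {n : ℕ} (hn : n ≠ 0)
    {h : MvPolynomial (Fin N) ℝ} (hh : h.IsHomogeneous n) (hharm : IsHarmonic κ h) :
    gaussInt hN hκ h = 0 := by
  have h1 := congrArg (gaussInt hN hκ) (sum_X_mul_dunklT κ hh)
  have h2 : gaussInt hN hκ (∑ i, X i * dunklT κ i h) = 0 := by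
    rw [map_sum]
    simp only [← gaussInt_dunklT]
    rw [← map_sum, hharm, map_zero]
  have h3 : gaussInt hN hκ (∑ i, ∑ j ∈ {i}ᶜ, (h - swapVars i j h)) = 0 := by
    rw [map_sum]
    refine Finset.sum_eq_zero fun i _ => ?_
    rw [map_sum]
    refine Finset.sum_eq_zero fun j _ => ?_
    rw [map_sub, gaussInt_swapVars, sub_self]
  rw [map_nsmul, h2, map_add, map_nsmul, map_smul, h3, smul_zero, smul_zero, add_zero] at h1
  have h4 := h1.symm
  rw [nsmul_eq_mul, mul_eq_zero] at h4
  refine h4.resolve_left ?_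
  exact_mod_cast mul_ne_zero two_ne_zero hn

theorem dunklT_of_isHomogeneous_zero (i : Fin N) {f : MvPolynomial (Fin N) ℝ}
    (hf : f.IsHomogeneous 0) : dunklT κ i f = 0 := by
  rw [← totalDegree_zero_iff_isHomogeneous, totalDegree_eq_zero_iff_eq_C] at hf
  rw [hf, dunklT_C]

/-- Harmonic polynomials are orthogonal to polynomials of lower degree. -/
theorem gaussInt_mul_eq_zero (hN : N ≠ 0) (hκ : -1 < N * κ) (k : ℕ) :
    ∀ {q : MvPolynomial (Fin N) ℝ}, q.IsHomogeneous k → ∀ {n : ℕ}, k < n →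
      ∀ {h : MvPolynomial (Fin N) ℝ}, h.IsHomogeneous n → IsHarmonic κ h →
        gaussInt hN hκ (q * h) = 0 := by
  induction k using Nat.strong_induction_on with
  | _ k ih =>
    intro q hq n hkn h hh hharm
    refine isHomogeneous_induction (p := fun m f => m = k → gaussInt hN hκ (f * h) = 0)
      ?_ ?_ ?_ ?_ hq rfl
    · intro a _
      rw [C_mul', map_smul, gaussInt_of_isHarmonic hN hκ (by omega) hh hharm, smul_zero]
    · intro m _
      rw [zero_mul, map_zero]
    · intro m f g hf hg hm
      rw [add_mul, map_add, hf hm, hg hm, add_zero]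
    · intro m i f hf _ hm
      obtain ⟨n, rfl⟩ : ∃ n', n = n' + 1 := ⟨n - 1, by omega⟩
      rw [gaussInt_X_mul_mul, ih m (by omega) hf (by omega) (dunklT_isHomogeneous κ i hh)
        (hharm.dunklT i), zero_add]
      cases m with
      | zero => rw [dunklT_of_isHomogeneous_zero i hf, zero_mul, map_zero]
      | succ m => exact ih m (by omega) (dunklT_isHomogeneous κ i hf) (by omega) hh hharm

/-- On harmonic polynomials the pairing is given by integration against the Gaussian weight. -/
theorem gaussInt_mul_eq_pairing (hN : N ≠ 0) (hκ : -1 < N * κ) {n : ℕ}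
    {f : MvPolynomial (Fin N) ℝ} (hf : f.IsHomogeneous n) {h : MvPolynomial (Fin N) ℝ}
    (hh : h.IsHomogeneous n) (hharm : IsHarmonic κ h) :
    gaussInt hN hκ (f * h) = gaussInt hN hκ 1 * pairing κ f h := by
  refine isHomogeneous_induction (p := fun n f => ∀ h : MvPolynomial (Fin N) ℝ,
    h.IsHomogeneous n → IsHarmonic κ h →
      gaussInt hN hκ (f * h) = gaussInt hN hκ 1 * pairing κ f h) ?_ ?_ ?_ ?_ hf h hh hharm
  · intro a h hh _
    rw [← totalDegree_zero_iff_isHomogeneous, totalDegree_eq_zero_iff_eq_C] at hh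
    rw [hh, pairing, polyOfT_C, ← C_mul, ← mul_one (C _), C_mul', map_smul, smul_eq_mul,
      smul_eval, eval_C]
    ring
  · intro n h _ _
    simp [pairing]
  · intro n f g hf hg h hh hharm
    rw [add_mul, map_add, hf h hh hharm, hg h hh hharm, pairing, pairing, pairing, map_add,
      LinearMap.add_apply, map_add, mul_add]
  · intro n i f hf ih h hh hharm
    rw [gaussInt_X_mul_mul, ih _ (dunklT_isHomogeneous κ i hh) (hharm.dunklT i)]
    have h0 : gaussInt hN hκ (dunklT κ i f * h) = 0 := by
      cases n with
      | zero => rw [dunklT_of_isHomogeneous_zero i hf, zero_mul, map_zero]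
      | succ n => exact gaussInt_mul_eq_zero hN hκ n (dunklT_isHomogeneous κ i hf) (by omega) hh hharm
    rw [h0, add_zero, pairing, pairing, mul_comm (X i), polyOfT_mul, polyOfT_X,
      Module.End.mul_apply]

theorem gaussInt_one_pos (hN : N ≠ 0) (hκ : -1 < N * κ) : 0 < gaussInt hN hκ 1 := by
  have hint := integrable_evalE_mul_gaussWeight hN hκ 1 (ε := 0) (by simp)
  rw [gaussInt_apply, integral_pos_iff_support_of_nonneg (fun x => ?_) hint]
  · have h : (Function.support fun x : EuclideanSpace ℝ (Fin N) => evalE 1 x * gaussWeight κ 0 x)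
        =ᵐ[volume] Set.univ := by
      rw [eventuallyEq_univ]
      filter_upwards [ae_coord_ne] with x hx
      have : 0 < gaussWeight κ 0 x := by
        refine mul_pos (Finset.prod_pos fun i _ => Finset.prod_pos fun j hj => ?_) (Real.exp_pos _)
        have h1 : x i - x j ≠ 0 := sub_ne_zero.2 (hx i j (Finset.mem_Ioi.1 hj).ne)
        exact Real.rpow_pos_of_pos (by positivity) _
      simpa [evalE] using this.ne'
    rw [measure_congr h]
    exact NeZero.pos _
  · simpa [evalE] using gaussWeight_nonneg κ le_rfl x

end GaussianFunctional

end PlanarDunkl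

end

noncomputable section

namespace PlanarDunkl

section GaussianMeasure

variable {N : ℕ} {κ : ℝ}

theorem measurable_gaussDensity : Measurable fun x : EuclideanSpace ℝ (Fin N) =>
    ENNReal.ofReal ((2 * Real.pi) ^ (-(N : ℝ) / 2) * Real.exp (-‖x‖ ^ 2 / 2)) := by
  fun_prop

theorem gaussDensity_smul (F : MvPolynomial (Fin N) ℝ) (x : EuclideanSpace ℝ (Fin N)) :
    (ENNReal.ofReal ((2 * Real.pi) ^ (-(N : ℝ) / 2) * Real.exp (-‖x‖ ^ 2 / 2))).toReal •
      (evalE F x * weight κ x)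
      = (2 * Real.pi) ^ (-(N : ℝ) / 2) * (evalE F x * gaussWeight κ 0 x) := by
  rw [ENNReal.toReal_ofReal (by positivity), smul_eq_mul, gaussWeight, regWeight_zero,
    show -‖x‖ ^ 2 / 2 = -(1 / 2) * ‖x‖ ^ 2 by ring]
  ring

theorem integrable_gaussMeasure (hN : N ≠ 0) (hκ : -1 < N * κ) (F : MvPolynomial (Fin N) ℝ) :
    Integrable (fun x => evalE F x * weight κ x) (gaussMeasure N) := by
  rw [gaussMeasure, integrable_withDensity_iff_integrable_smul' measurable_gaussDensity
    (.of_forall fun _ => ENNReal.ofReal_lt_top)]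
  simp only [gaussDensity_smul]
  exact (integrable_evalE_mul_gaussWeight hN hκ F (by simp)).const_mul _

theorem integral_gaussMeasure (hN : N ≠ 0) (hκ : -1 < N * κ) (F : MvPolynomial (Fin N) ℝ) :
    ∫ x, evalE F x * weight κ x ∂gaussMeasure N
      = (2 * Real.pi) ^ (-(N : ℝ) / 2) * gaussInt hN hκ F := by
  rw [gaussMeasure, integral_withDensity_eq_integral_toReal_smul measurable_gaussDensity
    (.of_forall fun _ => ENNReal.ofReal_lt_top)]
  simp only [gaussDensity_smul]
  rw [integral_const_mul, gaussInt_apply]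

theorem evalE_one (x : EuclideanSpace ℝ (Fin N)) : evalE 1 x = 1 := by simp [evalE]

theorem evalE_mul (f g : MvPolynomial (Fin N) ℝ) (x : EuclideanSpace ℝ (Fin N)) :
    evalE (f * g) x = evalE f x * evalE g x := by simp [evalE]

theorem gaussInner_eq (hN : N ≠ 0) (hκ : -1 < N * κ) (f g : MvPolynomial (Fin N) ℝ) :
    gaussInner κ f g = (gaussInt hN hκ 1)⁻¹ * gaussInt hN hκ (f * g) := by
  have h1 := integral_gaussMeasure hN hκ 1
  have h2 := integral_gaussMeasure hN hκ (f * g)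
  simp only [evalE_one, one_mul] at h1
  simp only [evalE_mul] at h2
  have hc : (0 : ℝ) < (2 * Real.pi) ^ (-(N : ℝ) / 2) := by positivity
  rw [gaussInner, h1, h2, mul_inv, mul_mul_mul_comm, inv_mul_cancel₀ hc.ne', one_mul]

end GaussianMeasure

section PolarCoordinates

variable {N : ℕ} {κ : ℝ}

theorem evalE_smul {n : ℕ} {F : MvPolynomial (Fin N) ℝ} (hF : F.IsHomogeneous n) (r : ℝ)
    (x : EuclideanSpace ℝ (Fin N)) : evalE F (r • x) = r ^ n * evalE F x := by
  refine isHomogeneous_induction (p := fun n F => evalE F (r • x) = r ^ n * evalE F x)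
    ?_ ?_ ?_ ?_ hF
  · intro a; simp [evalE]
  · intro n; simp [evalE]
  · intro n f g hf hg
    simp only [evalE, map_add] at hf hg ⊢
    rw [hf, hg, mul_add]
  · intro n i f _ hf
    rw [evalE_mul, evalE_mul, hf]
    simp [evalE]
    ring

theorem weight_smul (κ : ℝ) {r : ℝ} (hr : 0 < r) (x : EuclideanSpace ℝ (Fin N)) :
    weight κ (r • x) = r ^ ((N : ℝ) * (N - 1) * κ) * weight κ x := by
  have h : ∀ i j : Fin N, |(r • x) j - (r • x) i| ^ κ = r ^ κ * |x j - x i| ^ κ := by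
    intro i j
    rw [PiLp.smul_apply, PiLp.smul_apply, smul_eq_mul, smul_eq_mul, ← mul_sub, abs_mul,
      abs_of_pos hr, Real.mul_rpow hr.le (abs_nonneg _)]
  rw [weight_eq_prod_compl, weight_eq_prod_compl]
  simp only [h, Finset.prod_mul_distrib, Finset.prod_const, Finset.card_compl,
    Finset.card_singleton, Fintype.card_fin, Finset.card_univ]
  congr 1
  rw [← Real.rpow_mul_natCast hr.le, ← Real.rpow_mul_natCast hr.le]
  congr 1
  cases N with
  | zero => simp
  | succ N => push_cast; simp; ring

/-- The radial part of the Gaussian weight on polynomials of degree `k`. -/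
def radial (N : ℕ) (κ : ℝ) (k : ℕ) (r : ℝ) : ℝ :=
  r ^ k * r ^ ((N : ℝ) * (N - 1) * κ) * Real.exp (-(1 / 2) * r ^ 2)

theorem radial_pos (k : ℕ) {r : ℝ} (hr : 0 < r) : 0 < radial N κ k r := by
  unfold radial
  positivity

theorem evalE_mul_gaussWeight_smul {k : ℕ} {F : MvPolynomial (Fin N) ℝ}
    (hF : F.IsHomogeneous k) {r : ℝ} (hr : 0 < r) {u : EuclideanSpace ℝ (Fin N)} (hu : ‖u‖ = 1) :
    evalE F (r • u) * gaussWeight κ 0 (r • u) = evalE F u * weight κ u * radial N κ k r := by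
  rw [gaussWeight, regWeight_zero, weight_smul κ hr, evalE_smul hF, norm_smul, hu, mul_one,
    Real.norm_eq_abs, abs_of_pos hr, radial]
  ring

theorem polar_integrable (hN : N ≠ 0) (hκ : -1 < N * κ) {k : ℕ} {F : MvPolynomial (Fin N) ℝ}
    (hF : F.IsHomogeneous k) :
    Integrable (fun u : Metric.sphere (0 : EuclideanSpace ℝ (Fin N)) 1 =>
      evalE F u.1 * weight κ u.1) (volume : Measure (EuclideanSpace ℝ (Fin N))).toSphere ∧
    gaussInt hN hκ F = (∫ u : Metric.sphere (0 : EuclideanSpace ℝ (Fin N)) 1,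
      evalE F u.1 * weight κ u.1 ∂(volume : Measure (EuclideanSpace ℝ (Fin N))).toSphere) *
      ∫ r : Set.Ioi (0 : ℝ), radial N κ k r.1 ∂(Measure.volumeIoiPow (N - 1)) := by
  set μ : Measure (EuclideanSpace ℝ (Fin N)) := volume with hμ
  have : Nontrivial (EuclideanSpace ℝ (Fin N)) := by
    have : NeZero N := ⟨hN⟩
    infer_instance
  have hint := integrable_evalE_mul_gaussWeight hN hκ F (ε := 0) (by simp)
  have hmp := μ.measurePreserving_homeomorphUnitSphereProd
  rw [finrank_euclideanSpace_fin] at hmp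
  have hemb := (homeomorphUnitSphereProd (EuclideanSpace ℝ (Fin N))).measurableEmbedding
  let g : Metric.sphere (0 : EuclideanSpace ℝ (Fin N)) 1 × Set.Ioi (0 : ℝ) → ℝ :=
    fun p => evalE F p.1.1 * weight κ p.1.1 * radial N κ k p.2.1
  have hcomp : (fun x : ({0}ᶜ : Set (EuclideanSpace ℝ (Fin N))) =>
      evalE F x.1 * gaussWeight κ 0 x.1)
      = g ∘ homeomorphUnitSphereProd (EuclideanSpace ℝ (Fin N)) := by
    ext x
    set p := homeomorphUnitSphereProd (EuclideanSpace ℝ (Fin N)) x with hp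
    have hx : x = (homeomorphUnitSphereProd (EuclideanSpace ℝ (Fin N))).symm p := by
      rw [hp, Homeomorph.symm_apply_apply]
    have hx' : x.1 = p.2.1 • p.1.1 := by
      rw [hx, homeomorphUnitSphereProd_symm_apply_coe]
    rw [hx', evalE_mul_gaussWeight_smul hF p.2.2 (by simp)]
    rfl
  have h1 : Integrable g (μ.toSphere.prod (Measure.volumeIoiPow (N - 1))) := by
    rw [← hmp.integrable_comp_emb hemb, ← hcomp]
    have h := hint
    rw [← restrict_compl_singleton (μ := volume) 0, ← IntegrableOn,
      integrableOn_iff_comap_subtypeVal (by measurability)] at h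
    exact h
  constructor
  · have h2 := h1.prod_left_ae
    have hne : (ae (Measure.volumeIoiPow (N - 1))).NeBot := by
      rw [ae_neBot]
      intro h0
      have h3 := Measure.volumeIoiPow_apply_Iio (N - 1) ⟨1, Set.mem_Ioi.2 one_pos⟩
      rw [h0] at h3
      simp at h3
      have : (0 : ℝ) < ((N - 1 : ℕ) : ℝ) + 1 := by positivity
      have := inv_pos.2 this
      linarith
    obtain ⟨r, hr⟩ := h2.exists
    have h4 := hr.mul_const (radial N κ k r.1)⁻¹
    refine h4.congr (.of_forall fun u => ?_)
    simp only [g]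
    rw [mul_inv_cancel_right₀ (radial_pos k r.2).ne']
  · rw [← integral_prod_mul (fun u : Metric.sphere (0 : EuclideanSpace ℝ (Fin N)) 1 =>
      evalE F u.1 * weight κ u.1) (fun r : Set.Ioi (0 : ℝ) => radial N κ k r.1)]
    rw [← hmp.integral_comp hemb g, gaussInt_apply,
      ← restrict_compl_singleton (μ := volume) 0,
      ← integral_subtype_comap (measurableSet_singleton _).compl]
    exact congrArg (fun f => ∫ x, f x ∂_) hcomp

theorem half_dim_pos (hN : N ≠ 0) (hκ : -1 < N * κ) : 0 < (N : ℝ) / 2 * ((N - 1) * κ + 1) := by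
  have h1 : (1 : ℝ) ≤ N := by exact_mod_cast Nat.one_le_iff_ne_zero.2 hN
  have h2 : 0 ≤ (N - 1) * (N * κ + 1) := mul_nonneg (by linarith) (by linarith)
  nlinarith

/-- The Gamma integral that arises in the radial direction. -/
theorem integral_radial (hN : N ≠ 0) (hκ : -1 < N * κ) (n : ℕ) :
    ∫ r : Set.Ioi (0 : ℝ), radial N κ (2 * n) r.1 ∂(Measure.volumeIoiPow (N - 1))
      = (1 / 2 : ℝ) ^ (-((N : ℝ) / 2 * ((N - 1) * κ + 1) + n)) * (1 / 2)
        * Real.Gamma ((N : ℝ) / 2 * ((N - 1) * κ + 1) + n) := by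
  have ha := half_dim_pos hN hκ
  have hN1 : ((N - 1 : ℕ) : ℝ) = N - 1 := by
    rw [Nat.cast_sub (Nat.one_le_iff_ne_zero.2 hN), Nat.cast_one]
  set q : ℝ := (N : ℝ) - 1 + 2 * n + (N : ℝ) * (N - 1) * κ with hq
  have hqa : (q + 1) / 2 = (N : ℝ) / 2 * ((N - 1) * κ + 1) + n := by rw [hq]; ring
  have h := integral_rpow_mul_exp_neg_mul_rpow (p := 2) (q := q) (b := 1 / 2) two_pos
    (by have : (0 : ℝ) ≤ n := Nat.cast_nonneg n
        linarith) (by norm_num)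
  rw [neg_div, hqa] at h
  rw [← h, Measure.volumeIoiPow, integral_withDensity_eq_integral_toReal_smul (by fun_prop)
    (.of_forall fun _ => ENNReal.ofReal_lt_top), integral_subtype_comap measurableSet_Ioi
      (fun r : ℝ => (ENNReal.ofReal (r ^ (N - 1))).toReal • radial N κ (2 * n) r)]
  refine setIntegral_congr_fun measurableSet_Ioi fun r hr => ?_
  have hr : 0 < r := hr
  rw [ENNReal.toReal_ofReal (by positivity), smul_eq_mul, radial, hq, Real.rpow_add hr,
    Real.rpow_add hr, ← hN1, Real.rpow_natCast, Real.rpow_two]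
  have : r ^ (2 * (n : ℝ)) = r ^ (2 * n) := by
    rw [← Real.rpow_natCast]; push_cast; rfl
  rw [this]
  ring

theorem integral_radial_ratio (hN : N ≠ 0) (hκ : -1 < N * κ) (n : ℕ) :
    ∫ r : Set.Ioi (0 : ℝ), radial N κ (2 * n) r.1 ∂(Measure.volumeIoiPow (N - 1))
      = 2 ^ n * poch ((N : ℝ) / 2 * ((N - 1) * κ + 1)) n *
        ∫ r : Set.Ioi (0 : ℝ), radial N κ 0 r.1 ∂(Measure.volumeIoiPow (N - 1)) := by
  have h0 := integral_radial hN hκ 0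
  rw [mul_zero, Nat.cast_zero, add_zero] at h0
  rw [integral_radial hN hκ, h0]
  have ha := half_dim_pos hN hκ
  set a := (N : ℝ) / 2 * ((N - 1) * κ + 1)
  have hG : Real.Gamma (a + n) = poch a n * Real.Gamma a := by
    induction n with
    | zero => simp [poch_zero]
    | succ n ih =>
      rw [Nat.cast_succ, ← add_assoc, Real.Gamma_add_one (by positivity), ih, poch_succ]
      ring
  have hp : (1 / 2 : ℝ) ^ (-(a + n)) = 2 ^ n * (1 / 2) ^ (-a) := by
    rw [neg_add, Real.rpow_add (by norm_num), mul_comm, Real.rpow_neg (by norm_num),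
      Real.rpow_natCast, one_div, inv_pow, inv_inv]
  rw [hG, hp]
  ring

theorem toSphere_univ_ne (hN : N ≠ 0) :
    (volume : Measure (EuclideanSpace ℝ (Fin N))).toSphere Set.univ ≠ 0 := by
  have : NeZero N := ⟨hN⟩
  rw [Ne, Measure.measure_univ_eq_zero]
  exact Measure.toSphere_ne_zero _

theorem integrable_sphereMeasure (hN : N ≠ 0) (hκ : -1 < N * κ) {k : ℕ}
    {F : MvPolynomial (Fin N) ℝ} (hF : F.IsHomogeneous k) :
    Integrable (fun u : Metric.sphere (0 : EuclideanSpace ℝ (Fin N)) 1 =>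
      evalE F u.1 * weight κ u.1) (sphereMeasure N) :=
  (polar_integrable hN hκ hF).1.smul_measure (ENNReal.inv_ne_top.2 (toSphere_univ_ne hN))

/-- The Gaussian and the spherical inner product of homogeneous polynomials are proportional. -/
theorem gaussInner_eq_sphereInner (hN : N ≠ 0) (hκ : -1 < N * κ) {n : ℕ}
    {f g : MvPolynomial (Fin N) ℝ} (hf : f.IsHomogeneous n) (hg : g.IsHomogeneous n) :
    gaussInner κ f g
      = 2 ^ n * poch ((N : ℝ) / 2 * ((N - 1) * κ + 1)) n * sphereInner κ f g := by
  have hfg : (f * g).IsHomogeneous (2 * n) := by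
    rw [two_mul]; exact hf.mul hg
  have h1 := (polar_integrable hN hκ (MvPolynomial.isHomogeneous_one (Fin N) ℝ)).2
  have h2 := (polar_integrable hN hκ hfg).2
  rw [integral_radial_ratio hN hκ] at h2
  simp only [evalE_one, one_mul] at h1
  simp only [evalE_mul] at h2
  have hpos := gaussInt_one_pos hN hκ
  rw [gaussInner_eq hN hκ, sphereInner, sphereMeasure, integral_smul_measure,
    integral_smul_measure, smul_eq_mul, smul_eq_mul]
  have hc : ((volume : Measure (EuclideanSpace ℝ (Fin N))).toSphere Set.univ)⁻¹.toReal ≠ 0 :=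
    ENNReal.toReal_ne_zero.2 ⟨ENNReal.inv_ne_zero.2 (measure_ne_top _ _),
      ENNReal.inv_ne_top.2 (toSphere_univ_ne hN)⟩
  set c := ((volume : Measure (EuclideanSpace ℝ (Fin N))).toSphere Set.univ)⁻¹.toReal
  set A := ∫ u : Metric.sphere (0 : EuclideanSpace ℝ (Fin N)) 1, weight κ u.1
    ∂(volume : Measure (EuclideanSpace ℝ (Fin N))).toSphere
  set R := ∫ r : Set.Ioi (0 : ℝ), radial N κ 0 r.1 ∂(Measure.volumeIoiPow (N - 1))
  rw [h1] at hpos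
  have hA : A ≠ 0 := by rintro h; rw [h, zero_mul] at hpos; exact hpos.false
  have hR : R ≠ 0 := by rintro h; rw [h, mul_zero] at hpos; exact hpos.false
  rw [h1, h2]
  field_simp

theorem gaussInner_eq_pairing (hN : N ≠ 0) (hκ : -1 < N * κ) {n : ℕ}
    {f h : MvPolynomial (Fin N) ℝ} (hf : f.IsHomogeneous n) (hh : h.IsHomogeneous n)
    (hharm : IsHarmonic κ h) : gaussInner κ f h = pairing κ f h := by
  rw [gaussInner_eq hN hκ, gaussInt_mul_eq_pairing hN hκ hf hh hharm, ← mul_assoc,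
    inv_mul_cancel₀ (gaussInt_one_pos hN hκ).ne', one_mul]

end PolarCoordinates

end PlanarDunkl

end

noncomputable section

namespace PlanarDunkl

section Norms

open MvPolynomial

variable {N : ℕ} (hN : 2 ≤ N) {κ : ℝ}

theorem eq_and_eq_of_two_pow_mul {n : ℕ} {x y a b : ℝ}
    (h : (x : ℂ) + y * Complex.I = 2 ^ n * (a + b * Complex.I)) :
    x = 2 ^ n * a ∧ y = 2 ^ n * b := by
  have h' : (⟨x, y⟩ : ℂ) = ⟨2 ^ n * a, 2 ^ n * b⟩ := by
    rw [Complex.mk_eq_add_mul_I, Complex.mk_eq_add_mul_I, h]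
    push_cast
    ring
  exact ⟨congrArg Complex.re h', congrArg Complex.im h'⟩

theorem pairing_self_of_evalPoint_real {n : ℕ} {h : MvPolynomial (Fin N) ℝ}
    (hh : h.IsHomogeneous n) (hp : IsPlanar hN κ h) (hharm : IsHarmonic κ h) {s K : ℝ}
    (hs : evalPoint hN h = (s : ℂ)) (hK : (Tsum hN κ ^ n) h = C K) :
    pairing κ h h = 2⁻¹ ^ n * s * K ∧ ∀ x : Fin N → ℝ, ((pairing κ h h : ℝ) : ℂ)
      = (2 : ℂ)⁻¹ ^ n * evalPoint hN h * ((eval x ((Tsum hN κ ^ n) h) : ℝ) : ℂ) := by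
  obtain ⟨a, b, h1, h2⟩ := exists_pairing_eq hN hh hp hharm
  have key : pairing κ h h = 2⁻¹ ^ n * s * K := by
    rw [hs] at h1
    obtain ⟨hre, him⟩ := eq_and_eq_of_two_pow_mul (x := s) (y := 0) (by rw [← h1]; simp)
    have hb : b = 0 := by
      have h2n : (2 : ℝ) ^ n ≠ 0 := by positivity
      exact (mul_eq_zero.1 him.symm).resolve_left h2n
    rw [h2, hb, zero_mul, add_zero, hK, eval_C, hre, ← mul_assoc, ← mul_pow,
      inv_mul_cancel₀ two_ne_zero, one_pow, one_mul]
  refine ⟨key, fun x => ?_⟩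
  rw [key, hs, hK, eval_C]
  push_cast
  ring

theorem pairing_self_of_evalPoint_imag {n : ℕ} {h : MvPolynomial (Fin N) ℝ}
    (hh : h.IsHomogeneous n) (hp : IsPlanar hN κ h) (hharm : IsHarmonic κ h) {s K : ℝ}
    (hs : evalPoint hN h = 2 * Complex.I * (s : ℂ))
    (hK : (Tsum hN κ ^ (n - 1)) (Tdiff hN κ h) = C K) :
    pairing κ h h = 2⁻¹ ^ n * (2 * s) * K ∧ ∀ x : Fin N → ℝ, ((pairing κ h h : ℝ) : ℂ)
      = -Complex.I * (2 : ℂ)⁻¹ ^ n * evalPoint hN h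
        * ((eval x ((Tsum hN κ ^ (n - 1)) (Tdiff hN κ h)) : ℝ) : ℂ) := by
  obtain ⟨a, b, h1, h2⟩ := exists_pairing_eq hN hh hp hharm
  have key : pairing κ h h = 2⁻¹ ^ n * (2 * s) * K := by
    rw [hs] at h1
    obtain ⟨hre, him⟩ := eq_and_eq_of_two_pow_mul (x := 0) (y := 2 * s)
      (by rw [← h1]; push_cast; ring)
    have ha : a = 0 := by
      have h2n : (2 : ℝ) ^ n ≠ 0 := by positivity
      exact (mul_eq_zero.1 hre.symm).resolve_left h2n
    rw [h2, ha, zero_mul, zero_add, hK, eval_C, him, ← mul_assoc, ← mul_pow,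
      inv_mul_cancel₀ two_ne_zero, one_pow, one_mul]
  refine ⟨key, fun x => ?_⟩
  rw [key, hs, hK, eval_C]
  push_cast
  linear_combination (2 * (2 : ℂ)⁻¹ ^ n * s * K) * Complex.I_sq

theorem evalPoint_sum_smul_eq {ι : Type*} (t : Finset ι) (c : ι → ℝ)
    (f : ι → MvPolynomial (Fin N) ℝ) (u : ℂ) (s : ι → ℝ)
    (hf : ∀ j ∈ t, evalPoint hN (f j) = u * (s j : ℂ)) :
    evalPoint hN (∑ j ∈ t, c j • f j) = u * ((∑ j ∈ t, c j * s j : ℝ) : ℂ) := by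
  have h : evalPoint hN (∑ j ∈ t, c j • f j) = ∑ j ∈ t, (c j : ℂ) * evalPoint hN (f j) := by
    rw [evalPoint, map_sum]
    exact Finset.sum_congr rfl fun j _ => by rw [map_smul]; exact Complex.real_smul
  rw [h, Complex.ofReal_sum, Finset.mul_sum]
  refine Finset.sum_congr rfl fun j hj => ?_
  rw [hf j hj]
  push_cast
  ring

variable (κ)

theorem evalPoint_hPlus_even (m : ℕ) : evalPoint hN (hPlus hN κ (2 * m))
    = ((∑ j ∈ Finset.range (m + 1), (2 : ℝ)⁻¹ ^ j * (gO j (N * κ - κ + m)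
      / poch (N * κ + m + 1) j) * sConst (2 * m) (m - j) κ 1 : ℝ) : ℂ) := by
  rw [hPlus_even, evalPoint_sum_smul_eq hN _ _ _ 1 (fun j => sConst (2 * m) (m - j) κ 1), one_mul]
  intro j hj
  have hj := Finset.mem_range.1 hj
  rw [one_mul, ← evalPoint_phi hN κ (by omega), show 2 * m - 2 * (m - j) = 2 * j by omega]

theorem evalPoint_hPlus_odd (m : ℕ) : evalPoint hN (hPlus hN κ (2 * m + 1))
    = ((∑ j ∈ Finset.range (m + 1), (2 : ℝ)⁻¹ ^ j * (gE j (N * κ - κ + m + 1)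
      / poch (N * κ + m + 2) j) * sConst (2 * m + 1) (m - j) κ 1 : ℝ) : ℂ) := by
  rw [hPlus_odd, evalPoint_sum_smul_eq hN _ _ _ 1 (fun j => sConst (2 * m + 1) (m - j) κ 1),
    one_mul]
  intro j hj
  have hj := Finset.mem_range.1 hj
  rw [one_mul, ← evalPoint_phi hN κ (by omega),
    show 2 * m + 1 - 2 * (m - j) = 2 * j + 1 by omega]

theorem evalPoint_hMinus_even (m : ℕ) : evalPoint hN (hMinus hN κ (2 * m))
    = 2 * Complex.I * ((∑ j ∈ Finset.range m, (2 : ℝ)⁻¹ ^ j * (gE j (N * κ - κ + m)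
      / poch (N * κ + m + 2) j) * sConst (2 * m - 1) (m - 1 - j) κ 2 : ℝ) : ℂ) := by
  rw [hMinus_even, evalPoint_sum_smul_eq hN _ _ _ (2 * Complex.I)
    (fun j => sConst (2 * m - 1) (m - 1 - j) κ 2)]
  intro j hj
  have hj := Finset.mem_range.1 hj
  rw [← evalPoint_psi hN κ (by omega), show 2 * m - 1 + 1 = 2 * m by omega,
    show 2 * m - 1 - 2 * (m - 1 - j) = 2 * j + 1 by omega]

theorem evalPoint_hMinus_odd (m : ℕ) : evalPoint hN (hMinus hN κ (2 * m + 1))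
    = 2 * Complex.I * ((∑ j ∈ Finset.range (m + 1), (2 : ℝ)⁻¹ ^ j * (gO j (N * κ - κ + m)
      / poch (N * κ + m + 2) j) * sConst (2 * m) (m - j) κ 2 : ℝ) : ℂ) := by
  rw [hMinus_odd, evalPoint_sum_smul_eq hN _ _ _ (2 * Complex.I)
    (fun j => sConst (2 * m) (m - j) κ 2)]
  intro j hj
  have hj := Finset.mem_range.1 hj
  rw [← evalPoint_psi hN κ (by omega), show 2 * m - 2 * (m - j) = 2 * j by omega]

end Norms

end PlanarDunkl

end

theorem mainTheorem3 (N : ℕ) (hN : 2 ≤ N) (κ : ℝ) (hκ : -1 / (N : ℝ) < κ) :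
    -- `h_{2m}^+`
    (∀ m : ℕ,
      (∀ x : Fin N → ℝ,
        ((PlanarDunkl.pairing κ (PlanarDunkl.hPlus hN κ (2 * m))
            (PlanarDunkl.hPlus hN κ (2 * m)) : ℝ) : ℂ)
          = (2 : ℂ)⁻¹ ^ (2 * m) * PlanarDunkl.evalPoint hN (PlanarDunkl.hPlus hN κ (2 * m))
            * ((MvPolynomial.eval x ((PlanarDunkl.Tsum hN κ ^ (2 * m))
                (PlanarDunkl.hPlus hN κ (2 * m))) : ℝ) : ℂ)) ∧
      PlanarDunkl.pairing κ (PlanarDunkl.hPlus hN κ (2 * m)) (PlanarDunkl.hPlus hN κ (2 * m))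
        = (2 : ℝ)⁻¹ ^ m
          * (∑ j ∈ Finset.range (m + 1), (2 : ℝ)⁻¹ ^ j
              * (PlanarDunkl.gO j (N * κ - κ + m) / PlanarDunkl.poch (N * κ + m + 1) j)
              * PlanarDunkl.sConst (2 * m) (m - j) κ 1)
          * PlanarDunkl.poch (N * κ - κ + 1) m * PlanarDunkl.poch (N * κ + 1) m) ∧
    -- `h_{2m+1}^+`
    (∀ m : ℕ,
      (∀ x : Fin N → ℝ,
        ((PlanarDunkl.pairing κ (PlanarDunkl.hPlus hN κ (2 * m + 1))
            (PlanarDunkl.hPlus hN κ (2 * m + 1)) : ℝ) : ℂ)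
          = (2 : ℂ)⁻¹ ^ (2 * m + 1)
            * PlanarDunkl.evalPoint hN (PlanarDunkl.hPlus hN κ (2 * m + 1))
            * ((MvPolynomial.eval x ((PlanarDunkl.Tsum hN κ ^ (2 * m + 1))
                (PlanarDunkl.hPlus hN κ (2 * m + 1))) : ℝ) : ℂ)) ∧
      PlanarDunkl.pairing κ (PlanarDunkl.hPlus hN κ (2 * m + 1))
          (PlanarDunkl.hPlus hN κ (2 * m + 1))
        = (2 : ℝ)⁻¹ ^ m
          * (∑ j ∈ Finset.range (m + 1), (2 : ℝ)⁻¹ ^ j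
              * (PlanarDunkl.gE j (N * κ - κ + m + 1) / PlanarDunkl.poch (N * κ + m + 2) j)
              * PlanarDunkl.sConst (2 * m + 1) (m - j) κ 1)
          * PlanarDunkl.poch (N * κ - κ + 1) m * PlanarDunkl.poch (N * κ + 1) (m + 1)) ∧
    -- `h_{2m}^-`, where `m ≥ 1`
    (∀ m : ℕ, 1 ≤ m →
      (∀ x : Fin N → ℝ,
        ((PlanarDunkl.pairing κ (PlanarDunkl.hMinus hN κ (2 * m))
            (PlanarDunkl.hMinus hN κ (2 * m)) : ℝ) : ℂ)
          = -Complex.I * (2 : ℂ)⁻¹ ^ (2 * m)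
            * PlanarDunkl.evalPoint hN (PlanarDunkl.hMinus hN κ (2 * m))
            * ((MvPolynomial.eval x ((PlanarDunkl.Tsum hN κ ^ (2 * m - 1))
                (PlanarDunkl.Tdiff hN κ (PlanarDunkl.hMinus hN κ (2 * m)))) : ℝ) : ℂ)) ∧
      PlanarDunkl.pairing κ (PlanarDunkl.hMinus hN κ (2 * m)) (PlanarDunkl.hMinus hN κ (2 * m))
        = 4 * (2 : ℝ)⁻¹ ^ m
          * (∑ j ∈ Finset.range m, (2 : ℝ)⁻¹ ^ j
              * (PlanarDunkl.gE j (N * κ - κ + m) / PlanarDunkl.poch (N * κ + m + 2) j)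
              * PlanarDunkl.sConst (2 * m - 1) (m - 1 - j) κ 2)
          * PlanarDunkl.poch (N * κ - κ + 1) (m - 1) * PlanarDunkl.poch (N * κ + 1) (m + 1)) ∧
    -- `h_{2m+1}^-`
    (∀ m : ℕ,
      (∀ x : Fin N → ℝ,
        ((PlanarDunkl.pairing κ (PlanarDunkl.hMinus hN κ (2 * m + 1))
            (PlanarDunkl.hMinus hN κ (2 * m + 1)) : ℝ) : ℂ)
          = -Complex.I * (2 : ℂ)⁻¹ ^ (2 * m + 1)
            * PlanarDunkl.evalPoint hN (PlanarDunkl.hMinus hN κ (2 * m + 1))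
            * ((MvPolynomial.eval x ((PlanarDunkl.Tsum hN κ ^ (2 * m))
                (PlanarDunkl.Tdiff hN κ (PlanarDunkl.hMinus hN κ (2 * m + 1)))) : ℝ) : ℂ)) ∧
      PlanarDunkl.pairing κ (PlanarDunkl.hMinus hN κ (2 * m + 1))
          (PlanarDunkl.hMinus hN κ (2 * m + 1))
        = 2 * (2 : ℝ)⁻¹ ^ m
          * (∑ j ∈ Finset.range (m + 1), (2 : ℝ)⁻¹ ^ j
              * (PlanarDunkl.gO j (N * κ - κ + m) / PlanarDunkl.poch (N * κ + m + 2) j)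
              * PlanarDunkl.sConst (2 * m) (m - j) κ 2)
          * PlanarDunkl.poch (N * κ - κ + 1) m * PlanarDunkl.poch (N * κ + 1) (m + 1)) ∧
    -- the weight is integrable, so that both normalizing constants make sense
    MeasureTheory.Integrable (PlanarDunkl.weight κ) (PlanarDunkl.gaussMeasure N) ∧
    MeasureTheory.Integrable
      (fun x : Metric.sphere (0 : EuclideanSpace ℝ (Fin N)) 1 => PlanarDunkl.weight κ x.1)
      (PlanarDunkl.sphereMeasure N) ∧
    -- the Gaussian and sphere norms of `h = h_n^+` and `h = h_n^-`
    (∀ (n : ℕ) (h : MvPolynomial (Fin N) ℝ),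
      (h = PlanarDunkl.hPlus hN κ n ∨ h = PlanarDunkl.hMinus hN κ n) →
        MeasureTheory.Integrable
          (fun x => PlanarDunkl.evalE h x * PlanarDunkl.evalE h x * PlanarDunkl.weight κ x)
          (PlanarDunkl.gaussMeasure N) ∧
        MeasureTheory.Integrable
          (fun x : Metric.sphere (0 : EuclideanSpace ℝ (Fin N)) 1 =>
            PlanarDunkl.evalE h x.1 * PlanarDunkl.evalE h x.1 * PlanarDunkl.weight κ x.1)
          (PlanarDunkl.sphereMeasure N) ∧
        PlanarDunkl.gaussInner κ h h = PlanarDunkl.pairing κ h h ∧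
        PlanarDunkl.pairing κ h h
          = 2 ^ n * PlanarDunkl.poch ((N : ℝ) / 2 * (((N : ℝ) - 1) * κ + 1)) n
            * PlanarDunkl.sphereInner κ h h) := by
  have hN0 : N ≠ 0 := by omega
  have hNκ := PlanarDunkl.Nκ_gt hN hκ
  refine ⟨fun m => ?_, fun m => ?_, fun m hm => ?_, fun m => ?_, ?_, ?_, ?_⟩
  · obtain ⟨h1, h2⟩ := PlanarDunkl.pairing_self_of_evalPoint_real hN
      (PlanarDunkl.hPlus_isHomogeneous hN κ (2 * m)) (PlanarDunkl.isPlanar_hPlus hN (2 * m))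
      (PlanarDunkl.isHarmonic_hPlus hN hκ (2 * m)) (PlanarDunkl.evalPoint_hPlus_even hN κ m)
      (PlanarDunkl.Tsum_pow_hPlus_even hN hκ m)
    refine ⟨h2, h1.trans ?_⟩
    rw [two_mul m, pow_add]
    have h3 : (2 : ℝ)⁻¹ ^ m * 2 ^ m = 1 := by rw [← mul_pow]; norm_num
    linear_combination ((2 : ℝ)⁻¹ ^ m
      * (∑ j ∈ Finset.range (m + 1), (2 : ℝ)⁻¹ ^ j
        * (PlanarDunkl.gO j (N * κ - κ + m) / PlanarDunkl.poch (N * κ + m + 1) j)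
        * PlanarDunkl.sConst (m + m) (m - j) κ 1)
      * PlanarDunkl.poch (N * κ - κ + 1) m * PlanarDunkl.poch (N * κ + 1) m) * h3
  · obtain ⟨h1, h2⟩ := PlanarDunkl.pairing_self_of_evalPoint_real hN
      (PlanarDunkl.hPlus_isHomogeneous hN κ (2 * m + 1))
      (PlanarDunkl.isPlanar_hPlus hN (2 * m + 1)) (PlanarDunkl.isHarmonic_hPlus hN hκ (2 * m + 1))
      (PlanarDunkl.evalPoint_hPlus_odd hN κ m) (PlanarDunkl.Tsum_pow_hPlus_odd hN hκ m)
    refine ⟨h2, h1.trans ?_⟩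
    have h3 : (2 : ℝ)⁻¹ ^ (2 * m + 1) * 2 ^ (m + 1) = 2⁻¹ ^ m := by
      rw [show 2 * m + 1 = m + (m + 1) by ring, pow_add, mul_assoc, ← mul_pow]; norm_num
    rw [← h3]
    ring
  · obtain ⟨m, rfl⟩ : ∃ k, m = k + 1 := ⟨m - 1, by omega⟩
    obtain ⟨h1, h2⟩ := PlanarDunkl.pairing_self_of_evalPoint_imag hN
      (PlanarDunkl.hMinus_isHomogeneous hN κ (2 * (m + 1)))
      (PlanarDunkl.isPlanar_hMinus hN (2 * (m + 1)))
      (PlanarDunkl.isHarmonic_hMinus hN hκ (2 * (m + 1)))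
      (PlanarDunkl.evalPoint_hMinus_even hN κ (m + 1)) (PlanarDunkl.Tsum_pow_hMinus_even hN hκ m)
    refine ⟨h2, h1.trans ?_⟩
    have h3 : (2 : ℝ)⁻¹ ^ (2 * (m + 1)) * 2 * 2 ^ (m + 2) = 4 * 2⁻¹ ^ (m + 1) := by
      rw [show 2 * (m + 1) = m + 1 + (m + 1) by ring, pow_add,
        show (2 : ℝ) ^ (m + 2) = 2 ^ (m + 1) * 2 by ring]
      have h4 : (2 : ℝ)⁻¹ ^ (m + 1) * 2 ^ (m + 1) = 1 := by rw [← mul_pow]; norm_num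
      linear_combination 4 * (2 : ℝ)⁻¹ ^ (m + 1) * h4
    rw [← h3, Nat.add_sub_cancel]
    ring
  · obtain ⟨h1, h2⟩ := PlanarDunkl.pairing_self_of_evalPoint_imag hN
      (PlanarDunkl.hMinus_isHomogeneous hN κ (2 * m + 1))
      (PlanarDunkl.isPlanar_hMinus hN (2 * m + 1))
      (PlanarDunkl.isHarmonic_hMinus hN hκ (2 * m + 1))
      (PlanarDunkl.evalPoint_hMinus_odd hN κ m) (PlanarDunkl.Tsum_pow_hMinus_odd hN hκ m)
    refine ⟨h2, h1.trans ?_⟩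
    have h3 : (2 : ℝ)⁻¹ ^ (2 * m + 1) * 2 ^ (m + 1) = 2⁻¹ ^ m := by
      rw [show 2 * m + 1 = m + (m + 1) by ring, pow_add, mul_assoc, ← mul_pow]; norm_num
    rw [← h3]
    ring
  · simpa [PlanarDunkl.evalE_one] using PlanarDunkl.integrable_gaussMeasure hN0 hNκ 1
  · simpa [PlanarDunkl.evalE_one] using PlanarDunkl.integrable_sphereMeasure hN0 hNκ
      (MvPolynomial.isHomogeneous_one (Fin N) ℝ)
  · intro n h hh
    have hhom : h.IsHomogeneous n := by
      rcases hh with rfl | rfl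
      · exact PlanarDunkl.hPlus_isHomogeneous hN κ n
      · exact PlanarDunkl.hMinus_isHomogeneous hN κ n
    have hharm : PlanarDunkl.IsHarmonic κ h := by
      rcases hh with rfl | rfl
      · exact PlanarDunkl.isHarmonic_hPlus hN hκ n
      · exact PlanarDunkl.isHarmonic_hMinus hN hκ n
    have hG := PlanarDunkl.gaussInner_eq_pairing hN0 hNκ hhom hhom hharm
    refine ⟨?_, ?_, hG, ?_⟩
    · simpa only [PlanarDunkl.evalE_mul] using PlanarDunkl.integrable_gaussMeasure hN0 hNκ (h * h)
    · simpa only [PlanarDunkl.evalE_mul] using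
        PlanarDunkl.integrable_sphereMeasure hN0 hNκ (hhom.mul hhom)
    · rw [← hG, PlanarDunkl.gaussInner_eq_sphereInner hN0 hNκ hhom hhom]
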